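/- **Theorem (Semi-random 2-XOR refutation).** A 2-XOR instance $\phi=(V,E,r)$ with $n$ variables and $m$ constraints consists of $V=[n]$, a multiset $E$ of $m$ two-element subsets of $V$ (copies of the same subset are distinguishable), and signs $r:E\to\{\pm1\}$. An assignment $x\in\{\pm1\}^V$ satisfies $e=\{a,b\}\in E$ if $x_ax_b\,r(e)=1$, and $\mathrm{val}_\phi$ is the maximum over $x$ of the fraction of satisfied constraints ($0$ if $m=0$). Let $M_\phi\in\mathbb R^{V\times V}$ have as its entry at $(a,b)$, $a<b$, the sum of $r(e)$ over all copies $e\in E$ of $\{a,b\}$, and all other entries $0$. Let $$\mathrm{sdp}(M)=\max\Big\{\sum_{i,j}M_{ij}\langle u_i,v_j\rangle \;:\; u_i,v_j\in\mathbb R^{2n},\ \|u_i\|,\|v_j\|\le 1\Big\}$$ be the value of the semidefinite relaxation of $\|M\|_{\infty\to1}=\max_{x,y\in\{\pm1\}^n}x^\top My$. There is a deterministic algorithm (a while-program over integer arrays, with cost measured by the number of bits processed) that on every 2-XOR instance $\phi$ with $n$ variables and $m$ constraints runs in time polynomial in $n+m$ and outputs a rational number $A(\phi)$ such that: 1. for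 every instance $\phi$, $\mathrm{val}_\phi\le A(\phi)$; 2. for every instance $\phi$, $\mathrm{sdp}(M_\phi)\le(2A(\phi)-1)\,m\le\mathrm{sdp}(M_\phi)+1$, i.e. the bound that is certified is the SDP value, computed up to an additive error of $1$; 3. for every $c\in\mathbb N$ there is a constant $K>0$, depending only on $c$, such that for all $n\ge1$, all $m$, all $0<\varepsilon<1/2$ with $m\ge Kn/\varepsilon^2$, and every multiset $E$ of $m$ two-element subsets of $[n]$, $$\Pr_r\big[A([n],E,r)\le \tfrac12+\varepsilon\big]\ \ge\ 1-n^{-c},$$ where $r$ is uniformly random among all functions $E\to\{\pm1\}$. In particular, when $m\ge Kn/\varepsilon^2$, the algorithm certifies $\mathrm{val}_\phi\le\frac12+\varepsilon$ in polynomial time with high probability over the signs of a semi-random instance. -/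

import Mathlib

namespace TwoXORRefutation

/-! ### 2-XOR instances -/

/-- Two-element subsets `{a, b}` of the variable set `Fin n`, each represented by its
increasing enumeration `a < b`. -/
abbrev Edge (n : ℕ) : Type := {p : Fin n × Fin n // p.1 < p.2}

/-- A 2-XOR instance with `n` variables and `m` constraints: a multiset of `m` edges (listed as a
family, so repetitions are allowed and the copies are distinguishable) and a sign for each of
them. Signs are the elements `1` and `-1` of `ℤˣ`. -/
structure Instance (n m : ℕ) where
  edge : Fin m → Edge n
  sign : Fin m → ℤˣ

/-- The fraction of the constraints satisfied by the assignment `x`; the constraint `j` on the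
edge `{a, b}` is satisfied when `x a * x b * sign j = 1`. -/
noncomputable def Instance.valAt {n m : ℕ} (φ : Instance n m) (x : Fin n → ℤˣ) : ℝ :=
  ((Finset.univ.filter fun j : Fin m =>
      x (φ.edge j).1.1 * x (φ.edge j).1.2 * φ.sign j = 1).card : ℝ) / (m : ℝ)

/-- The value of an instance: the maximum over the (finitely many) assignments of the fraction of
satisfied constraints. -/
noncomputable def Instance.val {n m : ℕ} (φ : Instance n m) : ℝ :=
  ⨆ x : Fin n → ℤˣ, φ.valAt x

/-- The constraint matrix: the entry at `(a, b)` is the sum of the signs of all the copies of the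
edge `{a, b}` with `a < b`, and all the other entries are `0`. -/
noncomputable def Instance.matrix {n m : ℕ} (φ : Instance n m) : Matrix (Fin n) (Fin n) ℝ :=
  fun a b => ∑ j : Fin m, if (φ.edge j).1 = (a, b) then (((φ.sign j : ℤˣ) : ℤ) : ℝ) else 0

/-- The value of the semidefinite relaxation of the `∞ → 1` norm
`max {xᵀ M y | x, y ∈ {-1, 1} ^ n}` of a matrix: the numbers `x i`, `y j` are replaced by vectors
of the unit ball, and the products by inner products. The dimension `2 * n` loses
nothing, since `2 * n` vectors of any Euclidean space span at most `2 * n` dimensions. -/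
noncomputable def sdpValue {n : ℕ} (M : Matrix (Fin n) (Fin n) ℝ) : ℝ :=
  sSup {t : ℝ | ∃ u v : Fin n → EuclideanSpace ℝ (Fin (2 * n)),
    (∀ i, ‖u i‖ ≤ 1) ∧ (∀ j, ‖v j‖ ≤ 1) ∧ t = ∑ i, ∑ j, M i j * inner ℝ (u i) (v j)}

open Classical in
/-- The probability of an event when the `m` signs are chosen uniformly at random from all the
functions `Fin m → {-1, 1}`. -/
noncomputable def signProb {m : ℕ} (S : (Fin m → ℤˣ) → Prop) : ℝ :=
  ((Finset.univ.filter S).card : ℝ) / (Fintype.card (Fin m → ℤˣ) : ℝ)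

/-! ### While programs on a random access machine, with logarithmic (bit) cost -/

/-- The memory: banks numbered by `ℕ`, each an array of integers indexed by `ℤ`.
A program names the banks it uses by constants, and so uses finitely many. -/
abbrev Memory : Type := ℕ → ℤ → ℤ

/-- Integer expressions. `get a i` reads bank `a` at the address given by the value of `i`. -/
inductive Expr : Type where
  | const : ℤ → Expr
  | get : ℕ → Expr → Expr
  | add : Expr → Expr → Expr
  | sub : Expr → Expr → Expr
  | mul : Expr → Expr → Expr
  | div : Expr → Expr → Expr

/-- The number of binary digits of an integer. -/
def bitSize (z : ℤ) : ℕ := z.natAbs.size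

/-- The value of an expression (`div` is the rounded integer quotient). -/
def Expr.eval (s : Memory) : Expr → ℤ
  | .const z => z
  | .get a i => s a (i.eval s)
  | .add e f => e.eval s + f.eval s
  | .sub e f => e.eval s - f.eval s
  | .mul e f => e.eval s * f.eval s
  | .div e f => e.eval s / f.eval s

/-- The cost of evaluating an expression: every operation costs one plus the number of bits of its
result, so that (with the cost of the subexpressions) operands, addresses and results are all paid
for bit by bit. -/
def Expr.cost (s : Memory) : Expr → ℕ
  | .const z => 1 + bitSize z
  | .get a i => 1 + bitSize (s a (i.eval s)) + i.cost s
  | .add e f => 1 + bitSize (e.eval s + f.eval s) + e.cost s + f.cost s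
  | .sub e f => 1 + bitSize (e.eval s - f.eval s) + e.cost s + f.cost s
  | .mul e f => 1 + bitSize (e.eval s * f.eval s) + e.cost s + f.cost s
  | .div e f => 1 + bitSize (e.eval s / f.eval s) + e.cost s + f.cost s

/-- Programs. `assign a i e` stores the value of `e` in bank `a` at the address `i`;
a test `e` counts as true when the value of `e` is positive. -/
inductive Prog : Type where
  | skip : Prog
  | assign : ℕ → Expr → Expr → Prog
  | seq : Prog → Prog → Prog
  | ite : Expr → Prog → Prog → Prog
  | loop : Expr → Prog → Prog

/-- The memory after `z` has been stored in bank `a` at the address `i`. -/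
def Memory.set (s : Memory) (a : ℕ) (i z : ℤ) : Memory :=
  Function.update s a (Function.update (s a) i z)

/-- `Exec p s s' t`: started in the memory `s`, the program `p` halts in the memory `s'` after time
`t`. The program `loop e p` executes `p` while `e` is positive. -/
inductive Exec : Prog → Memory → Memory → ℕ → Prop where
  | skip (s : Memory) : Exec .skip s s 1
  | assign (s : Memory) (a : ℕ) (i e : Expr) :
      Exec (.assign a i e) s (s.set a (i.eval s) (e.eval s)) (1 + i.cost s + e.cost s)
  | seq {p q : Prog} {s s' s'' : Memory} {t t' : ℕ} :
      Exec p s s' t → Exec q s' s'' t' → Exec (.seq p q) s s'' (t + t')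
  | ite_pos {e : Expr} {p q : Prog} {s s' : Memory} {t : ℕ} :
      0 < e.eval s → Exec p s s' t → Exec (.ite e p q) s s' (1 + e.cost s + t)
  | ite_neg {e : Expr} {p q : Prog} {s s' : Memory} {t : ℕ} :
      ¬ 0 < e.eval s → Exec q s s' t → Exec (.ite e p q) s s' (1 + e.cost s + t)
  | loop_done {e : Expr} {p : Prog} {s : Memory} :
      ¬ 0 < e.eval s → Exec (.loop e p) s s (1 + e.cost s)
  | loop_step {e : Expr} {p : Prog} {s s' s'' : Memory} {t t' : ℕ} :
      0 < e.eval s → Exec p s s' t → Exec (.loop e p) s' s'' t' →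
      Exec (.loop e p) s s'' (1 + e.cost s + t + t')

/-- Execution is deterministic: the final memory and the time are functions of the initial
memory. -/
theorem Exec.deterministic {p : Prog} {s s₁ s₂ : Memory} {t₁ t₂ : ℕ}
    (h₁ : Exec p s s₁ t₁) (h₂ : Exec p s s₂ t₂) : s₁ = s₂ ∧ t₁ = t₂ := by
  induction h₁ generalizing s₂ t₂ with
  | skip s => cases h₂; exact ⟨rfl, rfl⟩
  | assign s a i e => cases h₂; exact ⟨rfl, rfl⟩
  | seq _ _ ih ih' =>
    cases h₂ with
    | seq k k' =>
      obtain ⟨rfl, rfl⟩ := ih k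
      obtain ⟨rfl, rfl⟩ := ih' k'
      exact ⟨rfl, rfl⟩
  | ite_pos hc _ ih =>
    cases h₂ with
    | ite_pos _ k => obtain ⟨rfl, rfl⟩ := ih k; exact ⟨rfl, rfl⟩
    | ite_neg hn _ => exact absurd hc hn
  | ite_neg hc _ ih =>
    cases h₂ with
    | ite_pos hn _ => exact absurd hn hc
    | ite_neg _ k => obtain ⟨rfl, rfl⟩ := ih k; exact ⟨rfl, rfl⟩
  | loop_done hc =>
    cases h₂ with
    | loop_done _ => exact ⟨rfl, rfl⟩
    | loop_step hn _ _ => exact absurd hn hc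
  | loop_step hc _ _ ih ih' =>
    cases h₂ with
    | loop_done hn => exact absurd hc hn
    | loop_step _ k k' =>
      obtain ⟨rfl, rfl⟩ := ih k
      obtain ⟨rfl, rfl⟩ := ih' k'
      exact ⟨rfl, rfl⟩

/-- The array with the entries `f 0, …, f (m - 1)`, followed and preceded by zeros. -/
def array {m : ℕ} (f : Fin m → ℤ) : ℤ → ℤ := fun i =>
  if h : 0 ≤ i ∧ i < (m : ℤ) then f ⟨i.toNat, by omega⟩ else 0

/-- The input of a program: bank `0` holds `n` and `m`, banks `1` and `2` the two variables (numbered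
from `0`) of each constraint, and bank `3` its sign. Everything else is `0`. -/
def Instance.input {n m : ℕ} (φ : Instance n m) : Memory
  | 0 => array ![(n : ℤ), (m : ℤ)]
  | 1 => array fun j => (((φ.edge j).1.1 : ℕ) : ℤ)
  | 2 => array fun j => (((φ.edge j).1.2 : ℕ) : ℤ)
  | 3 => array fun j => ((φ.sign j : ℤˣ) : ℤ)
  | _ => fun _ => 0

/-- The function `A` from 2-XOR instances to rational numbers is computed by one program in time
polynomial in `n + m`. The result is returned as a fraction whose numerator and (positive)
denominator are stored in bank `4`, at the addresses `0` and `1`. -/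
def PolyTimeComputable (A : (n m : ℕ) → Instance n m → ℚ) : Prop :=
  ∃ (p : Prog) (T : Polynomial ℕ), ∀ (n m : ℕ) (φ : Instance n m),
    ∃ (s : Memory) (t : ℕ), Exec p φ.input s t ∧ t ≤ T.eval (n + m) ∧
      0 < s 4 1 ∧ A n m φ = (s 4 0 : ℚ) / (s 4 1 : ℚ)

end TwoXORRefutation

/-!
The algorithm solves the semidefinite program by a dual subgradient method in exact integer
arithmetic, and outputs `1 / 2 + (S + 1 / 2) / (2 * m)`, where `S` is the value it finds.

*The method.* Put the vectors `u`, `v` of the relaxation together into a positive semidefinite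
matrix `X` of order `2 * n` with `X i i = 1`. Multipliers for these constraints turn the problem
into the maximization of a linear function over the positive semidefinite matrices of trace
`2 * n`, that is, into the computation of a largest eigenvalue. Eigenvalues are avoided: a high
power of a positive semidefinite matrix `A`, scaled to the right trace, is nearly a maximizer of
the inner product with `A`, because the weights `λ ^ p` concentrate on the largest eigenvalues `λ`
(`trace_mul_le_trace_pow`). So the response to the multipliers is a matrix power, of which only
the diagonal and the objective value are rounded and kept (`exists_response`). The multipliers
then move along the violation of the constraints. The sum of their squares is a potential. That it
is nonnegative shows that the mean objective value is nearly at least the optimum; that it is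
small, by comparison with the identity matrix, shows that the mean response is nearly feasible, so
that its objective value is nearly at most the optimum. Hence `S` is within `1 / 2` of the
semidefinite value (`total_bounds`).

*The certificate.* An assignment is a feasible point of the relaxation, which gives
`val_le_refute`. For random signs, a Chernoff bound and a union bound over the `4 ^ n` pairs of
sign vectors control the combinatorial `∞ → 1` norm, and Grothendieck's inequality
(`sdpValue_le_of_signs`) transfers this to the semidefinite value with a loss of a constant factor
(`signProb_sdpValue_le`).

*The running time.* All the matrices are integral with entries of polynomially many bits, since the
number of steps and the exponent are polynomials in `n + m`. The program consists of `for` loops,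
and `Runs` bounds the time of a loop by the number of its passes, the length of its code, and the
number of bits of a memory cell. Each phase of the program is then described by its effect on the
banks of the memory (`Steps`), up to the whole program (`runs_refute`).
-/


/-! ### Gram matrices and the semidefinite value -/

namespace TwoXORRefutation

/-- A positive semidefinite matrix is the Gram matrix of vectors of a Euclidean space whose
dimension is the size of the matrix. -/
theorem exists_gram_vectors {ι : Type*} [Fintype ι] [DecidableEq ι] {X : Matrix ι ι ℝ}
    (hX : X.PosSemidef) :
    ∃ w : ι → EuclideanSpace ℝ ι, ∀ i j, inner ℝ (w i) (w j) = X i j := by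
  open scoped MatrixOrder Matrix.Norms.L2Operator in
  obtain ⟨B, hB⟩ := CStarAlgebra.nonneg_iff_eq_star_mul_self.mp hX.nonneg
  refine ⟨fun i => WithLp.toLp 2 fun k => B k i, fun i j => ?_⟩
  rw [hB]
  simp [PiLp.inner_apply, Matrix.mul_apply, Matrix.star_eq_conjTranspose, mul_comm]

theorem inner_le_of_norm_le_one {E : Type*} [NormedAddCommGroup E] [InnerProductSpace ℝ E]
    {u v : E} (hu : ‖u‖ ≤ 1) (hv : ‖v‖ ≤ 1) : |inner ℝ u v| ≤ 1 :=
  (abs_real_inner_le_norm u v).trans (by nlinarith [norm_nonneg u, norm_nonneg v])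

theorem bddAbove_sdp {n : ℕ} (M : Matrix (Fin n) (Fin n) ℝ) :
    BddAbove {t : ℝ | ∃ u v : Fin n → EuclideanSpace ℝ (Fin (2 * n)),
      (∀ i, ‖u i‖ ≤ 1) ∧ (∀ j, ‖v j‖ ≤ 1) ∧ t = ∑ i, ∑ j, M i j * inner ℝ (u i) (v j)} := by
  refine ⟨∑ i, ∑ j, |M i j|, ?_⟩
  rintro t ⟨u, v, hu, hv, rfl⟩
  refine Finset.sum_le_sum fun i _ => Finset.sum_le_sum fun j _ => ?_
  refine (le_abs_self _).trans ?_
  rw [abs_mul]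
  exact mul_le_of_le_one_right (abs_nonneg _) (inner_le_of_norm_le_one (hu i) (hv j))

theorem sdpValue_nonneg {n : ℕ} (M : Matrix (Fin n) (Fin n) ℝ) : 0 ≤ sdpValue M :=
  le_csSup (bddAbove_sdp M) ⟨fun _ => 0, fun _ => 0, by simp, by simp, by simp⟩

theorem sdpValue_le {n : ℕ} {M : Matrix (Fin n) (Fin n) ℝ} {b : ℝ}
    (h : ∀ u v : Fin n → EuclideanSpace ℝ (Fin (2 * n)), (∀ i, ‖u i‖ ≤ 1) → (∀ j, ‖v j‖ ≤ 1) →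
      ∑ i, ∑ j, M i j * inner ℝ (u i) (v j) ≤ b) : sdpValue M ≤ b :=
  csSup_le ⟨_, fun _ => 0, fun _ => 0, by simp, by simp, rfl⟩
    (by rintro t ⟨u, v, hu, hv, rfl⟩; exact h u v hu hv)

/-- The index in `Fin (2 * n)` of the vector `u a`, the indices below `n` being those of the
vectors `u` and the other ones those of the vectors `v`. -/
def leftIdx {n : ℕ} (a : Fin n) : Fin (2 * n) := ⟨a, by omega⟩

/-- The index in `Fin (2 * n)` of the vector `v b`. -/
def rightIdx {n : ℕ} (b : Fin n) : Fin (2 * n) := ⟨n + b, by omega⟩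

/-- The objective of the semidefinite program at a positive semidefinite matrix whose diagonal
is at most `c` is at most `c` times the semidefinite value. -/
theorem sum_posSemidef_le_sdpValue {n : ℕ} (M : Matrix (Fin n) (Fin n) ℝ)
    {X : Matrix (Fin (2 * n)) (Fin (2 * n)) ℝ} (hX : X.PosSemidef) {c : ℝ} (hc : 0 < c)
    (hd : ∀ i, X i i ≤ c) :
    ∑ i, ∑ j, M i j * X (leftIdx i) (rightIdx j) ≤ c * sdpValue M := by
  obtain ⟨w, hw⟩ := exists_gram_vectors hX
  set r : ℝ := (Real.sqrt c)⁻¹ with hr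
  have hr2 : r * r = c⁻¹ := by rw [hr, ← mul_inv, Real.mul_self_sqrt hc.le]
  have hnorm : ∀ i, ‖r • w i‖ ≤ 1 := fun i => by
    have h1 : ‖r • w i‖ ^ 2 ≤ 1 := by
      rw [← real_inner_self_eq_norm_sq, inner_smul_left, inner_smul_right, hw, ← mul_assoc]
      simp only [conj_trivial, hr2]
      rw [inv_mul_le_one₀ hc]
      exact hd i
    nlinarith [norm_nonneg (r • w i)]
  have := le_csSup (bddAbove_sdp M) ⟨fun i => r • w (leftIdx i), fun j => r • w (rightIdx j),
    fun i => hnorm _, fun j => hnorm _, rfl⟩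
  have h2 : ∑ i, ∑ j, M i j * inner ℝ (r • w (leftIdx i)) (r • w (rightIdx j)) =
      c⁻¹ * ∑ i, ∑ j, M i j * X (leftIdx i) (rightIdx j) := by
    simp only [Finset.mul_sum, inner_smul_left, inner_smul_right, hw, conj_trivial, ← hr2]
    exact Finset.sum_congr rfl fun i _ => Finset.sum_congr rfl fun j _ => by ring
  rw [h2, inv_mul_le_iff₀ hc] at this
  exact this

/-- The vectors `u` followed by the vectors `v`. -/
def joinVec {n : ℕ} {E : Type*} (u v : Fin n → E) (i : Fin (2 * n)) : E :=
  if h : (i : ℕ) < n then u ⟨i, h⟩ else v ⟨i - n, by omega⟩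

@[simp] theorem joinVec_leftIdx {n : ℕ} {E : Type*} (u v : Fin n → E) (i : Fin n) :
    joinVec u v (leftIdx i) = u i := by simp [joinVec, leftIdx]

@[simp] theorem joinVec_rightIdx {n : ℕ} {E : Type*} (u v : Fin n → E) (i : Fin n) :
    joinVec u v (rightIdx i) = v i := by simp [joinVec, rightIdx]

theorem joinVec_prop {n : ℕ} {E : Type*} {u v : Fin n → E} {p : E → Prop} (hu : ∀ i, p (u i))
    (hv : ∀ i, p (v i)) (i : Fin (2 * n)) : p (joinVec u v i) := by
  unfold joinVec
  split_ifs
  · exact hu _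
  · exact hv _

/-- Vectors of an arbitrary Euclidean space do not give more than those of `2 * n` dimensions. -/
theorem sum_inner_le_sdpValue {n : ℕ} (M : Matrix (Fin n) (Fin n) ℝ) {E : Type*}
    [NormedAddCommGroup E] [InnerProductSpace ℝ E] (u v : Fin n → E) {c : ℝ} (hc : 0 < c)
    (hu : ∀ i, ‖u i‖ ^ 2 ≤ c) (hv : ∀ j, ‖v j‖ ^ 2 ≤ c) :
    ∑ i, ∑ j, M i j * inner ℝ (u i) (v j) ≤ c * sdpValue M := by
  have h := sum_posSemidef_le_sdpValue M (Matrix.posSemidef_gram ℝ (joinVec u v)) hc (fun i => by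
    simp only [Matrix.gram_apply, real_inner_self_eq_norm_sq]
    exact joinVec_prop (p := fun x => ‖x‖ ^ 2 ≤ c) hu hv i)
  simpa [Matrix.gram_apply] using h

end TwoXORRefutation

/-! ### Grothendieck's inequality -/

namespace TwoXORRefutation

/-- The real number `1` or `-1` that a sign stands for. -/
def sgn (s : ℤˣ) : ℝ := ((s : ℤ) : ℝ)

@[simp] theorem sgn_one : sgn 1 = 1 := by simp [sgn]

@[simp] theorem sgn_neg_one : sgn (-1) = -1 := by simp [sgn]

theorem sgn_mul (s t : ℤˣ) : sgn (s * t) = sgn s * sgn t := by simp [sgn]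

theorem exists_sgn_mul_eq_abs (c : ℝ) : ∃ s : ℤˣ, sgn s * c = |c| := by
  rcases le_total 0 c with h | h
  · exact ⟨1, by simp [abs_of_nonneg h]⟩
  · exact ⟨-1, by simp [abs_of_nonpos h]⟩

theorem sum_sign (f : ℤˣ → ℝ) : ∑ s, f s = f 1 + f (-1) := by
  rw [show (Finset.univ : Finset ℤˣ) = {1, -1} from rfl]
  exact Finset.sum_pair (by decide)

theorem sum_signs_succ {d : ℕ} (f : (Fin (d + 1) → ℤˣ) → ℝ) :
    ∑ g, f g = ∑ g : Fin d → ℤˣ, (f (Fin.cons 1 g) + f (Fin.cons (-1) g)) := by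
  rw [← (Fin.consEquiv fun _ => ℤˣ).sum_comp, Fintype.sum_prod_type, sum_sign,
    ← Finset.sum_add_distrib]
  rfl

/-- The linear form with the coefficients `u` at a point of the discrete cube. -/
def signForm {d : ℕ} (u : Fin d → ℝ) (g : Fin d → ℤˣ) : ℝ := ∑ i, u i * sgn (g i)

theorem signForm_cons {d : ℕ} (u : Fin (d + 1) → ℝ) (s : ℤˣ) (g : Fin d → ℤˣ) :
    signForm u (Fin.cons s g) = u 0 * sgn s + signForm (fun i => u i.succ) g := by
  simp [signForm, Fin.sum_univ_succ]

theorem sum_signForm_mul {d : ℕ} (u v : Fin d → ℝ) :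
    ∑ g, signForm u g * signForm v g = 2 ^ d * ∑ i, u i * v i := by
  induction d with
  | zero => simp [signForm]
  | succ d ih =>
    have h := ih (fun i => u i.succ) (fun i => v i.succ)
    rw [sum_signs_succ]
    calc _ = ∑ g : Fin d → ℤˣ, (2 * (u 0 * v 0) + 2 *
            (signForm (fun i => u i.succ) g * signForm (fun i => v i.succ) g)) := by
          refine Finset.sum_congr rfl fun g _ => ?_
          simp only [signForm_cons, sgn_one, sgn_neg_one]
          ring
      _ = _ := by
          rw [Finset.sum_add_distrib, Finset.sum_const, ← Finset.mul_sum, h, Fin.sum_univ_succ]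
          simp
          ring

/-- The fourth moment of a Rademacher sum. -/
theorem sum_signForm_pow_four_le {d : ℕ} (u : Fin d → ℝ) :
    ∑ g, signForm u g ^ 4 ≤ 2 ^ d * (3 * (∑ i, u i ^ 2) ^ 2) := by
  induction d with
  | zero => simp [signForm]
  | succ d ih =>
    have h := ih (fun i => u i.succ)
    have h2 := sum_signForm_mul (fun i => u i.succ) (fun i => u i.succ)
    rw [sum_signs_succ]
    calc _ = ∑ g : Fin d → ℤˣ, (2 * u 0 ^ 4 + 12 * u 0 ^ 2 *
            (signForm (fun i => u i.succ) g * signForm (fun i => u i.succ) g) +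
            2 * signForm (fun i => u i.succ) g ^ 4) := by
          refine Finset.sum_congr rfl fun g _ => ?_
          simp only [signForm_cons, sgn_one, sgn_neg_one]
          ring
      _ ≤ _ := by
          rw [Finset.sum_add_distrib, Finset.sum_add_distrib, ← Finset.mul_sum,
            ← Finset.mul_sum _ _ (12 * u 0 ^ 2), ← Finset.mul_sum _ _ 2, h2, Fin.sum_univ_succ]
          simp only [← pow_two, Finset.sum_const, Finset.card_univ, Fintype.card_pi,
            Fintype.card_units_int, Finset.prod_const, Fintype.card_fin, nsmul_eq_mul,
            Nat.cast_pow, Nat.cast_ofNat]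
          set S := ∑ i : Fin d, u i.succ ^ 2
          have hp : (0 : ℝ) ≤ 2 ^ d := by positivity
          rw [pow_succ (2 : ℝ) d]
          nlinarith [mul_nonneg hp (sq_nonneg (u 0 ^ 2))]

/-- A bilinear form that is bounded on the vertices of a cube has the same bound on the cube. -/
theorem bilinear_le_of_signs {n : ℕ} {M : Matrix (Fin n) (Fin n) ℝ} {b : ℝ}
    (h : ∀ x y : Fin n → ℤˣ, ∑ i, ∑ j, M i j * (sgn (x i) * sgn (y j)) ≤ b)
    {x y : Fin n → ℝ} {c : ℝ} (hc : 0 ≤ c) (hx : ∀ i, |x i| ≤ c) (hy : ∀ i, |y i| ≤ c) :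
    ∑ i, ∑ j, M i j * (x i * y j) ≤ c ^ 2 * b := by
  choose s hs using fun i => exists_sgn_mul_eq_abs (∑ j, M i j * y j)
  choose t ht using fun j => exists_sgn_mul_eq_abs (∑ i, sgn (s i) * M i j)
  calc ∑ i, ∑ j, M i j * (x i * y j) = ∑ i, x i * ∑ j, M i j * y j := by
        refine Finset.sum_congr rfl fun i _ => ?_
        rw [Finset.mul_sum]
        exact Finset.sum_congr rfl fun j _ => by ring
    _ ≤ ∑ i, c * (sgn (s i) * ∑ j, M i j * y j) := by
        refine Finset.sum_le_sum fun i _ => ?_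
        rw [hs]
        refine (le_abs_self _).trans ?_
        rw [abs_mul]
        exact mul_le_mul_of_nonneg_right (hx i) (abs_nonneg _)
    _ = c * ∑ j, y j * ∑ i, sgn (s i) * M i j := by
        rw [← Finset.mul_sum]
        simp only [Finset.mul_sum]
        rw [Finset.sum_comm]
        refine Finset.sum_congr rfl fun i _ => Finset.sum_congr rfl fun j _ => by ring
    _ ≤ c * ∑ j, c * (sgn (t j) * ∑ i, sgn (s i) * M i j) := by
        refine mul_le_mul_of_nonneg_left (Finset.sum_le_sum fun j _ => ?_) hc
        rw [ht]
        refine (le_abs_self _).trans ?_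
        rw [abs_mul]
        exact mul_le_mul_of_nonneg_right (hy j) (abs_nonneg _)
    _ = c ^ 2 * ∑ i, ∑ j, M i j * (sgn (s i) * sgn (t j)) := by
        simp only [Finset.mul_sum]
        rw [Finset.sum_comm]
        refine Finset.sum_congr rfl fun i _ => Finset.sum_congr rfl fun j _ => by ring
    _ ≤ c ^ 2 * b := mul_le_mul_of_nonneg_left (h s t) (sq_nonneg c)

/-- Truncation at the level `√48`. -/
noncomputable def trunc (x : ℝ) : ℝ := if x ^ 2 ≤ 48 then x else 0

theorem abs_trunc_le (x : ℝ) : |trunc x| ≤ Real.sqrt 48 := by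
  unfold trunc
  split_ifs with h
  · exact Real.abs_le_sqrt h
  · simp

theorem trunc_sq_le (x : ℝ) : trunc x ^ 2 ≤ x ^ 2 := by
  unfold trunc
  split_ifs
  · rfl
  · simpa using sq_nonneg x

theorem sub_trunc_sq_le (x : ℝ) : (x - trunc x) ^ 2 ≤ x ^ 4 / 48 := by
  unfold trunc
  split_ifs with h
  · simp; positivity
  · rw [not_le] at h
    rw [le_div_iff₀ (by norm_num)]
    nlinarith [sq_nonneg x]

/-- **Grothendieck's inequality**, with the constant `96`. Unit vectors `u`, `v` are replaced by
the Rademacher sums `⟨u, g⟩`, `⟨v, g⟩` on the discrete cube, which have the same inner products.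
Truncating these at `√48` makes them at each `g` a bounded solution of the combinatorial problem,
and the truncated parts have `L²` norm at most `1 / 4`, so that they account for at most half
of the semidefinite value. -/
theorem sdpValue_le_of_signs {n : ℕ} {M : Matrix (Fin n) (Fin n) ℝ} {b : ℝ}
    (h : ∀ x y : Fin n → ℤˣ, ∑ i, ∑ j, M i j * (sgn (x i) * sgn (y j)) ≤ b) :
    sdpValue M ≤ 96 * b := by
  suffices hS : sdpValue M ≤ 48 * b + sdpValue M / 2 by linarith
  refine sdpValue_le fun u v hu hv => ?_
  set S := sdpValue M
  let Ω := Fin (2 * n) → ℤˣ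
  have hp : (0 : ℝ) < 2 ^ (2 * n) := by positivity
  let U : Fin n → Ω → ℝ := fun i g => signForm (u i) g
  let V : Fin n → Ω → ℝ := fun i g => signForm (v i) g
  -- second and fourth moments of the Rademacher sum of a vector of the unit ball
  have key : ∀ w : EuclideanSpace ℝ (Fin (2 * n)), ‖w‖ ≤ 1 →
      ∑ g, signForm w g ^ 2 ≤ 2 ^ (2 * n) ∧
      ∑ g, (4 * (signForm w g - trunc (signForm w g))) ^ 2 ≤ 2 ^ (2 * n) := by
    intro w hw
    have h1 : ∑ i, w i ^ 2 ≤ 1 := by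
      have : ‖w‖ ^ 2 = ∑ i, w i ^ 2 := by simp [EuclideanSpace.norm_sq_eq]
      rw [← this]
      nlinarith [norm_nonneg w]
    have h0 : 0 ≤ ∑ i, w i ^ 2 := Finset.sum_nonneg fun i _ => sq_nonneg _
    constructor
    · have := sum_signForm_mul w w
      simp only [← pow_two] at this
      rw [this]
      nlinarith
    · calc _ ≤ ∑ g, (1 / 3) * signForm w g ^ 4 := by
            refine Finset.sum_le_sum fun g _ => ?_
            have := sub_trunc_sq_le (signForm w g)
            nlinarith
        _ ≤ (1 / 3) * (2 ^ (2 * n) * (3 * (∑ i, w i ^ 2) ^ 2)) := by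
            rw [← Finset.mul_sum]
            exact mul_le_mul_of_nonneg_left (sum_signForm_pow_four_le _) (by norm_num)
        _ ≤ 2 ^ (2 * n) := by nlinarith [mul_le_mul h1 h1 h0 zero_le_one]
  have norm_eq : ∀ f : Ω → ℝ, ‖(WithLp.toLp 2 f : EuclideanSpace ℝ Ω)‖ ^ 2 = ∑ g, f g ^ 2 := by
    intro f
    simp [EuclideanSpace.norm_sq_eq]
  have inner_eq : ∀ f f' : Ω → ℝ, inner ℝ (WithLp.toLp 2 f : EuclideanSpace ℝ Ω)
      (WithLp.toLp 2 f') = ∑ g, f g * f' g := by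
    intro f f'
    simp [PiLp.inner_apply, mul_comm]
  have main : 2 ^ (2 * n) * ∑ i, ∑ j, M i j * inner ℝ (u i) (v j) =
      ∑ g, ∑ i, ∑ j, M i j * (trunc (U i g) * trunc (V j g)) +
      (1 / 4) * ∑ i, ∑ j, M i j * (∑ g, (4 * (U i g - trunc (U i g))) * V j g) +
      (1 / 4) * ∑ i, ∑ j, M i j * (∑ g, trunc (U i g) * (4 * (V j g - trunc (V j g)))) := by
    have tt : ∑ g, ∑ i, ∑ j, M i j * (trunc (U i g) * trunc (V j g)) =
        ∑ i, ∑ j, ∑ g, M i j * (trunc (U i g) * trunc (V j g)) := by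
      rw [Finset.sum_comm]
      exact Finset.sum_congr rfl fun i _ => Finset.sum_comm
    rw [tt]
    simp only [Finset.mul_sum]
    rw [← Finset.sum_add_distrib, ← Finset.sum_add_distrib]
    refine Finset.sum_congr rfl fun i _ => ?_
    rw [← Finset.sum_add_distrib, ← Finset.sum_add_distrib]
    refine Finset.sum_congr rfl fun j _ => ?_
    rw [← Finset.sum_add_distrib, ← Finset.sum_add_distrib]
    have := sum_signForm_mul (u i) (v j)
    have h3 : (inner ℝ (u i) (v j) : ℝ) = ∑ k, u i k * v j k := by
      simp [PiLp.inner_apply, mul_comm]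
    rw [h3, mul_left_comm, ← this, Finset.mul_sum]
    refine Finset.sum_congr rfl fun g _ => ?_
    simp only [U, V]
    ring
  have t1 : ∑ g, ∑ i, ∑ j, M i j * (trunc (U i g) * trunc (V j g)) ≤ 2 ^ (2 * n) * (48 * b) := by
    calc _ ≤ ∑ _g : Ω, 48 * b := by
          refine Finset.sum_le_sum fun g _ => ?_
          have := bilinear_le_of_signs h (Real.sqrt_nonneg 48)
            (fun i => abs_trunc_le (U i g)) (fun i => abs_trunc_le (V i g))
          rwa [Real.sq_sqrt (by norm_num)] at this
      _ = _ := by simp [Ω]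
  have t2 := sum_inner_le_sdpValue M
    (fun i => (WithLp.toLp 2 fun g => 4 * (U i g - trunc (U i g)) : EuclideanSpace ℝ Ω))
    (fun j => (WithLp.toLp 2 (V j) : EuclideanSpace ℝ Ω)) hp
    (fun i => by rw [norm_eq]; exact (key _ (hu i)).2)
    (fun j => by rw [norm_eq]; exact (key _ (hv j)).1)
  have t3 := sum_inner_le_sdpValue M
    (fun i => (WithLp.toLp 2 fun g => trunc (U i g) : EuclideanSpace ℝ Ω))
    (fun j => (WithLp.toLp 2 fun g => 4 * (V j g - trunc (V j g)) : EuclideanSpace ℝ Ω)) hp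
    (fun i => by
      rw [norm_eq]
      exact (Finset.sum_le_sum fun g _ => trunc_sq_le _).trans (key _ (hu i)).1)
    (fun j => by rw [norm_eq]; exact (key _ (hv j)).2)
  simp only [inner_eq] at t2 t3
  refine le_of_mul_le_mul_left ?_ hp
  rw [main]
  have : (2 : ℝ) ^ (2 * n) * (48 * b + S / 2) = 2 ^ (2 * n) * (48 * b) +
    (1 / 4) * (2 ^ (2 * n) * S) + (1 / 4) * (2 ^ (2 * n) * S) := by ring
  rw [this]
  gcongr

end TwoXORRefutation

/-! ### Random signs -/

namespace TwoXORRefutation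

/-- Sums over the entries of the constraint matrix are sums over the constraints. -/
theorem sum_matrix_mul {n m : ℕ} (φ : Instance n m) (f : Fin n → Fin n → ℝ) :
    ∑ i, ∑ j, φ.matrix i j * f i j =
      ∑ e, sgn (φ.sign e) * f (φ.edge e).1.1 (φ.edge e).1.2 := by
  simp only [Instance.matrix, Finset.sum_mul]
  calc _ = ∑ i, ∑ e, ∑ j, (if (φ.edge e).1 = (i, j) then sgn (φ.sign e) else 0) * f i j :=
        Finset.sum_congr rfl fun i _ => Finset.sum_comm
    _ = ∑ e, ∑ i, ∑ j, (if (φ.edge e).1 = (i, j) then sgn (φ.sign e) else 0) * f i j :=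
        Finset.sum_comm
    _ = _ := by
        refine Finset.sum_congr rfl fun e _ => ?_
        rw [Finset.sum_eq_single (φ.edge e).1.1, Finset.sum_eq_single (φ.edge e).1.2]
        · simp
        · intro j _ hj
          rw [if_neg fun h => hj (by rw [h]), zero_mul]
        · simp
        · intro i _ hi
          exact Finset.sum_eq_zero fun j _ => by rw [if_neg fun h => hi (by rw [h]), zero_mul]
        · simp

/-- The moment generating function of a sum of random signs with coefficients `1` or `-1`. -/
theorem sum_exp_signs_le {m : ℕ} (a : Fin m → ℤˣ) (l : ℝ) :
    ∑ r : Fin m → ℤˣ, Real.exp (l * ∑ e, sgn (r e) * sgn (a e)) ≤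
      2 ^ m * Real.exp (m * (l ^ 2 / 2)) := by
  have h : ∀ e, ∑ s : ℤˣ, Real.exp (l * (sgn s * sgn (a e))) ≤ 2 * Real.exp (l ^ 2 / 2) := by
    intro e
    have h1 : ∑ s : ℤˣ, Real.exp (l * (sgn s * sgn (a e))) = 2 * Real.cosh l := by
      rw [sum_sign, Real.cosh_eq]
      rcases Int.units_eq_one_or (a e) with h | h <;> rw [h] <;> simp <;> ring
    rw [h1]
    linarith [Real.cosh_le_exp_half_sq l]
  calc _ = ∑ r : Fin m → ℤˣ, ∏ e, Real.exp (l * (sgn (r e) * sgn (a e))) := by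
        refine Finset.sum_congr rfl fun r _ => ?_
        rw [← Real.exp_sum, Finset.mul_sum]
    _ = ∏ e, ∑ s : ℤˣ, Real.exp (l * (sgn s * sgn (a e))) := by
        rw [Finset.prod_univ_sum, Fintype.piFinset_univ]
    _ ≤ ∏ _e : Fin m, 2 * Real.exp (l ^ 2 / 2) :=
        Finset.prod_le_prod (fun e _ => Finset.sum_nonneg fun s _ => (Real.exp_pos _).le)
          fun e _ => h e
    _ = _ := by
        rw [Finset.prod_const, Finset.card_univ, Fintype.card_fin, mul_pow, ← Real.exp_nat_mul]

/-- Hoeffding's bound, as a count of the sign vectors. -/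
theorem card_signs_le {m : ℕ} (a : Fin m → ℤˣ) {t : ℝ} (ht : 0 ≤ t) :
    ((Finset.univ.filter fun r : Fin m → ℤˣ => t * m < ∑ e, sgn (r e) * sgn (a e)).card : ℝ) ≤
      2 ^ m * Real.exp (-(t ^ 2 * m / 2)) := by
  have h : ((Finset.univ.filter fun r : Fin m → ℤˣ =>
      t * m < ∑ e, sgn (r e) * sgn (a e)).card : ℝ) * Real.exp (t * (t * m)) ≤
      2 ^ m * Real.exp (m * (t ^ 2 / 2)) := by
    refine le_trans ?_ (sum_exp_signs_le a t)
    rw [← nsmul_eq_mul, ← Finset.sum_const]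
    refine (Finset.sum_le_sum fun r hr => ?_).trans
      (Finset.sum_le_sum_of_subset_of_nonneg (Finset.filter_subset _ _)
        fun r _ _ => (Real.exp_pos _).le)
    exact Real.exp_le_exp.mpr (mul_le_mul_of_nonneg_left (Finset.mem_filter.mp hr).2.le ht)
  rwa [← le_div_iff₀ (Real.exp_pos _), mul_div_assoc, ← Real.exp_sub,
    show (m : ℝ) * (t ^ 2 / 2) - t * (t * m) = -(t ^ 2 * m / 2) by ring] at h

open Classical in
/-- With probability at least `1 - 4 ^ n * exp (-t² m / 2)` over the signs, the semidefinite value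
is at most `96 * t * m`: the union bound over the vertices of the cube, and Grothendieck's
inequality. -/
theorem signProb_sdpValue_le {n m : ℕ} (E : Fin m → Edge n) {t : ℝ} (ht : 0 ≤ t) :
    1 - 4 ^ n * Real.exp (-(t ^ 2 * m / 2)) ≤
      signProb fun r : Fin m → ℤˣ =>
        sdpValue (Instance.matrix ⟨E, r⟩) ≤ 96 * (t * m) := by
  set G : Finset (Fin m → ℤˣ) :=
    Finset.univ.filter fun r => sdpValue (Instance.matrix ⟨E, r⟩) ≤ 96 * (t * m)
  let bad : (Fin n → ℤˣ) × (Fin n → ℤˣ) → Finset (Fin m → ℤˣ) := fun p =>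
    Finset.univ.filter fun r => t * m < ∑ e, sgn (r e) * sgn (p.1 (E e).1.1 * p.2 (E e).1.2)
  have hsub : Gᶜ ⊆ Finset.univ.biUnion bad := by
    intro r hr
    by_contra hcon
    simp only [Finset.mem_biUnion, Finset.mem_univ, true_and, not_exists, bad,
      Finset.mem_filter, not_lt, Prod.forall] at hcon
    rw [Finset.mem_compl] at hr
    apply hr
    simp only [G, Finset.mem_filter, Finset.mem_univ, true_and]
    refine sdpValue_le_of_signs fun x y => ?_
    rw [sum_matrix_mul]
    simpa only [sgn_mul] using hcon x y
  have hN : (Fintype.card (Fin m → ℤˣ) : ℝ) = 2 ^ m := by simp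
  have hbad : (Gᶜ.card : ℝ) ≤ 4 ^ n * (2 ^ m * Real.exp (-(t ^ 2 * m / 2))) := by
    calc (Gᶜ.card : ℝ) ≤ ∑ p, ((bad p).card : ℝ) := by
          exact_mod_cast (Finset.card_le_card hsub).trans Finset.card_biUnion_le
      _ ≤ ∑ _p : (Fin n → ℤˣ) × (Fin n → ℤˣ), 2 ^ m * Real.exp (-(t ^ 2 * m / 2)) :=
          Finset.sum_le_sum fun p _ => card_signs_le (fun e => p.1 (E e).1.1 * p.2 (E e).1.2) ht
      _ = _ := by
          simp only [Finset.sum_const, Finset.card_univ, Fintype.card_prod, Fintype.card_pi,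
            Fintype.card_units_int, Finset.prod_const, Fintype.card_fin, nsmul_eq_mul,
            Nat.cast_pow, Nat.cast_ofNat, Nat.cast_mul]
          rw [← mul_pow]
          norm_num
  have hG : (G.card : ℝ) = 2 ^ m - Gᶜ.card := by
    rw [← hN, Finset.card_compl, Nat.cast_sub (Finset.card_le_univ G)]
    ring
  have hp : (0 : ℝ) < 2 ^ m := by positivity
  change _ ≤ (G.card : ℝ) / _
  rw [hN, le_div_iff₀ hp, hG]
  linarith

theorem signProb_mono {m : ℕ} {S S' : (Fin m → ℤˣ) → Prop} (h : ∀ r, S r → S' r) :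
    signProb S ≤ signProb S' := by
  refine div_le_div_of_nonneg_right (Nat.cast_le.mpr (Finset.card_le_card ?_)) (Nat.cast_nonneg _)
  intro r hr
  simp only [Finset.mem_filter, Finset.mem_univ, true_and] at hr ⊢
  exact h r hr

/-- The random bound with the failure probability `n ^ (-c)`, using `4 ≤ exp 2` and
`n ≤ exp n`. -/
theorem signProb_sdpValue_le_pow (c : ℕ) {n m : ℕ} (hn : 0 < n) (E : Fin m → Edge n) {t : ℝ}
    (ht : 0 ≤ t) (h : (2 * c + 4) * n ≤ t ^ 2 * m) :
    1 - 1 / (n : ℝ) ^ c ≤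
      signProb fun r : Fin m → ℤˣ =>
        sdpValue (Instance.matrix ⟨E, r⟩) ≤ 96 * (t * m) := by
  refine le_trans ?_ (signProb_sdpValue_le E ht)
  have hn' : (0 : ℝ) < n := by exact_mod_cast hn
  have h4 : (4 : ℝ) ≤ Real.exp 2 := by
    have h := Real.add_one_le_exp (1 : ℝ)
    have : Real.exp 2 = Real.exp 1 * Real.exp 1 := by rw [← Real.exp_add]; norm_num
    nlinarith
  have h1 : (n : ℝ) ≤ Real.exp n := by linarith [Real.add_one_le_exp (n : ℝ)]
  have h2 : (n : ℝ) ^ c ≤ Real.exp (c * n) := by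
    rw [Real.exp_nat_mul]
    exact pow_le_pow_left₀ hn'.le h1 c
  have h3 : 4 ^ n * Real.exp (-(t ^ 2 * m / 2)) ≤ Real.exp (-(c * n)) := by
    calc _ ≤ Real.exp 2 ^ n * Real.exp (-((c + 2) * n)) := by
          gcongr
          linarith
      _ = _ := by
          rw [← Real.exp_nat_mul, ← Real.exp_add]
          ring_nf
  have h5 : Real.exp (-(c * n)) ≤ 1 / (n : ℝ) ^ c := by
    rw [Real.exp_neg, one_div]
    exact inv_anti₀ (pow_pos hn' c) h2
  linarith

end TwoXORRefutation

/-! ### Matrix powers as approximate maximizers over the positive semidefinite cone -/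

namespace TwoXORRefutation

open Matrix

section Oracle

variable {ι : Type*} [Fintype ι] [DecidableEq ι]

theorem trace_mul_nonneg {A X : Matrix ι ι ℝ} (hA : A.PosSemidef) (hX : X.PosSemidef) :
    0 ≤ (A * X).trace := by
  open scoped MatrixOrder Matrix.Norms.L2Operator in
  obtain ⟨B, rfl⟩ := CStarAlgebra.nonneg_iff_eq_star_mul_self.mp hX.nonneg
  rw [← Matrix.mul_assoc, Matrix.trace_mul_comm, ← Matrix.mul_assoc]
  exact (hA.mul_mul_conjTranspose_same B).trace_nonneg

/-- The tangent inequality that makes an eigenvalue below the maximum `y` lose little: the weight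
`x ^ p` is small unless `y - x` is. -/
theorem pow_mul_sub_le {x y : ℝ} (hx : 0 ≤ x) (hxy : x ≤ y) (p : ℕ) :
    (p + 1) * (x ^ p * (y - x)) ≤ y ^ (p + 1) - x ^ (p + 1) := by
  induction p with
  | zero => simp
  | succ p ih =>
    have h1 := mul_le_mul_of_nonneg_left ih hx
    have h2 : 0 ≤ (y ^ (p + 1) - x ^ (p + 1)) * (y - x) :=
      mul_nonneg (sub_nonneg.mpr (pow_le_pow_left₀ hx hxy _)) (sub_nonneg.mpr hxy)
    push_cast
    simp only [pow_succ] at *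
    nlinarith

theorem exists_unitary_diagonal {A : Matrix ι ι ℝ} (hA : A.PosSemidef) :
    ∃ (U : Matrix ι ι ℝ) (l : ι → ℝ), Uᴴ * U = 1 ∧ U * Uᴴ = 1 ∧ (∀ i, 0 ≤ l i) ∧
      A = U * diagonal l * Uᴴ := by
  refine ⟨hA.1.eigenvectorUnitary, hA.1.eigenvalues, ?_, ?_, hA.eigenvalues_nonneg, ?_⟩
  · exact Unitary.coe_star_mul_self hA.1.eigenvectorUnitary
  · exact Unitary.coe_mul_star_self hA.1.eigenvectorUnitary
  · have := hA.1.spectral_theorem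
    rw [Unitary.conjStarAlgAut_apply] at this
    simpa [star_eq_conjTranspose] using this

theorem conj_diagonal_pow {U : Matrix ι ι ℝ} (hU : Uᴴ * U = 1) (hU' : U * Uᴴ = 1) (l : ι → ℝ)
    (p : ℕ) : (U * diagonal l * Uᴴ) ^ p = U * diagonal (fun i => l i ^ p) * Uᴴ := by
  induction p with
  | zero => simp only [pow_zero, diagonal_one, Matrix.mul_one, hU']
  | succ p ih =>
    rw [pow_succ, ih]
    calc _ = U * diagonal (fun i => l i ^ p) * (Uᴴ * U) * diagonal l * Uᴴ := by
          simp only [Matrix.mul_assoc]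
      _ = _ := by
          rw [hU, Matrix.mul_one, Matrix.mul_assoc U, diagonal_mul_diagonal]
          simp only [pow_succ]

theorem trace_conj_diagonal {U : Matrix ι ι ℝ} (hU : Uᴴ * U = 1) (l : ι → ℝ) :
    (U * diagonal l * Uᴴ).trace = ∑ i, l i := by
  rw [Matrix.trace_mul_comm, ← Matrix.mul_assoc, hU, Matrix.one_mul, Matrix.trace_diagonal]

/-- Among the positive semidefinite matrices of a given trace, `A ^ p`, scaled to that trace,
maximizes the inner product with `A` up to a factor that tends to `1` as `p` grows. The point is
that the weights `λ ^ p` concentrate on the largest eigenvalues `λ`. -/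
theorem trace_mul_le_trace_pow {A X : Matrix ι ι ℝ} (hA : A.PosSemidef) (hX : X.PosSemidef)
    (p : ℕ) :
    (1 - (Fintype.card ι : ℝ) / (p + 1)) * (A * X).trace * (A ^ p).trace ≤
      X.trace * (A ^ (p + 1)).trace := by
  obtain ⟨U, l, hU, hU', hl, rfl⟩ := exists_unitary_diagonal hA
  rcases isEmpty_or_nonempty ι with hι | hι
  · simp [Matrix.trace]
  obtain ⟨k, hk⟩ := Finite.exists_max l
  have hAX : ((U * diagonal l * Uᴴ) * X).trace ≤ l k * X.trace := by
    have h1 : (U * diagonal (fun i => l k - l i) * Uᴴ).PosSemidef :=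
      (PosSemidef.diagonal fun i => sub_nonneg.mpr (hk i)).mul_mul_conjTranspose_same U
    have h2 := trace_mul_nonneg h1 hX
    have h3 : U * diagonal (fun i => l k - l i) * Uᴴ = l k • 1 - U * diagonal l * Uᴴ := by
      have : diagonal (fun i => l k - l i) = l k • (1 : Matrix ι ι ℝ) - diagonal l := by
        rw [smul_one_eq_diagonal, diagonal_sub]
      rw [this, Matrix.mul_sub, Matrix.sub_mul, Matrix.mul_smul, Matrix.smul_mul, Matrix.mul_one,
        hU']
    rw [h3, Matrix.sub_mul, Matrix.trace_sub, Matrix.smul_mul, Matrix.trace_smul, Matrix.one_mul,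
      smul_eq_mul] at h2
    linarith
  have hAX0 := trace_mul_nonneg hA hX
  rw [conj_diagonal_pow hU hU', conj_diagonal_pow hU hU', trace_conj_diagonal hU,
    trace_conj_diagonal hU]
  set s := ∑ i, l i ^ p with hs
  have hs0 : 0 ≤ s := Finset.sum_nonneg fun i _ => pow_nonneg (hl i) p
  have hp : (0 : ℝ) < p + 1 := by positivity
  have key : (1 - (Fintype.card ι : ℝ) / (p + 1)) * l k * s ≤ ∑ i, l i ^ (p + 1) := by
    have h1 : (p + 1) * ∑ i, l i ^ p * (l k - l i) ≤ Fintype.card ι * (l k * s) := by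
      have h4 : l k ^ p ≤ s :=
        Finset.single_le_sum (f := fun i => l i ^ p) (fun i _ => pow_nonneg (hl i) p)
          (Finset.mem_univ k)
      rw [Finset.mul_sum, ← nsmul_eq_mul, ← Finset.card_univ, ← Finset.sum_const]
      refine Finset.sum_le_sum fun i _ => ?_
      refine (pow_mul_sub_le (hl i) (hk i) p).trans ?_
      have := mul_le_mul_of_nonneg_left h4 (hl k)
      have := pow_nonneg (hl i) (p + 1)
      rw [pow_succ (l k)]
      linarith
    have h2 : ∑ i, l i ^ p * (l k - l i) = l k * s - ∑ i, l i ^ (p + 1) := by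
      rw [hs, Finset.mul_sum, ← Finset.sum_sub_distrib]
      exact Finset.sum_congr rfl fun i _ => by ring
    rw [h2, mul_comm, ← le_div_iff₀ hp] at h1
    have h3 : (1 - (Fintype.card ι : ℝ) / (p + 1)) * l k * s =
        l k * s - Fintype.card ι * (l k * s) / (p + 1) := by ring
    linarith
  have hX0 := hX.trace_nonneg
  by_cases hq : 0 ≤ 1 - (Fintype.card ι : ℝ) / (p + 1)
  · calc _ ≤ (1 - (Fintype.card ι : ℝ) / (p + 1)) * (l k * X.trace) * s := by gcongr
      _ = X.trace * ((1 - (Fintype.card ι : ℝ) / (p + 1)) * l k * s) := by ring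
      _ ≤ _ := mul_le_mul_of_nonneg_left key hX0
  · rw [not_le] at hq
    have h1 : (1 - (Fintype.card ι : ℝ) / (p + 1)) *
        ((U * diagonal l * Uᴴ) * X).trace * s ≤ 0 :=
      mul_nonpos_of_nonpos_of_nonneg (mul_nonpos_of_nonpos_of_nonneg hq.le hAX0) hs0
    exact h1.trans (mul_nonneg hX0 (Finset.sum_nonneg fun i _ => pow_nonneg (hl i) _))

theorem trace_pow_pos {A : Matrix ι ι ℝ} (hA : A.PosSemidef) (h : 0 < A.trace) (p : ℕ) :
    0 < (A ^ p).trace := by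
  obtain ⟨U, l, hU, hU', hl, rfl⟩ := exists_unitary_diagonal hA
  rw [trace_conj_diagonal hU] at h
  rw [conj_diagonal_pow hU hU', trace_conj_diagonal hU]
  obtain ⟨i, -, hi⟩ := Finset.exists_ne_zero_of_sum_ne_zero h.ne'
  exact Finset.sum_pos' (fun i _ => pow_nonneg (hl i) p)
    ⟨i, Finset.mem_univ i, pow_pos (lt_of_le_of_ne (hl i) (Ne.symm hi)) p⟩

end Oracle

end TwoXORRefutation

/-! ### The subgradient method -/

namespace TwoXORRefutation

open Matrix

theorem leftIdx_ne_rightIdx {n : ℕ} (a b : Fin n) : leftIdx a ≠ rightIdx b := by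
  intro h
  have := congrArg Fin.val h
  simp [leftIdx, rightIdx] at this
  omega

/-- The symmetric matrix `[[0, M], [Mᵀ, 0]]`, for the constraint matrix `M`. -/
def Instance.sym {n m : ℕ} (φ : Instance n m) : Matrix (Fin (2 * n)) (Fin (2 * n)) ℤ :=
  fun i j => ∑ e : Fin m, ((φ.sign e : ℤˣ) : ℤ) *
    ((if i = leftIdx (φ.edge e).1.1 ∧ j = rightIdx (φ.edge e).1.2 then 1 else 0) +
      if i = rightIdx (φ.edge e).1.2 ∧ j = leftIdx (φ.edge e).1.1 then 1 else 0)

/-- The real matrix with the same entries as an integer matrix. -/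
abbrev toReal {ι : Type*} (A : Matrix ι ι ℤ) : Matrix ι ι ℝ := A.map (Int.castRingHom ℝ)

theorem toReal_apply {ι : Type*} (A : Matrix ι ι ℤ) (i j : ι) : toReal A i j = (A i j : ℝ) := rfl

theorem trace_toReal {ι : Type*} [Fintype ι] (A : Matrix ι ι ℤ) :
    (toReal A).trace = (A.trace : ℝ) := by
  simp [Matrix.trace]

theorem cast_sum_mul {ι : Type*} [Fintype ι] (A B : Matrix ι ι ℤ) :
    ((∑ i, ∑ j, A i j * B i j : ℤ) : ℝ) = ∑ i, ∑ j, (A i j : ℝ) * toReal B i j := by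
  push_cast
  rfl

theorem sum_sym_mul {n m : ℕ} (φ : Instance n m) (f : Fin (2 * n) → Fin (2 * n) → ℝ) :
    ∑ i, ∑ j, (φ.sym i j : ℝ) * f i j =
      ∑ e, sgn (φ.sign e) * (f (leftIdx (φ.edge e).1.1) (rightIdx (φ.edge e).1.2) +
        f (rightIdx (φ.edge e).1.2) (leftIdx (φ.edge e).1.1)) := by
  have aux : ∀ a b : Fin (2 * n),
      ∑ i, ∑ j, (if i = a ∧ j = b then (1 : ℝ) else 0) * f i j = f a b := by
    intro a b
    rw [Finset.sum_eq_single a, Finset.sum_eq_single b]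
    · simp
    · intro j _ hj
      simp [hj]
    · simp
    · intro i _ hi
      simp [hi]
    · simp
  simp only [Instance.sym, Int.cast_sum, Finset.sum_mul]
  calc _ = ∑ i, ∑ e, ∑ j, (((φ.sign e : ℤˣ) : ℤ) *
    ((if i = leftIdx (φ.edge e).1.1 ∧ j = rightIdx (φ.edge e).1.2 then 1 else 0) +
      if i = rightIdx (φ.edge e).1.2 ∧ j = leftIdx (φ.edge e).1.1 then 1 else 0) : ℤ) * f i j :=
        Finset.sum_congr rfl fun i _ => Finset.sum_comm
    _ = ∑ e, ∑ i, ∑ j, (((φ.sign e : ℤˣ) : ℤ) *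
    ((if i = leftIdx (φ.edge e).1.1 ∧ j = rightIdx (φ.edge e).1.2 then 1 else 0) +
      if i = rightIdx (φ.edge e).1.2 ∧ j = leftIdx (φ.edge e).1.1 then 1 else 0) : ℤ) * f i j :=
        Finset.sum_comm
    _ = _ := by
        refine Finset.sum_congr rfl fun e _ => ?_
        rw [← aux, ← aux (rightIdx _), ← Finset.sum_add_distrib, Finset.mul_sum]
        refine Finset.sum_congr rfl fun i _ => ?_
        rw [← Finset.sum_add_distrib, Finset.mul_sum]
        refine Finset.sum_congr rfl fun j _ => ?_
        push_cast
        simp only [sgn]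
        ring

theorem sym_transpose {n m : ℕ} (φ : Instance n m) : φ.symᵀ = φ.sym := by
  ext i j
  simp only [Instance.sym, transpose_apply]
  refine Finset.sum_congr rfl fun e _ => ?_
  rw [add_comm]
  simp only [and_comm]

theorem sym_diag {n m : ℕ} (φ : Instance n m) (i : Fin (2 * n)) : φ.sym i i = 0 := by
  simp only [Instance.sym]
  refine Finset.sum_eq_zero fun e _ => ?_
  rw [if_neg, if_neg]
  · simp
  · rintro ⟨h1, h2⟩
    exact leftIdx_ne_rightIdx _ _ (h2.symm.trans h1)
  · rintro ⟨h1, h2⟩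
    exact leftIdx_ne_rightIdx _ _ (h1.symm.trans h2)

theorem abs_sym_le {n m : ℕ} (φ : Instance n m) (i j : Fin (2 * n)) : |φ.sym i j| ≤ 2 * m := by
  refine (Finset.abs_sum_le_sum_abs _ _).trans ?_
  calc _ ≤ ∑ _e : Fin m, (2 : ℤ) := by
        refine Finset.sum_le_sum fun e _ => ?_
        rcases Int.units_eq_one_or (φ.sign e) with h | h <;> rw [h] <;> split_ifs <;> simp
    _ = _ := by simp [mul_comm]

/-- The inner product of the constraint matrix, symmetrized, with a matrix. -/
noncomputable def Instance.pair {n m : ℕ} (φ : Instance n m)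
    (X : Matrix (Fin (2 * n)) (Fin (2 * n)) ℝ) : ℝ := ∑ i, ∑ j, (φ.sym i j : ℝ) * X i j

theorem pair_eq_trace {n m : ℕ} (φ : Instance n m) (X : Matrix (Fin (2 * n)) (Fin (2 * n)) ℝ) :
    φ.pair X = (toReal φ.sym * X).trace := by
  conv_rhs => rw [← sym_transpose]
  simp only [Matrix.trace, Matrix.diag, Matrix.mul_apply, Instance.pair, toReal, Matrix.map_apply,
    transpose_apply, Int.coe_castRingHom]
  exact Finset.sum_comm

theorem pair_eq_of_isHermitian {n m : ℕ} (φ : Instance n m)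
    {X : Matrix (Fin (2 * n)) (Fin (2 * n)) ℝ} (hX : X.IsHermitian) :
    φ.pair X = 2 * ∑ i, ∑ j, φ.matrix i j * X (leftIdx i) (rightIdx j) := by
  rw [Instance.pair, sum_sym_mul φ X, sum_matrix_mul φ fun i j => X (leftIdx i) (rightIdx j),
    Finset.mul_sum]
  refine Finset.sum_congr rfl fun e _ => ?_
  have := hX.apply (leftIdx (φ.edge e).1.1) (rightIdx (φ.edge e).1.2)
  simp only [star_trivial] at this
  rw [this]
  ring

theorem abs_apply_le_trace_of_posSemidef {ι : Type*} [Fintype ι] [DecidableEq ι] {X : Matrix ι ι ℝ}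
    (hX : X.PosSemidef) (i j : ι) : |X i j| ≤ X.trace := by
  obtain ⟨w, hw⟩ := exists_gram_vectors hX
  have hd : ∀ k, ‖w k‖ ^ 2 ≤ X.trace := fun k => by
    rw [← real_inner_self_eq_norm_sq, hw]
    exact Finset.single_le_sum (f := fun k => X k k) (fun k _ => hX.diag_nonneg)
      (Finset.mem_univ k)
  rw [← hw]
  refine (abs_real_inner_le_norm _ _).trans ?_
  nlinarith [hd i, hd j, sq_nonneg (‖w i‖ - ‖w j‖)]

theorem abs_pair_le {n m : ℕ} (φ : Instance n m) {X : Matrix (Fin (2 * n)) (Fin (2 * n)) ℝ}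
    (hX : X.PosSemidef) : |φ.pair X| ≤ 2 * m * X.trace := by
  rw [Instance.pair, sum_sym_mul φ X]
  refine (Finset.abs_sum_le_sum_abs _ _).trans ?_
  calc _ ≤ ∑ _e : Fin m, 2 * X.trace := by
        refine Finset.sum_le_sum fun e _ => ?_
        have h1 := abs_le.mp (abs_apply_le_trace_of_posSemidef hX (leftIdx (φ.edge e).1.1)
          (rightIdx (φ.edge e).1.2))
        have h2 := abs_le.mp (abs_apply_le_trace_of_posSemidef hX (rightIdx (φ.edge e).1.2)
          (leftIdx (φ.edge e).1.1))
        rcases Int.units_eq_one_or (φ.sign e) with h | h <;> rw [h, abs_le] <;>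
          constructor <;> simp <;> linarith [h1.1, h1.2, h2.1, h2.2]
    _ = _ := by simp; ring

theorem posSemidef_add_sym {n m : ℕ} (φ : Instance n m) :
    ((2 * m : ℝ) • (1 : Matrix (Fin (2 * n)) (Fin (2 * n)) ℝ) + toReal φ.sym).PosSemidef := by
  refine PosSemidef.of_dotProduct_mulVec_nonneg ?_ fun x => ?_
  · ext i j
    have := congrFun (congrFun (sym_transpose φ) i) j
    simp only [transpose_apply] at this
    simp [this, one_apply, eq_comm]
  · have h1 := abs_pair_le φ (posSemidef_vecMulVec_self_star x)
    have h2 : (vecMulVec x (star x)).trace = x ⬝ᵥ x := by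
      simp [Matrix.trace, vecMulVec_apply, dotProduct]
    have h3 : x ⬝ᵥ (toReal φ.sym *ᵥ x) = φ.pair (vecMulVec x (star x)) := by
      simp only [dotProduct, mulVec, Instance.pair, Finset.mul_sum, vecMulVec_apply]
      refine Finset.sum_congr rfl fun i _ => Finset.sum_congr rfl fun j _ => ?_
      simp
      ring
    rw [h2] at h1
    rw [star_trivial, add_mulVec, dotProduct_add, h3, smul_mulVec, one_mulVec, dotProduct_smul,
      smul_eq_mul]
    linarith [(abs_le.mp h1).1]

/-! The parameters of the method, in terms of `R`, which exceeds `n + m` by a constant: `R ^ 8`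
is the resolution to which the vector of subgradients is rounded, `R ^ 9` the number of steps and
`R ^ 10 + 1` the exponent of the matrix power. The dual variables are stored as
multiples of `1 / R ^ 12`, which makes the step size `R ^ 8 / R ^ 12 = R ^ (-4)`. -/

/-- `n + m + 1000`. It is irreducible so that its powers are never evaluated. -/
@[irreducible] def size (n m : ℕ) : ℕ := n + m + 1000

/-- The matrix whose large eigenvalues the oracle looks for: the symmetrized constraint matrix
minus the diagonal matrix of the dual variables, scaled to integers, and shifted to be positive
definite. -/
def Instance.shifted {n m : ℕ} (φ : Instance n m) (z : Fin (2 * n) → ℤ) :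
    Matrix (Fin (2 * n)) (Fin (2 * n)) ℤ :=
  ((size n m : ℤ) ^ 12) • φ.sym + diagonal fun i => (size n m : ℤ) ^ 19 - 2 * z i

/-- The matrix power that is the response of the oracle. -/
def Instance.power {n m : ℕ} (φ : Instance n m) (z : Fin (2 * n) → ℤ) :
    Matrix (Fin (2 * n)) (Fin (2 * n)) ℤ :=
  φ.shifted z ^ (size n m ^ 10 + 1)

/-- The diagonal entry of the response, scaled to trace `2 * n`, rounded down to a multiple of
`1 / size n m ^ 8`. -/
def Instance.roundDiag {n m : ℕ} (φ : Instance n m) (z : Fin (2 * n) → ℤ) (i : Fin (2 * n)) : ℤ :=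
  (size n m : ℤ) ^ 8 * (2 * n) * φ.power z i i / (φ.power z).trace

/-- The objective at the response, scaled to trace `2 * n`, rounded down to a multiple of
`1 / size n m ^ 8`. -/
def Instance.roundPair {n m : ℕ} (φ : Instance n m) (z : Fin (2 * n) → ℤ) : ℤ :=
  (size n m : ℤ) ^ 8 * (2 * n) * (∑ i, ∑ j, φ.sym i j * φ.power z i j) / (φ.power z).trace

/-- The dual variables after `t` steps. -/
def Instance.dual {n m : ℕ} (φ : Instance n m) : ℕ → Fin (2 * n) → ℤ
  | 0 => 0
  | t + 1 => fun i => φ.dual t i + (φ.roundDiag (φ.dual t) i - (size n m : ℤ) ^ 8)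

/-- The sum of the first `t` objective values. -/
def Instance.total {n m : ℕ} (φ : Instance n m) (t : ℕ) : ℤ :=
  ∑ k ∈ Finset.range t, φ.roundPair (φ.dual k)

end TwoXORRefutation

/-! ### The responses of the oracle -/

namespace TwoXORRefutation

open Matrix

theorem size_bounds (n m : ℕ) :
    (1000 : ℝ) ≤ size n m ∧ (n : ℝ) ≤ size n m ∧ (m : ℝ) ≤ size n m := by
  rw [size]
  push_cast
  refine ⟨?_, ?_, ?_⟩ <;> linarith [Nat.cast_nonneg (α := ℝ) n, Nat.cast_nonneg (α := ℝ) m]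

theorem cast_ediv_bounds (a : ℤ) {b : ℤ} (hb : 0 < b) :
    (a : ℝ) / b - 1 < ((a / b : ℤ) : ℝ) ∧ ((a / b : ℤ) : ℝ) ≤ (a : ℝ) / b := by
  have hb' : (0 : ℝ) < b := by exact_mod_cast hb
  have h1 : ((a / b * b : ℤ) : ℝ) ≤ a := by exact_mod_cast Int.ediv_mul_le a hb.ne'
  have h2 : (a : ℝ) < (((a / b + 1) * b : ℤ) : ℝ) := by
    exact_mod_cast Int.lt_ediv_add_one_mul_self a hb
  push_cast at h1 h2
  constructor
  · rw [sub_lt_iff_lt_add, div_lt_iff₀ hb']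
    exact h2
  · rw [le_div_iff₀ hb']
    exact h1

theorem toReal_shifted {n m : ℕ} (φ : Instance n m) (z : Fin (2 * n) → ℤ) :
    toReal (φ.shifted z) = ((size n m : ℝ) ^ 12) • toReal φ.sym +
      diagonal fun i => (size n m : ℝ) ^ 19 - 2 * (z i : ℝ) := by
  ext i j
  rw [Instance.shifted, toReal_apply, Matrix.add_apply, Matrix.smul_apply, Matrix.add_apply,
    Matrix.smul_apply, toReal_apply]
  by_cases h : i = j <;> simp [h]

theorem toReal_power {n m : ℕ} (φ : Instance n m) (z : Fin (2 * n) → ℤ) :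
    toReal (φ.power z) = toReal (φ.shifted z) ^ (size n m ^ 10 + 1) :=
  map_pow (Int.castRingHom ℝ).mapMatrix (φ.shifted z) _

theorem posSemidef_shifted {n m : ℕ} (φ : Instance n m) {z : Fin (2 * n) → ℤ}
    (hz : ∀ i, |(z i : ℝ)| ≤ 2 * n * (size n m : ℝ) ^ 17) :
    (toReal (φ.shifted z)).PosSemidef ∧
      ∀ i, 0 < (toReal (φ.shifted z)) i i := by
  obtain ⟨hr, hn, hm⟩ := size_bounds n m
  set r : ℝ := (size n m : ℝ)
  have hr0 : 0 < r := by linarith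
  have hd : ∀ i, 0 < r ^ 19 - 2 * (z i : ℝ) - r ^ 12 * (2 * m) := fun i => by
    have h1 := (abs_le.mp (hz i)).2
    have h2 : 2 * n * r ^ 17 ≤ 2 * r * r ^ 17 := by gcongr
    have h3 : r ^ 12 * (2 * m) ≤ r ^ 12 * (2 * r) := by gcongr
    have h4 : r ^ 13 ≤ r ^ 18 := pow_le_pow_right₀ (by linarith) (by norm_num)
    have h5 : 1000 * r ^ 18 ≤ r * r ^ 18 := by gcongr
    have h6 : 0 < r ^ 18 := by positivity
    nlinarith
  constructor
  · have : toReal (φ.shifted z) = r ^ 12 • ((2 * m : ℝ) • 1 + toReal φ.sym) +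
        diagonal fun i => r ^ 19 - 2 * (z i : ℝ) - r ^ 12 * (2 * m) := by
      rw [toReal_shifted]
      ext i j
      by_cases h : i = j
      · subst h
        simp [r]
        ring
      · simp [h, r]
    rw [this]
    exact ((posSemidef_add_sym φ).smul (by positivity)).add
      (PosSemidef.diagonal fun i => (hd i).le)
  · intro i
    rw [toReal_shifted]
    have := hd i
    have h1 : 0 ≤ r ^ 12 * (2 * m) := by positivity
    simp [sym_diag]
    linarith

theorem trace_shifted_mul {n m : ℕ} (φ : Instance n m) (z : Fin (2 * n) → ℤ)
    (X : Matrix (Fin (2 * n)) (Fin (2 * n)) ℝ) :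
    (toReal (φ.shifted z) * X).trace = (size n m : ℝ) ^ 12 * φ.pair X +
      ((size n m : ℝ) ^ 19 * X.trace - 2 * ∑ i, z i * X i i) := by
  rw [toReal_shifted, Matrix.add_mul, Matrix.trace_add, Matrix.smul_mul, Matrix.trace_smul,
    ← pair_eq_trace, smul_eq_mul]
  congr 1
  simp only [Matrix.trace, Matrix.diag, diagonal_mul, Finset.mul_sum, ← Finset.sum_sub_distrib]
  exact Finset.sum_congr rfl fun i _ => by ring

/-- One call of the oracle: the response, scaled to trace `2 * n`, is an approximate maximizer of
the Lagrangian over the positive semidefinite matrices of this trace, and `roundDiag`, `roundPair`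
are its diagonal and its objective value, rounded. -/
theorem exists_response {n m : ℕ} (φ : Instance n m) (hn : 0 < n) {z : Fin (2 * n) → ℤ}
    (hz : ∀ i, |(z i : ℝ)| ≤ 2 * n * (size n m : ℝ) ^ 17) :
    ∃ X : Matrix (Fin (2 * n)) (Fin (2 * n)) ℝ, X.PosSemidef ∧ X.trace = 2 * n ∧
      (∀ i, (size n m : ℝ) ^ 8 * X i i - 1 < φ.roundDiag z i ∧
        (φ.roundDiag z i : ℝ) ≤ (size n m : ℝ) ^ 8 * X i i) ∧
      ((size n m : ℝ) ^ 8 * φ.pair X - 1 < φ.roundPair z ∧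
        (φ.roundPair z : ℝ) ≤ (size n m : ℝ) ^ 8 * φ.pair X) ∧
      ∀ Y : Matrix (Fin (2 * n)) (Fin (2 * n)) ℝ, Y.PosSemidef → (∀ i, Y i i = 1) →
        (size n m : ℝ) ^ 12 * φ.pair Y + 2 * ∑ i, z i * (X i i - 1) ≤
          (size n m : ℝ) ^ 12 * φ.pair X + 8 * (size n m : ℝ) ^ 11 := by
  obtain ⟨hr, hnr, hm⟩ := size_bounds n m
  obtain ⟨hA, hAd⟩ := posSemidef_shifted φ hz
  set p := size n m ^ 10 + 1 with hp
  set A := toReal (φ.shifted z) with hAdef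
  have hBdef : toReal (φ.power z) = A ^ p := toReal_power φ z
  have hBe : ∀ i j, ((φ.power z i j : ℤ) : ℝ) = (A ^ p) i j := fun i j => by
    rw [← hBdef, toReal_apply]
  have htr : (((φ.power z).trace : ℤ) : ℝ) = (A ^ p).trace := by
    rw [← hBdef, trace_toReal]
  have hB : (A ^ p).PosSemidef := hA.pow p
  have hN : Nonempty (Fin (2 * n)) := ⟨⟨0, by omega⟩⟩
  have htr0 : 0 < (A ^ p).trace :=
    trace_pow_pos hA (Finset.sum_pos (fun i _ => hAd i) Finset.univ_nonempty) p
  have htrZ : 0 < (φ.power z).trace := by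
    rw [← htr] at htr0
    exact_mod_cast htr0
  set c : ℝ := 2 * n / (A ^ p).trace with hc
  have hc0 : 0 ≤ c := by positivity
  have hXtr : (c • A ^ p).trace = 2 * n := by
    rw [Matrix.trace_smul, smul_eq_mul, hc, div_mul_cancel₀ _ htr0.ne']
  set r : ℝ := (size n m : ℝ) with hrdef
  have hr0 : 0 < r := by linarith
  refine ⟨c • A ^ p, hB.smul hc0, hXtr, fun i => ?_, ?_, fun Y hY hY1 => ?_⟩
  · have h := cast_ediv_bounds ((size n m : ℤ) ^ 8 * (2 * n) * φ.power z i i) htrZ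
    rw [htr] at h
    have h2 : (((size n m : ℤ) ^ 8 * (2 * n) * φ.power z i i : ℤ) : ℝ) / (A ^ p).trace =
        r ^ 8 * (c • A ^ p) i i := by
      push_cast
      rw [hBe, Matrix.smul_apply, smul_eq_mul, hc]
      ring
    rw [h2] at h
    rw [Instance.roundDiag]
    exact h
  · have h := cast_ediv_bounds
      ((size n m : ℤ) ^ 8 * (2 * n) * (∑ i, ∑ j, φ.sym i j * φ.power z i j)) htrZ
    rw [htr] at h
    have h2 : (((size n m : ℤ) ^ 8 * (2 * n) * (∑ i, ∑ j, φ.sym i j * φ.power z i j) : ℤ) : ℝ) /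
        (A ^ p).trace = r ^ 8 * φ.pair (c • A ^ p) := by
      have h3 : φ.pair (c • A ^ p) = c * ∑ i, ∑ j, (φ.sym i j : ℝ) * (A ^ p) i j := by
        simp only [Instance.pair, Matrix.smul_apply, smul_eq_mul, Finset.mul_sum]
        exact Finset.sum_congr rfl fun i _ => Finset.sum_congr rfl fun j _ => by ring
      rw [Int.cast_mul, cast_sum_mul, hBdef, h3, hc]
      push_cast
      ring
    rw [h2] at h
    rw [Instance.roundPair]
    exact h
  · have hYtr : Y.trace = 2 * n := by simp [Matrix.trace, hY1]
    have h1 := trace_mul_le_trace_pow hA hY p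
    have h2 : (A * (c • A ^ p)).trace = 2 * n * (A ^ (p + 1)).trace / (A ^ p).trace := by
      rw [Matrix.mul_smul, ← pow_succ', Matrix.trace_smul, smul_eq_mul, hc]
      ring
    rw [hYtr, ← le_div_iff₀ htr0, ← h2, hAdef, trace_shifted_mul, trace_shifted_mul, ← hAdef, hXtr,
      hYtr, Fintype.card_fin] at h1
    simp only [← hrdef] at h1
    set a := r ^ 12 * φ.pair Y + (r ^ 19 * (2 * n) - 2 * ∑ i, z i * Y i i) with ha
    -- the loss of the oracle is `2 * n * a / (p + 1)`
    have hn0 : (0 : ℝ) ≤ n := Nat.cast_nonneg n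
    have ha2 : a ≤ 4 * r ^ 20 := by
      have h3 := (abs_le.mp (abs_pair_le φ hY)).2
      rw [hYtr] at h3
      have h4 : -(2 * ∑ i, z i * Y i i) ≤ 2 * (2 * n * (2 * n * r ^ 17)) := by
        have : -∑ i, (z i : ℝ) * Y i i ≤ ∑ _i : Fin (2 * n), 2 * n * r ^ 17 := by
          rw [← Finset.sum_neg_distrib]
          refine Finset.sum_le_sum fun i _ => ?_
          rw [hY1, mul_one]
          linarith [(abs_le.mp (hz i)).1]
        simp only [Finset.sum_const, Finset.card_univ, Fintype.card_fin, nsmul_eq_mul] at this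
        push_cast at this
        linarith
      have h5 : r ^ 12 * φ.pair Y ≤ r ^ 12 * (2 * r * (2 * r)) :=
        mul_le_mul_of_nonneg_left (h3.trans (by gcongr)) (by positivity)
      have h6 : r ^ 19 * (2 * n) ≤ r ^ 19 * (2 * r) := by gcongr
      have h7 : 2 * (2 * n * (2 * n * r ^ 17)) ≤ 2 * (2 * r * (2 * r * r ^ 17)) := by gcongr
      have h8 : r ^ 14 ≤ r ^ 19 := pow_le_pow_right₀ (by linarith) (by norm_num)
      have h9 : 1000 * r ^ 19 ≤ r * r ^ 19 := by gcongr
      have h10 : 0 < r ^ 19 := by positivity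
      nlinarith
    have hpR : r ^ 10 ≤ (p : ℝ) + 1 := by rw [hp]; push_cast; linarith
    have hloss : ((2 * n : ℕ) : ℝ) / (p + 1) * a ≤ 8 * r ^ 11 := by
      calc ((2 * n : ℕ) : ℝ) / (p + 1) * a ≤ 2 * r / r ^ 10 * (4 * r ^ 20) := by
            push_cast
            have : 0 ≤ a := by
              have := trace_mul_nonneg hA hY
              rw [hAdef, trace_shifted_mul, hYtr] at this
              exact this
            gcongr
        _ = 8 * r ^ 11 := by field_simp; ring
    have h3 : ∑ i, (z i : ℝ) * Y i i = ∑ i, (z i : ℝ) := by simp [hY1]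
    have h4 : ∑ i, (z i : ℝ) * ((c • A ^ p) i i - 1) =
        ∑ i, (z i : ℝ) * (c • A ^ p) i i - ∑ i, (z i : ℝ) := by
      rw [← Finset.sum_sub_distrib]
      exact Finset.sum_congr rfl fun i _ => by ring
    rw [h4]
    rw [ha, h3] at h1
    rw [ha, h3] at hloss
    linarith

theorem abs_roundDiag_sub_le {n m : ℕ} (φ : Instance n m) {z : Fin (2 * n) → ℤ}
    (hz : ∀ i, |(z i : ℝ)| ≤ 2 * n * (size n m : ℝ) ^ 17) (i : Fin (2 * n)) :
    |φ.roundDiag z i - (size n m : ℤ) ^ 8| ≤ 2 * n * (size n m : ℤ) ^ 8 := by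
  have hn : 0 < n := by have := i.2; omega
  obtain ⟨X, hX, hXtr, hd, -, -⟩ := exists_response φ hn hz
  obtain ⟨h1, h2⟩ := hd i
  have h0 : 0 ≤ X i i := hX.diag_nonneg
  have h3 : X i i ≤ 2 * n := hXtr ▸ (le_abs_self _).trans (abs_apply_le_trace_of_posSemidef hX i i)
  have h4 : 0 ≤ φ.roundDiag z i := by
    have : (-1 : ℝ) < φ.roundDiag z i := lt_of_le_of_lt (by
      have : (0 : ℝ) ≤ (size n m : ℝ) ^ 8 * X i i := by positivity
      linarith) h1
    have : (-1 : ℤ) < φ.roundDiag z i := by exact_mod_cast this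
    omega
  have h5 : φ.roundDiag z i ≤ (size n m : ℤ) ^ 8 * (2 * n) := by
    have : (φ.roundDiag z i : ℝ) ≤ (size n m : ℝ) ^ 8 * (2 * n) := h2.trans (by gcongr)
    exact_mod_cast this
  have h6 : (size n m : ℤ) ^ 8 ≤ (size n m : ℤ) ^ 8 * (2 * n) :=
    le_mul_of_one_le_right (by positivity) (by omega)
  have h7 : (0 : ℤ) ≤ (size n m : ℤ) ^ 8 := by positivity
  rw [abs_le]
  constructor <;> linarith

theorem abs_dual_le {n m : ℕ} (φ : Instance n m) {t : ℕ} (ht : t ≤ size n m ^ 9)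
    (i : Fin (2 * n)) : |φ.dual t i| ≤ t * (2 * n * (size n m : ℤ) ^ 8) := by
  induction t generalizing i with
  | zero => simp [Instance.dual]
  | succ t ih =>
    have ih' := ih (by omega)
    have h := abs_roundDiag_sub_le φ (z := φ.dual t) (fun i => ?_) i
    · refine (abs_add_le _ _).trans ?_
      push_cast
      linarith [ih' i]
    · have h1 : |(φ.dual t i : ℝ)| ≤ t * (2 * n * (size n m : ℝ) ^ 8) := by exact_mod_cast ih' i
      refine h1.trans ?_
      have : (t : ℝ) ≤ (size n m : ℝ) ^ 9 := by exact_mod_cast (by omega : t ≤ size n m ^ 9)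
      calc _ ≤ (size n m : ℝ) ^ 9 * (2 * n * (size n m : ℝ) ^ 8) := by gcongr
        _ = _ := by ring

theorem abs_dual_le' {n m : ℕ} (φ : Instance n m) {t : ℕ} (ht : t ≤ size n m ^ 9)
    (i : Fin (2 * n)) : |(φ.dual t i : ℝ)| ≤ 2 * n * (size n m : ℝ) ^ 17 := by
  have h1 : |(φ.dual t i : ℝ)| ≤ t * (2 * n * (size n m : ℝ) ^ 8) := by
    exact_mod_cast abs_dual_le φ ht i
  refine h1.trans ?_
  have : (t : ℝ) ≤ (size n m : ℝ) ^ 9 := by exact_mod_cast ht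
  calc _ ≤ (size n m : ℝ) ^ 9 * (2 * n * (size n m : ℝ) ^ 8) := by gcongr
    _ = _ := by ring

end TwoXORRefutation

/-! ### The accuracy of the method -/

namespace TwoXORRefutation

open Matrix

theorem sdpValue_matrix_le {n m : ℕ} (φ : Instance n m) : sdpValue φ.matrix ≤ m := by
  refine sdpValue_le fun u v hu hv => ?_
  rw [sum_matrix_mul φ fun i j => inner ℝ (u i) (v j)]
  calc _ ≤ ∑ _e : Fin m, (1 : ℝ) := by
        refine Finset.sum_le_sum fun e _ => ?_
        have h := abs_le.mp (inner_le_of_norm_le_one (hu (φ.edge e).1.1) (hv (φ.edge e).1.2))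
        rcases Int.units_eq_one_or (φ.sign e) with h' | h' <;> rw [h'] <;> simp <;> linarith
    _ = m := by simp

/-- A feasible point of the semidefinite program, completed to unit vectors: since the diagonal of
the objective vanishes, the diagonal of the Gram matrix can be raised to `1`. -/
theorem exists_posSemidef_of_feasible {n m : ℕ} (φ : Instance n m)
    {u v : Fin n → EuclideanSpace ℝ (Fin (2 * n))} (hu : ∀ i, ‖u i‖ ≤ 1) (hv : ∀ j, ‖v j‖ ≤ 1) :
    ∃ Y : Matrix (Fin (2 * n)) (Fin (2 * n)) ℝ, Y.PosSemidef ∧ (∀ i, Y i i = 1) ∧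
      φ.pair Y = 2 * ∑ i, ∑ j, φ.matrix i j * inner ℝ (u i) (v j) := by
  have hw : ∀ i, ‖joinVec u v i‖ ≤ 1 := joinVec_prop (p := fun x => ‖x‖ ≤ 1) hu hv
  have hY : (gram ℝ (joinVec u v) +
      diagonal fun i => 1 - ‖joinVec u v i‖ ^ 2).PosSemidef :=
    (posSemidef_gram ℝ (joinVec u v)).add
      (PosSemidef.diagonal fun i => by
        have := hw i
        have := norm_nonneg (joinVec u v i)
        simp only [Pi.zero_apply, sub_nonneg]
        nlinarith)
  refine ⟨_, hY, fun i => ?_, ?_⟩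
  · simp [gram_apply]
  · rw [pair_eq_of_isHermitian φ hY.1]
    congr 1
    refine Finset.sum_congr rfl fun i _ => Finset.sum_congr rfl fun j _ => ?_
    rw [Matrix.add_apply, diagonal_apply_ne _ (leftIdx_ne_rightIdx i j), gram_apply]
    simp

/-- The mean of the responses is nearly feasible and nearly optimal. Both facts come from the
potential `∑ i, (dual i) ^ 2`: an upper bound on it for the comparison with an optimal point gives
the optimality, and for the comparison with the identity matrix it gives a bound on the dual
variables, which are, up to scaling, the sums of the violations of the constraints `X i i = 1`. -/
theorem total_bounds {n m : ℕ} (φ : Instance n m) (hn : 0 < n) :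
    sdpValue φ.matrix ≤ φ.total (size n m ^ 9) / (2 * (size n m : ℝ) ^ 17) + 1 / 2 ∧
      φ.total (size n m ^ 9) / (2 * (size n m : ℝ) ^ 17) + 1 / 2 ≤ sdpValue φ.matrix + 1 := by
  obtain ⟨hr, hnr, hm⟩ := size_bounds n m
  have hstep : ∀ t, t < size n m ^ 9 → _ := fun t ht =>
    exists_response φ hn fun i => abs_dual_le' φ ht.le i
  choose! X hX hXtr hXd hXp hXY using hstep
  have hround : ∀ t, t < size n m ^ 9 → ∀ i,
      |φ.roundDiag (φ.dual t) i - (size n m : ℤ) ^ 8| ≤ 2 * n * (size n m : ℤ) ^ 8 :=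
    fun t ht i => abs_roundDiag_sub_le φ (fun i => abs_dual_le' φ ht.le i) i
  have hdual : ∀ t, t ≤ size n m ^ 9 → ∀ i, |(φ.dual t i : ℝ)| ≤ 2 * n * (size n m : ℝ) ^ 17 :=
    fun t ht i => abs_dual_le' φ ht i
  have hT : ((size n m ^ 9 : ℕ) : ℝ) = (size n m : ℝ) ^ 9 := by push_cast; rfl
  generalize size n m ^ 9 = T at *
  set r : ℝ := (size n m : ℝ) with hrdef
  have hr0 : 0 < r := by linarith
  have hr1 : 1 ≤ r := by linarith
  have hn0 : (0 : ℝ) ≤ n := Nat.cast_nonneg n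
  have hT0 : (0 : ℝ) < T := by rw [hT]; positivity
  -- the recursion of the dual variables and of the potential
  have hrec : ∀ t i, (φ.dual (t + 1) i : ℝ) = φ.dual t i + (φ.roundDiag (φ.dual t) i - r ^ 8) := by
    intro t i
    simp [Instance.dual, hrdef]
  have pot : ∀ Y : Matrix (Fin (2 * n)) (Fin (2 * n)) ℝ, Y.PosSemidef → (∀ i, Y i i = 1) →
      ∀ t, t ≤ T → ∑ i, (φ.dual t i : ℝ) ^ 2 ≤
        r ^ 20 * (∑ k ∈ Finset.range t, φ.pair (X k) - t * φ.pair Y) + t * (24 * r ^ 19) := by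
    intro Y hY hY1 t
    induction t with
    | zero => simp [Instance.dual]
    | succ t ih =>
      intro ht
      have ih := ih (by omega)
      have htT : t < T := by omega
      have h1 := mul_le_mul_of_nonneg_left (hXY t htT Y hY hY1) (pow_nonneg hr0.le 8)
      have h2 : ∑ i, (φ.dual (t + 1) i : ℝ) ^ 2 ≤ ∑ i, (φ.dual t i : ℝ) ^ 2 +
          2 * r ^ 8 * ∑ i, (φ.dual t i : ℝ) * (X t i i - 1) + 8 * r ^ 19 + 8 * r ^ 19 := by
        have h3 : ∀ i, (φ.dual (t + 1) i : ℝ) ^ 2 ≤ (φ.dual t i : ℝ) ^ 2 +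
            2 * r ^ 8 * ((φ.dual t i : ℝ) * (X t i i - 1)) + 2 * (2 * r * r ^ 17) +
            (2 * r * r ^ 8) ^ 2 := by
          intro i
          rw [hrec]
          obtain ⟨h4, h5⟩ := hXd t htT i
          have h6 : |(φ.roundDiag (φ.dual t) i : ℝ) - r ^ 8| ≤ 2 * n * r ^ 8 := by
            have := hround t htT i
            rw [hrdef]
            exact_mod_cast this
          have h7 : ((φ.roundDiag (φ.dual t) i : ℝ) - r ^ 8) ^ 2 ≤ (2 * r * r ^ 8) ^ 2 := by
            refine sq_le_sq' ?_ ?_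
            · have : 2 * n * r ^ 8 ≤ 2 * r * r ^ 8 := by gcongr
              linarith [(abs_le.mp h6).1]
            · have : 2 * n * r ^ 8 ≤ 2 * r * r ^ 8 := by gcongr
              linarith [(abs_le.mp h6).2]
          -- replacing the rounded diagonal entry by the exact one costs at most `|dual|`
          have h8 : (φ.dual t i : ℝ) * (φ.roundDiag (φ.dual t) i - r ^ 8 * X t i i) ≤
              2 * r * r ^ 17 := by
            have h9 : |(φ.roundDiag (φ.dual t) i : ℝ) - r ^ 8 * X t i i| ≤ 1 := by
              rw [abs_le]; constructor <;> linarith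
            refine (le_abs_self _).trans ?_
            rw [abs_mul]
            refine (mul_le_of_le_one_right (abs_nonneg _) h9).trans ?_
            refine (hdual t htT.le i).trans ?_
            gcongr
          nlinarith
        refine (Finset.sum_le_sum fun i _ => h3 i).trans ?_
        simp only [Finset.sum_add_distrib, ← Finset.mul_sum, Finset.sum_const, Finset.card_univ,
          Fintype.card_fin, nsmul_eq_mul]
        push_cast
        have h10 : 2 * (n : ℝ) * (2 * (2 * r * r ^ 17)) ≤ 2 * r * (2 * (2 * r * r ^ 17)) := by
          gcongr
        have h11 : 2 * (n : ℝ) * (2 * r * r ^ 8) ^ 2 ≤ 2 * r * (2 * r * r ^ 8) ^ 2 := by gcongr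
        ring_nf at h10 h11 ⊢
        linarith
      rw [Finset.sum_range_succ]
      push_cast
      ring_nf at h1 h2 ih ⊢
      linarith
  -- sums of the rounded quantities
  have htot : r ^ 8 * ∑ k ∈ Finset.range T, φ.pair (X k) - T ≤ φ.total T ∧
      (φ.total T : ℝ) ≤ r ^ 8 * ∑ k ∈ Finset.range T, φ.pair (X k) := by
    have hTs : (T : ℝ) = ∑ _k ∈ Finset.range T, (1 : ℝ) := by simp
    rw [Instance.total, Int.cast_sum, Finset.mul_sum]
    constructor
    · rw [hTs, ← Finset.sum_sub_distrib]
      exact Finset.sum_le_sum fun k hk => (hXp k (Finset.mem_range.mp hk)).1.le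
    · exact Finset.sum_le_sum fun k hk => (hXp k (Finset.mem_range.mp hk)).2
  set a : ℝ := ∑ k ∈ Finset.range T, φ.pair (X k) with ha
  have hTr : (T : ℝ) * r ^ 8 = r ^ 17 := by rw [hT]; ring
  have h17 : 0 < r ^ 17 := by positivity
  constructor
  · refine sdpValue_le fun u v hu hv => ?_
    obtain ⟨Y, hY, hY1, hYp⟩ := exists_posSemidef_of_feasible φ hu hv
    set s := ∑ i, ∑ j, φ.matrix i j * inner ℝ (u i) (v j)
    have h := pot Y hY hY1 T le_rfl
    have h0 : 0 ≤ ∑ i, (φ.dual T i : ℝ) ^ 2 := Finset.sum_nonneg fun i _ => sq_nonneg _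
    rw [hYp] at h
    have h1 : 0 ≤ r ^ 19 * (r * (a - T * (2 * s)) + T * 24) := by
      refine h0.trans (h.trans (le_of_eq ?_))
      ring
    have h2 : 0 ≤ r * (a - T * (2 * s)) + T * 24 := nonneg_of_mul_nonneg_right h1 (by positivity)
    -- the duality gap of the method is `12 / r`, and the rounding costs `1 / (2 * r ^ 8)`
    have h3 : T * (2 * s) ≤ a + T / 4 := by
      have h4 : T * 24 ≤ r * (T / 4) := by nlinarith
      have h5 : r * (T * (2 * s)) ≤ r * (a + T / 4) := by nlinarith
      exact le_of_mul_le_mul_left h5 hr0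
    have h6 : r ^ 8 * (T * (2 * s)) ≤ r ^ 8 * (a + T / 4) :=
      mul_le_mul_of_nonneg_left h3 (by positivity)
    have h7 : (T : ℝ) ≤ r ^ 17 / 4 := by
      rw [← hTr]
      have : 1 * r ≤ r ^ 7 * r := by
        have := one_le_pow₀ (n := 7) hr1
        gcongr
      have : 4 ≤ r ^ 8 := by
        calc (4 : ℝ) ≤ 1 * r := by linarith
          _ ≤ r ^ 8 := by rw [pow_succ]; exact this
      nlinarith
    have h8 : 2 * r ^ 17 * s ≤ φ.total T + r ^ 17 := by
      have e1 : r ^ 8 * (T * (2 * s)) = 2 * r ^ 17 * s := by rw [← hTr]; ring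
      have e2 : r ^ 8 * (a + T / 4) = r ^ 8 * a + r ^ 17 / 4 := by rw [← hTr]; ring
      rw [e1, e2] at h6
      linarith [htot.1]
    rw [← sub_le_iff_le_add, le_div_iff₀ (by positivity)]
    linarith
  · -- the comparison with the identity matrix bounds the dual variables
    have hone := pot 1 PosSemidef.one (by simp) T le_rfl
    have hp1 : φ.pair (1 : Matrix (Fin (2 * n)) (Fin (2 * n)) ℝ) = 0 := by
      rw [Instance.pair]
      refine Finset.sum_eq_zero fun i _ => Finset.sum_eq_zero fun j _ => ?_
      by_cases h : i = j
      · subst h; simp [sym_diag]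
      · simp [h]
    have haT : a ≤ T * (4 * r ^ 2) := by
      calc a ≤ ∑ _k ∈ Finset.range T, 4 * r ^ 2 := by
            refine Finset.sum_le_sum fun k hk => ?_
            have hk' := Finset.mem_range.mp hk
            have h1 := (abs_le.mp (abs_pair_le φ (hX k hk'))).2
            rw [hXtr k hk'] at h1
            calc _ ≤ _ := h1
              _ ≤ 2 * r * (2 * r) := by gcongr
              _ = _ := by ring
        _ = _ := by simp
    have hz : ∀ i, (φ.dual T i : ℝ) ≤ r ^ 16 / 8 := by
      intro i
      have h1 : (φ.dual T i : ℝ) ^ 2 ≤ ∑ i, (φ.dual T i : ℝ) ^ 2 :=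
        Finset.single_le_sum (f := fun i => (φ.dual T i : ℝ) ^ 2) (fun i _ => sq_nonneg _)
          (Finset.mem_univ i)
      have h2 : (φ.dual T i : ℝ) ^ 2 ≤ (r ^ 16 / 8) ^ 2 := by
        rw [hp1, mul_zero, sub_zero, ← ha] at hone
        have h3 : r ^ 20 * a ≤ r ^ 20 * (T * (4 * r ^ 2)) :=
          mul_le_mul_of_nonneg_left haT (by positivity)
        have h4 : 1000 * r ^ 28 ≤ r ^ 31 := by
          calc 1000 * r ^ 28 ≤ r * r ^ 28 := by gcongr
            _ ≤ r ^ 2 * (r * r ^ 28) := le_mul_of_one_le_left (by positivity) (one_le_pow₀ hr1)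
            _ = r ^ 31 := by ring
        have h5 : 1000 * r ^ 31 ≤ r * r ^ 31 := by gcongr
        have h6 : 0 < r ^ 31 := by positivity
        rw [hT] at h3 hone
        ring_nf at h1 h3 h5 hone ⊢
        linarith
      exact (abs_le_of_sq_le_sq' h2 (by positivity)).2
    have hdiag : ∀ i, ∑ k ∈ Finset.range T, r ^ 8 * X k i i ≤
        φ.dual T i + T * (r ^ 8 + 1) := by
      intro i
      have : ∀ t ≤ T, ∑ k ∈ Finset.range t, r ^ 8 * X k i i ≤ φ.dual t i + t * (r ^ 8 + 1) := by
        intro t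
        induction t with
        | zero => simp [Instance.dual]
        | succ t ih =>
          intro ht
          have ih := ih (by omega)
          rw [Finset.sum_range_succ, hrec]
          push_cast
          linarith [(hXd t (by omega) i).1]
      exact this T le_rfl
    -- the mean of the responses has diagonal at most `1 + 1 / (4 * r)`
    set Z : Matrix (Fin (2 * n)) (Fin (2 * n)) ℝ := ∑ k ∈ Finset.range T, X k with hZdef
    have hZ : Z.PosSemidef := posSemidef_sum _ fun k hk => hX k (Finset.mem_range.mp hk)
    have hZd : ∀ i, Z i i ≤ T * (1 + 1 / (4 * r)) := by
      intro i
      have h1 := hdiag i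
      rw [← Finset.mul_sum] at h1
      have h2 : Z i i = ∑ k ∈ Finset.range T, X k i i := by
        rw [hZdef, Matrix.sum_apply]
      rw [← h2] at h1
      have h3 := hz i
      have h4 : (T : ℝ) ≤ r ^ 16 / 8 := by
        rw [hT]
        have h5 : r ^ 10 ≤ r ^ 16 := pow_le_pow_right₀ hr1 (by norm_num)
        have h6 : 1000 * r ^ 9 ≤ r * r ^ 9 := by gcongr
        nlinarith
      have h7 : r ^ 8 * Z i i ≤ r ^ 8 * (T * (1 + 1 / (4 * r))) := by
        have e : r ^ 8 * (T * (1 + 1 / (4 * r))) = T * r ^ 8 + r ^ 16 / 4 := by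
          rw [hT]; field_simp
        rw [e]
        linarith
      exact le_of_mul_le_mul_left h7 (by positivity)
    have hZp : a = φ.pair Z := by
      rw [ha, hZdef]
      simp only [pair_eq_trace, Finset.mul_sum, Matrix.trace_sum]
    have h1 := sum_posSemidef_le_sdpValue φ.matrix hZ (by positivity) hZd
    rw [pair_eq_of_isHermitian φ hZ.1] at hZp
    set s := sdpValue φ.matrix
    have hs : s ≤ r := (sdpValue_matrix_le φ).trans hm
    have h2 : a ≤ 2 * (T * s + T / 4) := by
      have h3 : T * (1 + 1 / (4 * r)) * s = T * s + T * (s / r) / 4 := by field_simp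
      have h4 : s / r ≤ 1 := by rw [div_le_one hr0]; exact hs
      have h5 : T * (s / r) ≤ T * 1 := mul_le_mul_of_nonneg_left h4 hT0.le
      linarith
    have h3 : (φ.total T : ℝ) ≤ 2 * r ^ 17 * s + r ^ 17 / 2 := by
      have h4 := mul_le_mul_of_nonneg_left h2 (pow_nonneg hr0.le 8)
      have e : r ^ 8 * (2 * (T * s + T / 4)) = 2 * r ^ 17 * s + r ^ 17 / 2 := by
        rw [← hTr]; ring
      linarith [htot.2]
    have h4 : (φ.total T : ℝ) / (2 * r ^ 17) ≤ s + 1 / 2 := by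
      rw [div_le_iff₀ (by positivity)]
      linarith
    linarith

end TwoXORRefutation

/-! ### Timed execution of loops -/

namespace TwoXORRefutation

/-- A constant that bounds the cost of an expression, in units of one more than the number of bits
of the memory cells. -/
def Expr.weight : Expr → ℕ
  | .const z => 1 + bitSize z
  | .get _ i => 1 + i.weight
  | .add e f => 2 + 2 * (e.weight + f.weight)
  | .sub e f => 2 + 2 * (e.weight + f.weight)
  | .mul e f => 2 + 2 * (e.weight + f.weight)
  | .div e f => 2 + 2 * (e.weight + f.weight)

/-- A constant that bounds the cost of one pass through the code of a program, in the same
units. -/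
def Prog.weight : Prog → ℕ
  | .skip => 1
  | .assign _ i e => 1 + i.weight + e.weight
  | .seq p q => p.weight + q.weight
  | .ite e p q => 1 + e.weight + p.weight + q.weight
  | .loop e p => 1 + e.weight + p.weight

/-- The memory after the whole bank `b` has been replaced by `f`. -/
def Memory.setBank (s : Memory) (b : ℕ) (f : ℤ → ℤ) : Memory := Function.update s b f

/-- Every memory cell has at most `B` bits. -/
def Small (B : ℕ) (s : Memory) : Prop := ∀ a i, |s a i| < 2 ^ B

/-- The program `p` leads from `s` to `s'` in time at most `p.weight * X`. -/
def Runs (X : ℕ) (p : Prog) (s s' : Memory) : Prop := ∃ t ≤ p.weight * X, Exec p s s' t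

theorem bitSize_le {z : ℤ} {B : ℕ} : bitSize z ≤ B ↔ |z| < 2 ^ B := by
  rw [bitSize, Nat.size_le, ← Int.natCast_natAbs]
  norm_cast

theorem bitSize_add_le (x y : ℤ) : bitSize (x + y) ≤ 1 + bitSize x + bitSize y := by
  rw [bitSize_le]
  have hx := bitSize_le.mp (le_refl (bitSize x))
  have hy := bitSize_le.mp (le_refl (bitSize y))
  have h1 : (2 : ℤ) ^ bitSize x ≤ 2 ^ (bitSize x + bitSize y) :=
    pow_le_pow_right₀ (by norm_num) (by omega)
  have h2 : (2 : ℤ) ^ bitSize y ≤ 2 ^ (bitSize x + bitSize y) :=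
    pow_le_pow_right₀ (by norm_num) (by omega)
  have h3 := abs_add_le x y
  rw [add_assoc, pow_add]
  linarith

theorem bitSize_neg (x : ℤ) : bitSize (-x) = bitSize x := by simp [bitSize]

theorem bitSize_sub_le (x y : ℤ) : bitSize (x - y) ≤ 1 + bitSize x + bitSize y := by
  rw [sub_eq_add_neg, ← bitSize_neg y]
  exact bitSize_add_le _ _

theorem bitSize_mul_le (x y : ℤ) : bitSize (x * y) ≤ bitSize x + bitSize y := by
  rw [bitSize_le, abs_mul, pow_add]
  exact mul_lt_mul'' (bitSize_le.mp le_rfl) (bitSize_le.mp le_rfl) (abs_nonneg _) (abs_nonneg _)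

theorem abs_ediv_le (x y : ℤ) : |x / y| ≤ |x| := by
  rw [← Int.natCast_natAbs, ← Int.natCast_natAbs]
  exact_mod_cast Int.natAbs_ediv_le_natAbs x y

theorem bitSize_div_le (x y : ℤ) : bitSize (x / y) ≤ bitSize x :=
  bitSize_le.mpr ((abs_ediv_le x y).trans_lt (bitSize_le.mp le_rfl))

theorem bitSize_eval_le_cost (s : Memory) (e : Expr) : bitSize (e.eval s) ≤ e.cost s := by
  cases e <;> simp only [Expr.eval, Expr.cost] <;> omega

theorem cost_le {B : ℕ} {s : Memory} (hs : Small B s) (e : Expr) :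
    e.cost s ≤ e.weight * (B + 1) := by
  induction e with
  | const z => exact Nat.le_mul_of_pos_right _ (by omega)
  | get a i ih =>
    have := bitSize_le.mpr (hs a (i.eval s))
    simp only [Expr.cost, Expr.weight]
    linarith
  | add e f ihe ihf =>
    have := bitSize_add_le (e.eval s) (f.eval s)
    have := bitSize_eval_le_cost s e
    have := bitSize_eval_le_cost s f
    simp only [Expr.cost, Expr.weight]
    nlinarith
  | sub e f ihe ihf =>
    have := bitSize_sub_le (e.eval s) (f.eval s)
    have := bitSize_eval_le_cost s e
    have := bitSize_eval_le_cost s f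
    simp only [Expr.cost, Expr.weight]
    nlinarith
  | mul e f ihe ihf =>
    have := bitSize_mul_le (e.eval s) (f.eval s)
    have := bitSize_eval_le_cost s e
    have := bitSize_eval_le_cost s f
    simp only [Expr.cost, Expr.weight]
    nlinarith
  | div e f ihe ihf =>
    have := bitSize_div_le (e.eval s) (f.eval s)
    have := bitSize_eval_le_cost s e
    simp only [Expr.cost, Expr.weight]
    nlinarith

theorem Runs.mono {X X' : ℕ} {p : Prog} {s s' : Memory} (h : Runs X p s s') (hX : X ≤ X') :
    Runs X' p s s' := by
  obtain ⟨t, ht, h⟩ := h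
  exact ⟨t, ht.trans (Nat.mul_le_mul_left _ hX), h⟩

theorem Runs.seq {X : ℕ} {p q : Prog} {s s' s'' : Memory} (h : Runs X p s s')
    (h' : Runs X q s' s'') : Runs X (.seq p q) s s'' := by
  obtain ⟨t, ht, h⟩ := h
  obtain ⟨t', ht', h'⟩ := h'
  refine ⟨t + t', ?_, .seq h h'⟩
  simp only [Prog.weight, add_mul]
  omega

theorem Runs.assign {B X : ℕ} {s : Memory} (hs : Small B s) (hX : B + 1 ≤ X) (a : ℕ)
    (i e : Expr) : Runs X (.assign a i e) s (s.set a (i.eval s) (e.eval s)) := by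
  refine ⟨_, ?_, .assign s a i e⟩
  have h1 := cost_le hs i
  have h2 := cost_le hs e
  have h3 := Nat.mul_le_mul_left i.weight hX
  have h4 := Nat.mul_le_mul_left e.weight hX
  simp only [Prog.weight, add_mul]
  omega

theorem Small.update {B : ℕ} {s : Memory} (hs : Small B s) (b : ℕ) {f : ℤ → ℤ}
    (hf : ∀ i, |f i| < 2 ^ B) : Small B (s.setBank b f) := by
  intro a i
  rw [Memory.setBank]
  by_cases h : a = b
  · subst h; simpa using hf i
  · rw [Function.update_of_ne h]; exact hs a i

theorem Small.set {B : ℕ} {s : Memory} (hs : Small B s) (b : ℕ) (j : ℤ) {x : ℤ}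
    (hx : |x| < 2 ^ B) : Small B (s.set b j x) := by
  refine hs.update b fun i => ?_
  by_cases h : i = j
  · subst h; simpa using hx
  · rw [Function.update_of_ne h]; exact hs b i

/-- `for c in 0, …, K - 1 do p`, where the counter is the cell of bank `c` at the address `0`. -/
def forLoop (c : ℕ) (K : Expr) (p : Prog) : Prog :=
  .seq (.assign c (.const 0) (.const 0))
    (.loop (.sub K (.get c (.const 0)))
      (.seq p (.assign c (.const 0) (.add (.get c (.const 0)) (.const 1)))))

/-- The rule for `for` loops, with the loop invariant `I`. -/
theorem runs_forLoop {c : ℕ} {K : Expr} {p : Prog} {I : ℕ → Memory → Prop} {k₀ B X : ℕ}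
    (hX : B + 1 ≤ X)
    (hI : ∀ k ≤ k₀, ∀ s, I k s → K.eval s = k₀ ∧ s c 0 = k ∧ Small B s)
    (hstep : ∀ k < k₀, ∀ s, I k s →
      ∃ s', Runs X p s s' ∧ s' c 0 = k ∧ Small B s' ∧ I (k + 1) (s'.set c 0 (k + 1)))
    {s : Memory} (hs : Small B s) (h0 : I 0 (s.set c 0 0)) :
    ∃ s', Runs ((k₀ + 1) * X) (forLoop c K p) s s' ∧ I k₀ s' := by
  set e : Expr := .sub K (.get c (.const 0)) with he
  set q : Prog := .seq p (.assign c (.const 0) (.add (.get c (.const 0)) (.const 1))) with hq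
  have hloop : ∀ d k, k + d = k₀ → ∀ s, I k s →
      ∃ s', Runs ((d + 1) * X) (.loop e q) s s' ∧ I k₀ s' := by
    intro d
    induction d with
    | zero =>
      intro k hk s hs
      obtain rfl : k = k₀ := by omega
      obtain ⟨h1, h2, h3⟩ := hI k le_rfl s hs
      refine ⟨s, ⟨_, ?_, .loop_done ?_⟩, hs⟩
      · have h4 := cost_le h3 e
        have h5 := Nat.mul_le_mul_left e.weight hX
        simp only [Prog.weight, add_mul, zero_add, one_mul]
        omega
      · simp [he, Expr.eval, h1, h2]
    | succ d ih =>
      intro k hk s hs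
      obtain ⟨h1, h2, h3⟩ := hI k (by omega) s hs
      obtain ⟨s', hr, hc, hs', hI'⟩ := hstep k (by omega) s hs
      have hq' : Runs X q s (s'.set c 0 (k + 1)) := by
        refine hr.seq ?_
        have h4 : (Expr.add (.get c (.const 0)) (.const 1)).eval s' = k + 1 :=
          congrArg (· + 1) hc
        rw [← h4]
        exact Runs.assign hs' hX c _ _
      obtain ⟨s'', hr'', hI''⟩ := ih (k + 1) (by omega) _ hI'
      obtain ⟨t, ht, hx⟩ := hq'
      obtain ⟨t', ht', hx'⟩ := hr''
      refine ⟨s'', ⟨_, ?_, .loop_step ?_ hx hx'⟩, hI''⟩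
      · have h4 := cost_le h3 e
        have h5 := Nat.mul_le_mul_left e.weight hX
        have h6 : (Prog.loop e q).weight * ((d + 1 + 1) * X) =
          (Prog.loop e q).weight * ((d + 1) * X) + (X + e.weight * X + q.weight * X) := by
          simp only [Prog.weight]; ring
        rw [h6]
        omega
      · simp only [he, Expr.eval, h1, h2]
        omega
  obtain ⟨s', hr, hI'⟩ := hloop k₀ 0 (by omega) _ h0
  refine ⟨s', Runs.seq ?_ hr, hI'⟩
  exact (Runs.assign hs hX c _ _).mono (Nat.le_mul_of_pos_left _ (by omega))

theorem abs_sum_ite_le {k : ℕ} {a : ℕ → ℤ} {w : ℕ → ℤ} {Y : ℤ} (hw : ∀ j < k, |w j| ≤ Y)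
    (i : ℤ) : |∑ j ∈ Finset.range k, if a j = i then w j else 0| ≤ k * Y := by
  refine (Finset.abs_sum_le_sum_abs _ _).trans ?_
  calc _ ≤ ∑ _j ∈ Finset.range k, Y := by
        refine Finset.sum_le_sum fun j hj => ?_
        have := hw j (Finset.mem_range.mp hj)
        split_ifs
        · exact this
        · simpa using (abs_nonneg _).trans this
    _ = _ := by simp

theorem Memory.set_set (s : Memory) (c : ℕ) (i x y : ℤ) :
    (s.set c i x).set c i y = s.set c i y := by
  simp [Memory.set]

theorem Memory.set_apply_self (s : Memory) (c : ℕ) (i x : ℤ) : s.set c i x c i = x := by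
  simp [Memory.set]

/-- The loop `for c in 0, …, K - 1 do b[α] := b[α] + v`: at each address it adds up the values `w k`
of `v` that are directed to this address. -/
theorem runs_scatter {b c : ℕ} (hbc : b ≠ c) {K α v : Expr} {s : Memory} {k₀ B X : ℕ}
    {a w : ℕ → ℤ} {Y Y' : ℤ} (hX : B + 1 ≤ X) (hs : Small B s)
    (hK : ∀ f, ∀ k : ℕ, K.eval ((s.setBank b f).set c 0 k) = k₀)
    (hα : ∀ f, ∀ k < k₀, α.eval ((s.setBank b f).set c 0 k) = a k)
    (hv : ∀ f, ∀ k < k₀, v.eval ((s.setBank b f).set c 0 k) = w k)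
    (hk : (k₀ : ℤ) < 2 ^ B) (hb : ∀ i, |s b i| ≤ Y) (hw : ∀ k < k₀, |w k| ≤ Y')
    (hY : Y + k₀ * Y' < 2 ^ B) :
    Runs ((k₀ + 1) * X) (forLoop c K (.assign b α (.add (.get b α) v))) s
      ((s.setBank b fun i => s b i +
        ∑ j ∈ Finset.range k₀, if a j = i then w j else 0).set c 0 k₀) ∧
      Small B ((s.setBank b fun i => s b i +
        ∑ j ∈ Finset.range k₀, if a j = i then w j else 0).set c 0 k₀) := by
  set F : ℕ → ℤ → ℤ := fun k i => s b i + ∑ j ∈ Finset.range k, if a j = i then w j else 0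
  have hF : ∀ k ≤ k₀, ∀ i, |F k i| < 2 ^ B := by
    intro k hkk i
    have h1 := abs_sum_ite_le (a := a) (fun j hj => hw j (lt_of_lt_of_le hj hkk)) i
    have h2 : (k : ℤ) * Y' ≤ k₀ * Y' := by
      rcases Nat.eq_zero_or_pos k with rfl | hpos
      · rcases Nat.eq_zero_or_pos k₀ with rfl | hpos
        · simp
        · have := (abs_nonneg _).trans (hw 0 hpos)
          simpa using mul_nonneg (by positivity) this
      · have := (abs_nonneg _).trans (hw 0 (by omega))
        gcongr
    refine (abs_add_le _ _).trans_lt ?_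
    linarith [hb i]
  have hsm : ∀ k ≤ k₀, Small B ((s.setBank b (F k)).set c 0 k) := fun k hkk =>
    (hs.update b (hF k hkk)).set c 0 (by
      rw [abs_of_nonneg (by positivity)]
      exact lt_of_le_of_lt (by exact_mod_cast hkk) hk)
  refine ⟨?_, hsm k₀ le_rfl⟩
  have h := runs_forLoop (c := c) (K := K) (p := .assign b α (.add (.get b α) v))
    (I := fun k s' => s' = (s.setBank b (F k)).set c 0 k) (k₀ := k₀) (B := B) hX ?_ ?_ hs ?_
  · obtain ⟨s', hr, rfl⟩ := h
    exact hr
  · rintro k hkk _ rfl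
    exact ⟨hK _ _, Memory.set_apply_self _ _ _ _, hsm k hkk⟩
  · rintro k hkk _ rfl
    have e : Memory.set ((s.setBank b (F k)).set c 0 k) b (a k) (F k (a k) + w k) =
        (s.setBank b (F (k + 1))).set c 0 k := by
      have h1 : Function.update (F k) (a k) (F k (a k) + w k) = F (k + 1) := by
        funext i
        simp only [F, Finset.sum_range_succ]
        by_cases h : i = a k
        · subst h
          simp
          ring
        · rw [Function.update_of_ne h, if_neg (Ne.symm h)]
          ring
      rw [← h1]
      simp only [Memory.set, Function.update_of_ne hbc, Memory.setBank, Function.update_self,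
        Function.update_of_ne hbc.symm]
      rw [Function.update_comm hbc, Function.update_idem]
      exact Function.update_comm hbc.symm _ _ _
    refine ⟨_, Runs.assign (hsm k hkk.le) hX b _ _, ?_⟩
    have hval : (Expr.add (.get b α) v).eval ((s.setBank b (F k)).set c 0 k) =
        F k (a k) + w k := by
      simp only [Expr.eval, hα _ k hkk, hv _ k hkk]
      simp [Memory.set, Memory.setBank, Function.update_of_ne hbc]
    rw [hval, hα _ k hkk, e]
    refine ⟨Memory.set_apply_self _ _ _ _, ?_, ?_⟩
    · exact (hs.update b (hF (k + 1) hkk)).set c 0 (by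
        rw [abs_of_nonneg (by positivity)]
        exact lt_trans (by exact_mod_cast hkk) hk)
    · rw [Memory.set_set]
      push_cast
      rfl
  · have : F 0 = s b := by funext i; simp [F]
    rw [this, Memory.setBank, Function.update_eq_self]
    rfl

/-- The loop `for c in 0, …, K - 1 do b[c] := v`, which stores the values of `v` as an array. -/
theorem runs_fill {b c : ℕ} (hbc : b ≠ c) {K v : Expr} {s : Memory} {k₀ B X : ℕ}
    {w : ℤ → ℤ} (hX : B + 1 ≤ X) (hs : Small B s)
    (hK : ∀ f, ∀ k : ℕ, K.eval ((s.setBank b f).set c 0 k) = k₀)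
    (hv : ∀ f, ∀ k < k₀, v.eval ((s.setBank b f).set c 0 k) = w k)
    (hk : (k₀ : ℤ) < 2 ^ B) (hw : ∀ k < k₀, |w k| < 2 ^ B) :
    Runs ((k₀ + 1) * X) (forLoop c K (.assign b (.get c (.const 0)) v)) s
      ((s.setBank b fun i => if 0 ≤ i ∧ i < k₀ then w i else s b i).set c 0 k₀) ∧
      Small B ((s.setBank b fun i =>
        if 0 ≤ i ∧ i < k₀ then w i else s b i).set c 0 k₀) := by
  set F : ℕ → ℤ → ℤ := fun k i => if 0 ≤ i ∧ i < k then w i else s b i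
  have hF : ∀ k ≤ k₀, ∀ i, |F k i| < 2 ^ B := by
    intro k hkk i
    simp only [F]
    split_ifs with h
    · lift i to ℕ using h.1
      exact hw i (by omega)
    · exact hs b i
  have hsm : ∀ k ≤ k₀, Small B ((s.setBank b (F k)).set c 0 k) := fun k hkk =>
    (hs.update b (hF k hkk)).set c 0 (by
      rw [abs_of_nonneg (by positivity)]
      exact lt_of_le_of_lt (by exact_mod_cast hkk) hk)
  refine ⟨?_, hsm k₀ le_rfl⟩
  have h := runs_forLoop (c := c) (K := K) (p := .assign b (.get c (.const 0)) v)
    (I := fun k s' => s' = (s.setBank b (F k)).set c 0 k) (k₀ := k₀) (B := B) hX ?_ ?_ hs ?_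
  · obtain ⟨s', hr, rfl⟩ := h
    exact hr
  · rintro k hkk _ rfl
    exact ⟨hK _ _, Memory.set_apply_self _ _ _ _, hsm k hkk⟩
  · rintro k hkk _ rfl
    have e : Memory.set ((s.setBank b (F k)).set c 0 k) b k (w k) =
        (s.setBank b (F (k + 1))).set c 0 k := by
      have h1 : Function.update (F k) k (w k) = F (k + 1) := by
        funext i
        simp only [F]
        by_cases h : i = k
        · subst h
          simp
        · rw [Function.update_of_ne h]
          have : (0 ≤ i ∧ i < (k : ℤ)) ↔ (0 ≤ i ∧ i < ((k + 1 : ℕ) : ℤ)) := by omega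
          simp only [this]
      rw [← h1]
      simp only [Memory.set, Function.update_of_ne hbc, Memory.setBank, Function.update_self,
        Function.update_of_ne hbc.symm]
      rw [Function.update_comm hbc, Function.update_idem]
      exact Function.update_comm hbc.symm _ _ _
    refine ⟨_, Runs.assign (hsm k hkk.le) hX b _ _, ?_⟩
    have hi : (Expr.get c (.const 0)).eval ((s.setBank b (F k)).set c 0 k) = k :=
      Memory.set_apply_self _ _ _ _
    rw [hv _ k hkk, hi, e]
    refine ⟨Memory.set_apply_self _ _ _ _, ?_, ?_⟩
    · exact (hs.update b (hF (k + 1) hkk)).set c 0 (by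
        rw [abs_of_nonneg (by positivity)]
        exact lt_trans (by exact_mod_cast hkk) hk)
    · rw [Memory.set_set]
      push_cast
      rfl
  · have : F 0 = s b := by
      funext i
      simp only [F]
      rw [if_neg (by omega)]
    rw [this, Memory.setBank, Function.update_eq_self]
    rfl

end TwoXORRefutation

/-! ### Matrices in memory -/

namespace TwoXORRefutation

open Matrix

/-- The array that stores a matrix row by row: the entry at `(i, j)` has the address `i * N + j`. -/
def flat {N : ℕ} (M : Matrix (Fin N) (Fin N) ℤ) : ℤ → ℤ := fun r =>
  ∑ i : Fin N, ∑ j : Fin N, if ((i : ℕ) : ℤ) * N + (j : ℕ) = r then M i j else 0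

theorem address_inj {N : ℕ} {i j i' j' : Fin N} :
    ((i : ℕ) : ℤ) * N + (j : ℕ) = ((i' : ℕ) : ℤ) * N + (j' : ℕ) ↔ i = i' ∧ j = j' := by
  constructor
  · intro h
    have h' : (i : ℕ) * N + j = (i' : ℕ) * N + j' := by exact_mod_cast h
    have h1 := congrArg (· / N) h'
    have h2 := congrArg (· % N) h'
    have hN : 0 < N := i.pos
    simp only [mul_comm _ N, Nat.mul_add_div hN, Nat.div_eq_of_lt j.2, Nat.div_eq_of_lt j'.2,
      Nat.mul_add_mod, Nat.mod_eq_of_lt j.2, Nat.mod_eq_of_lt j'.2, add_zero] at h1 h2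
    exact ⟨Fin.ext h1, Fin.ext h2⟩
  · rintro ⟨rfl, rfl⟩
    rfl

theorem flat_address {N : ℕ} (M : Matrix (Fin N) (Fin N) ℤ) (i j : Fin N) :
    flat M (((i : ℕ) : ℤ) * N + (j : ℕ)) = M i j := by
  simp only [flat, address_inj]
  rw [Finset.sum_eq_single i, Finset.sum_eq_single j]
  · simp
  · intro b _ hb
    simp [hb]
  · simp
  · intro b _ hb
    simp [hb]
  · simp

theorem flat_of_forall_ne {N : ℕ} (M : Matrix (Fin N) (Fin N) ℤ) {r : ℤ}
    (h : ∀ i j : Fin N, ((i : ℕ) : ℤ) * N + (j : ℕ) ≠ r) : flat M r = 0 :=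
  Finset.sum_eq_zero fun i _ => Finset.sum_eq_zero fun j _ => if_neg (h i j)

theorem eq_flat {N : ℕ} {M : Matrix (Fin N) (Fin N) ℤ} {f : ℤ → ℤ}
    (h : ∀ i j : Fin N, f (((i : ℕ) : ℤ) * N + (j : ℕ)) = M i j)
    (h' : ∀ r, (∀ i j : Fin N, ((i : ℕ) : ℤ) * N + (j : ℕ) ≠ r) → f r = 0) : f = flat M := by
  funext r
  by_cases hr : ∃ i j : Fin N, ((i : ℕ) : ℤ) * N + (j : ℕ) = r
  · obtain ⟨i, j, rfl⟩ := hr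
    rw [h, flat_address]
  · push Not at hr
    rw [h' r hr, flat_of_forall_ne M hr]

theorem abs_flat_le {N : ℕ} {M : Matrix (Fin N) (Fin N) ℤ} {c : ℤ} (hc : 0 ≤ c)
    (h : ∀ i j, |M i j| ≤ c) (r : ℤ) : |flat M r| ≤ c := by
  by_cases hr : ∃ i j : Fin N, ((i : ℕ) : ℤ) * N + (j : ℕ) = r
  · obtain ⟨i, j, rfl⟩ := hr
    rw [flat_address]
    exact h i j
  · push Not at hr
    rw [flat_of_forall_ne M hr, abs_zero]
    exact hc

theorem address_range {N : ℕ} {r : ℤ} :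
    (0 ≤ r ∧ r < ((N * N : ℕ) : ℤ)) ↔ ∃ i j : Fin N, ((i : ℕ) : ℤ) * N + (j : ℕ) = r := by
  constructor
  · rintro ⟨h0, h1⟩
    lift r to ℕ using h0
    have h1' : r < N * N := by exact_mod_cast h1
    have hN : 0 < N := Nat.pos_of_ne_zero fun h => by simp [h] at h1'
    refine ⟨⟨r / N, Nat.div_lt_of_lt_mul h1'⟩, ⟨r % N, Nat.mod_lt _ hN⟩, ?_⟩
    have := Nat.div_add_mod' r N
    exact_mod_cast this
  · rintro ⟨i, j, rfl⟩
    refine ⟨by positivity, ?_⟩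
    have h1 : (i : ℕ) + 1 ≤ N := i.2
    have h2 := Nat.mul_le_mul_right N h1
    have h3 := j.2
    have : (i : ℕ) * N + j < N * N := by linarith
    exact_mod_cast this

/-- Overwriting the whole range of a stored matrix by another one. -/
theorem fill_flat {N : ℕ} (M M' : Matrix (Fin N) (Fin N) ℤ) :
    (fun i : ℤ => if 0 ≤ i ∧ i < ((N * N : ℕ) : ℤ) then flat M i else flat M' i) = flat M := by
  refine eq_flat (fun i j => ?_) fun r hr => ?_
  · rw [if_pos (address_range.mpr ⟨i, j, rfl⟩), flat_address]
  · rw [if_neg fun h => ?_, flat_of_forall_ne M' hr]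
    obtain ⟨i, j, h⟩ := address_range.mp h
    exact hr i j h

theorem flat_smul {N : ℕ} (c : ℤ) (M : Matrix (Fin N) (Fin N) ℤ) (r : ℤ) :
    flat (c • M) r = c * flat M r := by
  simp [flat, Finset.mul_sum]

theorem flat_zero {N : ℕ} : flat (0 : Matrix (Fin N) (Fin N) ℤ) = fun _ => 0 := by
  funext r
  simp [flat]

/-- Adding up values directed to the addresses of matrix entries. -/
theorem flat_add_sum {N K : ℕ} (M : Matrix (Fin N) (Fin N) ℤ) (p q : Fin K → Fin N)
    {a w : ℕ → ℤ} (u : Fin K → ℤ) (ha : ∀ k : Fin K, a k = ((p k : ℕ) : ℤ) * N + (q k : ℕ))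
    (hw : ∀ k : Fin K, w k = u k) :
    (fun r => flat M r + ∑ k ∈ Finset.range K, if a k = r then w k else 0) =
      flat (M + Matrix.of fun i j => ∑ k, if i = p k ∧ j = q k then u k else 0) := by
  refine eq_flat (fun i j => ?_) fun r hr => ?_
  · rw [flat_address, Finset.sum_range]
    simp only [Matrix.add_apply, Matrix.of_apply, ha, hw, address_inj]
    congr 1
    refine Finset.sum_congr rfl fun k _ => ?_
    simp only [eq_comm]
  · rw [flat_of_forall_ne M hr, Finset.sum_range, zero_add]
    refine Finset.sum_eq_zero fun k _ => ?_
    rw [ha, if_neg (hr _ _)]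

theorem sum_range_mul (a N : ℕ) (f : ℕ → ℤ) :
    ∑ k ∈ Finset.range (a * N), f k =
      ∑ q ∈ Finset.range a, ∑ l ∈ Finset.range N, f (q * N + l) := by
  induction a with
  | zero => simp
  | succ a ih => rw [add_mul, one_mul, Finset.sum_range_add, ih, Finset.sum_range_succ]

/-- The product of two matrices as one flat loop over all triples `(i, j, l)`, in the order of the
number `(i * N + j) * N + l`. -/
theorem flat_mul {N : ℕ} (A B : Matrix (Fin N) (Fin N) ℤ) :
    (fun r : ℤ => (0 : ℤ) + ∑ k ∈ Finset.range (N * N * N), if ((k / N : ℕ) : ℤ) = r then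
      flat A (((k / N / N : ℕ) : ℤ) * N + (k % N : ℕ)) *
        flat B (((k % N : ℕ) : ℤ) * N + (k / N % N : ℕ)) else 0) = flat (A * B) := by
  refine eq_flat (fun i j => ?_) fun r hr => ?_
  · have hN : 0 < N := i.pos
    have hr : (i : ℕ) * N + j < N * N := by
      have := (address_range.mpr ⟨i, j, rfl⟩).2
      exact_mod_cast this
    rw [sum_range_mul, zero_add, Finset.sum_eq_single ((i : ℕ) * N + j)]
    · rw [Finset.sum_range, Matrix.mul_apply]
      refine Finset.sum_congr rfl fun l _ => ?_
      have h1 : (((i : ℕ) * N + j) * N + l) / N = (i : ℕ) * N + j := by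
        rw [mul_comm, Nat.mul_add_div hN, Nat.div_eq_of_lt l.2, add_zero]
      have h2 : (((i : ℕ) * N + j) * N + l) % N = l := by
        rw [mul_comm, Nat.mul_add_mod, Nat.mod_eq_of_lt l.2]
      have h3 : ((i : ℕ) * N + j) / N = i := by
        rw [mul_comm, Nat.mul_add_div hN, Nat.div_eq_of_lt j.2, add_zero]
      have h4 : ((i : ℕ) * N + j) % N = j := by
        rw [mul_comm, Nat.mul_add_mod, Nat.mod_eq_of_lt j.2]
      rw [h1, h2, h3, h4, flat_address, flat_address, if_pos (by push_cast; rfl)]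
    · intro q _ hq
      refine Finset.sum_eq_zero fun l hl => ?_
      have hl' := Finset.mem_range.mp hl
      rw [if_neg]
      rw [mul_comm, Nat.mul_add_div hN, Nat.div_eq_of_lt hl', add_zero]
      intro h
      apply hq
      exact_mod_cast h
    · intro h
      exact absurd (Finset.mem_range.mpr hr) h
  · rw [zero_add]
    refine Finset.sum_eq_zero fun k hk => if_neg fun h => ?_
    have hk' := Finset.mem_range.mp hk
    have h1 : k / N < N * N := Nat.div_lt_of_lt_mul (by linarith)
    obtain ⟨i, j, h2⟩ := address_range.mp ⟨Int.natCast_nonneg (k / N), by exact_mod_cast h1⟩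
    exact hr i j (h2.trans h)

theorem sum_flat_diag {N : ℕ} (A : Matrix (Fin N) (Fin N) ℤ) :
    ∑ k ∈ Finset.range N, flat A ((k : ℤ) * N + k) = A.trace := by
  rw [Finset.sum_range]
  exact Finset.sum_congr rfl fun i _ => flat_address A i i

theorem sum_flat_mul {N : ℕ} (A B : Matrix (Fin N) (Fin N) ℤ) :
    ∑ k ∈ Finset.range (N * N), flat A k * flat B k = ∑ i, ∑ j, A i j * B i j := by
  rw [sum_range_mul, Finset.sum_range]
  refine Finset.sum_congr rfl fun i _ => ?_
  rw [Finset.sum_range]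
  refine Finset.sum_congr rfl fun j _ => ?_
  push_cast
  rw [flat_address, flat_address]

theorem array_apply {K : ℕ} (f : Fin K → ℤ) {k : ℕ} (hk : k < K) : array f k = f ⟨k, hk⟩ := by
  rw [array, dif_pos ⟨by positivity, by exact_mod_cast hk⟩]
  congr

theorem array_add_sum {K : ℕ} (f u : Fin K → ℤ) {w : ℕ → ℤ} (hw : ∀ k : Fin K, w k = u k) :
    (fun i => array f i + ∑ k ∈ Finset.range K, if ((k : ℕ) : ℤ) = i then w k else 0) =
      array fun k => f k + u k := by
  funext i
  by_cases hi : 0 ≤ i ∧ i < (K : ℤ)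
  · lift i to ℕ using hi.1
    have hi' : i < K := by exact_mod_cast hi.2
    rw [array_apply _ hi', array_apply _ hi', Finset.sum_eq_single i]
    · rw [if_pos rfl, hw ⟨i, hi'⟩]
    · intro k _ hk
      rw [if_neg]
      exact_mod_cast hk
    · intro h
      exact absurd (Finset.mem_range.mpr hi') h
  · rw [array, array, dif_neg hi, dif_neg hi, zero_add]
    refine Finset.sum_eq_zero fun k hk => if_neg fun h => hi ?_
    have := Finset.mem_range.mp hk
    omega

theorem abs_array_le {K : ℕ} {f : Fin K → ℤ} {c : ℤ} (hc : 0 ≤ c) (h : ∀ k, |f k| ≤ c) (i : ℤ) :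
    |array f i| ≤ c := by
  unfold array
  split_ifs
  · exact h _
  · simpa using hc

theorem abs_mul_apply_le {N : ℕ} {A B : Matrix (Fin N) (Fin N) ℤ} {a b : ℤ}
    (ha : ∀ i j, |A i j| ≤ a) (hb : ∀ i j, |B i j| ≤ b) (i j : Fin N) :
    |(A * B) i j| ≤ N * (a * b) := by
  rw [Matrix.mul_apply]
  refine (Finset.abs_sum_le_sum_abs _ _).trans ?_
  calc _ ≤ ∑ _l : Fin N, a * b := by
        refine Finset.sum_le_sum fun l _ => ?_
        rw [abs_mul]
        exact mul_le_mul (ha i l) (hb l j) (abs_nonneg _) ((abs_nonneg _).trans (ha i l))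
    _ = _ := by simp

end TwoXORRefutation

/-! ### The program -/

namespace TwoXORRefutation

open Matrix

/-- `e ^ k`, by repeated multiplication. -/
def Expr.pow (e : Expr) : ℕ → Expr
  | 0 => .const 1
  | k + 1 => .mul (e.pow k) e

@[simp] theorem Expr.eval_pow (s : Memory) (e : Expr) (k : ℕ) :
    (e.pow k).eval s = e.eval s ^ k := by
  induction k with
  | zero => simp [Expr.pow, Expr.eval]
  | succ k ih => rw [pow_succ, ← ih]; rfl

/-- The remainder of a division. -/
def Expr.mod (e f : Expr) : Expr := .sub e (.mul f (.div e f))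

@[simp] theorem Expr.eval_mod (s : Memory) (e f : Expr) :
    (e.mod f).eval s = e.eval s % f.eval s := by
  rw [Int.emod_def]
  rfl

/-- The contents of the banks that the program writes before the result is stored: four matrices,
the dual variables, the trace and the inner product of the current matrix power, the sum of the
objective values, and three loop counters. The banks of the last six are cells, used at the
address `0` only. -/
structure Banks where
  W : ℤ → ℤ
  A : ℤ → ℤ
  B : ℤ → ℤ
  C : ℤ → ℤ
  z : ℤ → ℤ
  tr : ℤ
  num : ℤ
  acc : ℤ
  c₁ : ℤ
  c₂ : ℤ
  c₃ : ℤ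

/-- A bank that holds `x` at the address `0`, and zeros. -/
def cell (x : ℤ) : ℤ → ℤ := fun i => if i = 0 then x else 0

@[simp] theorem cell_zero (x : ℤ) : cell x 0 = x := rfl

theorem update_cell (x y : ℤ) : Function.update (cell x) 0 y = cell y := by
  funext i
  by_cases h : i = 0
  · subst h; simp
  · rw [Function.update_of_ne h]; simp [cell, h]

/-- The memory with the input `φ` and the given contents of the working banks. -/
def Banks.mem {n m : ℕ} (φ : Instance n m) (st : Banks) : Memory
  | 0 => φ.input 0
  | 1 => φ.input 1
  | 2 => φ.input 2
  | 3 => φ.input 3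
  | 5 => st.W
  | 6 => st.A
  | 7 => st.B
  | 8 => st.C
  | 9 => st.z
  | 10 => cell st.tr
  | 11 => cell st.num
  | 12 => cell st.acc
  | 13 => cell st.c₁
  | 14 => cell st.c₂
  | 15 => cell st.c₃
  | _ => fun _ => 0

section Access

variable {n m : ℕ} (φ : Instance n m) (st : Banks)

theorem mem_0_0 : st.mem φ 0 0 = n := by
  change array ![(n : ℤ), (m : ℤ)] 0 = n
  simp [array]

theorem mem_0_1 : st.mem φ 0 1 = m := by
  change array ![(n : ℤ), (m : ℤ)] 1 = m
  simp [array]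

theorem mem_1 {k : ℕ} (hk : k < m) : st.mem φ 1 k = ((φ.edge ⟨k, hk⟩).1.1 : ℕ) :=
  array_apply (fun j => (((φ.edge j).1.1 : ℕ) : ℤ)) hk

theorem mem_2 {k : ℕ} (hk : k < m) : st.mem φ 2 k = ((φ.edge ⟨k, hk⟩).1.2 : ℕ) :=
  array_apply (fun j => (((φ.edge j).1.2 : ℕ) : ℤ)) hk

theorem mem_3 {k : ℕ} (hk : k < m) : st.mem φ 3 k = ((φ.sign ⟨k, hk⟩ : ℤˣ) : ℤ) :=
  array_apply (fun j => ((φ.sign j : ℤˣ) : ℤ)) hk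

theorem mem_5 : st.mem φ 5 = st.W := rfl
theorem mem_6 : st.mem φ 6 = st.A := rfl
theorem mem_7 : st.mem φ 7 = st.B := rfl
theorem mem_8 : st.mem φ 8 = st.C := rfl
theorem mem_9 : st.mem φ 9 = st.z := rfl
theorem mem_10 : st.mem φ 10 = cell st.tr := rfl
theorem mem_11 : st.mem φ 11 = cell st.num := rfl
theorem mem_12 : st.mem φ 12 = cell st.acc := rfl
theorem mem_13 : st.mem φ 13 = cell st.c₁ := rfl
theorem mem_14 : st.mem φ 14 = cell st.c₂ := rfl
theorem mem_15 : st.mem φ 15 = cell st.c₃ := rfl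

theorem setBank_5 (f : ℤ → ℤ) : (st.mem φ).setBank 5 f = ({st with W := f} : Banks).mem φ := by
  funext a
  rcases a with _|_|_|_|_|_|_|_|_|_|_|_|_|_|_|_|a <;> rfl

theorem setBank_6 (f : ℤ → ℤ) : (st.mem φ).setBank 6 f = ({st with A := f} : Banks).mem φ := by
  funext a
  rcases a with _|_|_|_|_|_|_|_|_|_|_|_|_|_|_|_|a <;> rfl

theorem setBank_7 (f : ℤ → ℤ) : (st.mem φ).setBank 7 f = ({st with B := f} : Banks).mem φ := by
  funext a
  rcases a with _|_|_|_|_|_|_|_|_|_|_|_|_|_|_|_|a <;> rfl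

theorem setBank_8 (f : ℤ → ℤ) : (st.mem φ).setBank 8 f = ({st with C := f} : Banks).mem φ := by
  funext a
  rcases a with _|_|_|_|_|_|_|_|_|_|_|_|_|_|_|_|a <;> rfl

theorem setBank_9 (f : ℤ → ℤ) : (st.mem φ).setBank 9 f = ({st with z := f} : Banks).mem φ := by
  funext a
  rcases a with _|_|_|_|_|_|_|_|_|_|_|_|_|_|_|_|a <;> rfl

theorem setBank_10 (x : ℤ) :
    (st.mem φ).setBank 10 (cell x) = ({st with tr := x} : Banks).mem φ := by
  funext a
  rcases a with _|_|_|_|_|_|_|_|_|_|_|_|_|_|_|_|a <;> rfl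

theorem setBank_11 (x : ℤ) :
    (st.mem φ).setBank 11 (cell x) = ({st with num := x} : Banks).mem φ := by
  funext a
  rcases a with _|_|_|_|_|_|_|_|_|_|_|_|_|_|_|_|a <;> rfl

theorem setBank_12 (x : ℤ) :
    (st.mem φ).setBank 12 (cell x) = ({st with acc := x} : Banks).mem φ := by
  funext a
  rcases a with _|_|_|_|_|_|_|_|_|_|_|_|_|_|_|_|a <;> rfl

theorem setBank_13 (x : ℤ) :
    (st.mem φ).setBank 13 (cell x) = ({st with c₁ := x} : Banks).mem φ := by
  funext a
  rcases a with _|_|_|_|_|_|_|_|_|_|_|_|_|_|_|_|a <;> rfl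

theorem setBank_14 (x : ℤ) :
    (st.mem φ).setBank 14 (cell x) = ({st with c₂ := x} : Banks).mem φ := by
  funext a
  rcases a with _|_|_|_|_|_|_|_|_|_|_|_|_|_|_|_|a <;> rfl

theorem setBank_15 (x : ℤ) :
    (st.mem φ).setBank 15 (cell x) = ({st with c₃ := x} : Banks).mem φ := by
  funext a
  rcases a with _|_|_|_|_|_|_|_|_|_|_|_|_|_|_|_|a <;> rfl

theorem set_eq_setBank (s : Memory) (a : ℕ) (i x : ℤ) :
    s.set a i x = s.setBank a (Function.update (s a) i x) := rfl

theorem set_10 (x : ℤ) : (st.mem φ).set 10 0 x = ({st with tr := x} : Banks).mem φ := by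
  rw [set_eq_setBank, mem_10, update_cell, setBank_10]

theorem set_11 (x : ℤ) : (st.mem φ).set 11 0 x = ({st with num := x} : Banks).mem φ := by
  rw [set_eq_setBank, mem_11, update_cell, setBank_11]

theorem set_12 (x : ℤ) : (st.mem φ).set 12 0 x = ({st with acc := x} : Banks).mem φ := by
  rw [set_eq_setBank, mem_12, update_cell, setBank_12]

theorem set_13 (x : ℤ) : (st.mem φ).set 13 0 x = ({st with c₁ := x} : Banks).mem φ := by
  rw [set_eq_setBank, mem_13, update_cell, setBank_13]

theorem set_14 (x : ℤ) : (st.mem φ).set 14 0 x = ({st with c₂ := x} : Banks).mem φ := by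
  rw [set_eq_setBank, mem_14, update_cell, setBank_14]

theorem set_15 (x : ℤ) : (st.mem φ).set 15 0 x = ({st with c₃ := x} : Banks).mem φ := by
  rw [set_eq_setBank, mem_15, update_cell, setBank_15]

end Access

theorem mem_zero {n m : ℕ} (φ : Instance n m) :
    Banks.mem φ ⟨fun _ => 0, fun _ => 0, fun _ => 0, fun _ => 0, fun _ => 0, 0, 0, 0, 0, 0, 0⟩ =
      φ.input := by
  funext a
  rcases a with _|_|_|_|_|_|_|_|_|_|_|_|_|_|_|_|a <;>
    first
    | rfl
    | (funext i; exact ite_self 0)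

/-! The expressions for `n`, `m`, `2 * n`, `n + m + 1000` and for the counter of the
innermost loops. -/

def eN : Expr := .get 0 (.const 0)
def eM : Expr := .get 0 (.const 1)
def eD : Expr := .mul (.const 2) eN
def eR : Expr := .add (.add eN eM) (.const 1000)
def eK : Expr := .get 13 (.const 0)

section Eval

variable {n m : ℕ} (φ : Instance n m) (st : Banks)

theorem eval_eN : eN.eval (st.mem φ) = n := mem_0_0 φ st
theorem eval_eM : eM.eval (st.mem φ) = m := mem_0_1 φ st
theorem eval_eD : eD.eval (st.mem φ) = ((2 * n : ℕ) : ℤ) := by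
  push_cast
  rw [← eval_eN φ st]
  rfl
theorem eval_eR : eR.eval (st.mem φ) = (size n m : ℤ) := by
  rw [size]
  push_cast
  rw [← eval_eN φ st, ← eval_eM φ st]
  rfl
theorem eval_eK : eK.eval (st.mem φ) = st.c₁ := rfl

end Eval

/-- Stores the matrix `Instance.sym`, one triangle after the other. -/
def loadProg : Prog :=
  .seq
    (forLoop 13 eM (.assign 5 (.add (.mul (.get 1 eK) eD) (.add eN (.get 2 eK)))
      (.add (.get 5 (.add (.mul (.get 1 eK) eD) (.add eN (.get 2 eK)))) (.get 3 eK))))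
    (forLoop 13 eM (.assign 5 (.add (.mul (.add eN (.get 2 eK)) eD) (.get 1 eK))
      (.add (.get 5 (.add (.mul (.add eN (.get 2 eK)) eD) (.get 1 eK))) (.get 3 eK))))

/-- Stores the matrix `Instance.shifted`, for the current dual variables, in two banks. -/
def shiftProg : Prog :=
  .seq
    (forLoop 13 (.mul eD eD)
      (.assign 6 (.get 13 (.const 0)) (.mul (eR.pow 12) (.get 5 eK))))
  (.seq
    (forLoop 13 eD (.assign 6 (.add (.mul eK eD) eK)
      (.add (.get 6 (.add (.mul eK eD) eK)) (.sub (eR.pow 19) (.mul (.const 2) (.get 9 eK))))))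
    (forLoop 13 (.mul eD eD) (.assign 7 (.get 13 (.const 0)) (.get 6 eK))))

/-- Multiplies the matrix of bank `7` from the left by that of bank `6`, in one loop over all the
triples of indices. The product is collected in bank `8`, which is zero before and after. -/
def mulProg : Prog :=
  .seq
    (forLoop 13 (.mul (.mul eD eD) eD) (.assign 8 (.div eK eD) (.add (.get 8 (.div eK eD))
      (.mul (.get 6 (.add (.mul (.div (.div eK eD) eD) eD) (eK.mod eD)))
        (.get 7 (.add (.mul (eK.mod eD) eD) ((Expr.div eK eD).mod eD)))))))
  (.seq
    (forLoop 13 (.mul eD eD) (.assign 7 (.get 13 (.const 0)) (.get 8 eK)))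
    (forLoop 13 (.mul eD eD) (.assign 8 (.get 13 (.const 0)) (.const 0))))

/-- Computes `Instance.power`. -/
def powerProg : Prog := forLoop 14 (eR.pow 10) mulProg

/-- Computes the trace of the matrix power and its inner product with `Instance.sym`. -/
def traceProg : Prog :=
  .seq (.assign 10 (.const 0) (.const 0))
  (.seq
    (forLoop 13 eD (.assign 10 (.const 0)
      (.add (.get 10 (.const 0)) (.get 7 (.add (.mul eK eD) eK)))))
  (.seq (.assign 11 (.const 0) (.const 0))
    (forLoop 13 (.mul eD eD) (.assign 11 (.const 0)
      (.add (.get 11 (.const 0)) (.mul (.get 5 eK) (.get 7 eK)))))))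

/-- Updates the dual variables and the sum of the objective values. -/
def dualProg : Prog :=
  .seq
    (forLoop 13 eD (.assign 9 eK (.add (.get 9 eK)
      (.sub (.div (.mul (.mul (eR.pow 8) eD) (.get 7 (.add (.mul eK eD) eK)))
        (.get 10 (.const 0))) (eR.pow 8)))))
    (.assign 12 (.const 0) (.add (.get 12 (.const 0))
      (.div (.mul (.mul (eR.pow 8) eD) (.get 11 (.const 0))) (.get 10 (.const 0)))))

/-- The steps of the subgradient method. -/
def stepsProg : Prog :=
  forLoop 15 (eR.pow 9) (.seq shiftProg (.seq powerProg (.seq traceProg dualProg)))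

/-- `max m 1`. -/
def eM' : Expr := .add eM (.div (.const 1) (.add eM (.const 1)))

/-- Stores the result. -/
def outputProg : Prog :=
  .seq (.assign 4 (.const 0)
      (.add (.mul (.mul (.const 2) (eR.pow 17)) (.mul eM' eM'))
        (.mul eM (.add (.get 12 (.const 0)) (eR.pow 17)))))
    (.assign 4 (.const 1) (.mul (.mul (.const 4) (eR.pow 17)) (.mul eM' eM')))

/-- The refutation algorithm. -/
def refuteProg : Prog := .seq loadProg (.seq stepsProg outputProg)

end TwoXORRefutation

/-! ### The run of the program -/

namespace TwoXORRefutation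

open Matrix

/-- A bound on the entries of all the matrix powers that the program computes. Like `size`, it is
irreducible. -/
@[irreducible] def growth (n m : ℕ) : ℕ := size n m ^ (22 * (size n m ^ 10 + 1))

/-- The number of bits that the program uses in a memory cell. -/
@[irreducible] def bits (n m : ℕ) : ℕ := size n m * (40 + 22 * (size n m ^ 10 + 1))

section Bounds

variable (n m : ℕ)

theorem size_ge : (1000 : ℤ) ≤ size n m := by
  rw [size]; push_cast; omega

theorem two_mul_le_size_sq : ((2 * n : ℕ) : ℤ) ≤ (size n m : ℤ) ^ 2 := by
  have h := size_ge n m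
  have h1 : (n : ℤ) ≤ size n m := by rw [size]; push_cast; omega
  push_cast
  nlinarith

theorem le_size : (m : ℤ) ≤ size n m := by
  rw [size]; push_cast; omega

theorem growth_pos : (1 : ℤ) ≤ growth n m := by
  have h := size_ge n m
  rw [growth]
  push_cast
  exact one_le_pow₀ (by linarith)

theorem size_pow_le_growth {k : ℕ} (hk : k ≤ size n m ^ 10 + 1) :
    (size n m : ℤ) ^ (22 * k) ≤ growth n m := by
  have h := size_ge n m
  rw [growth]
  push_cast
  exact pow_le_pow_right₀ (by linarith) (by omega)

theorem size_pow_mul_growth_lt : (size n m : ℤ) ^ 40 * growth n m < 2 ^ bits n m := by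
  have h1 : size n m < 2 ^ size n m := Nat.lt_two_pow_self
  rw [growth, bits]
  generalize 22 * (size n m ^ 10 + 1) = e
  have h2 : size n m ^ (40 + e) < (2 ^ size n m) ^ (40 + e) := Nat.pow_lt_pow_left h1 (by omega)
  rw [← pow_mul, pow_add] at h2
  exact_mod_cast h2

variable {n m}

theorem lt_bits {x c : ℤ} {a : ℕ} (ha : a ≤ 39) (hc : c ≤ 1000)
    (h : x ≤ c * ((size n m : ℤ) ^ a * growth n m)) : x < 2 ^ bits n m := by
  refine h.trans_lt (lt_of_le_of_lt ?_ (size_pow_mul_growth_lt n m))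
  have hr := size_ge n m
  have hg := growth_pos n m
  calc c * ((size n m : ℤ) ^ a * growth n m) ≤ size n m * ((size n m : ℤ) ^ 39 * growth n m) := by
        refine mul_le_mul (by linarith) ?_ (by positivity) (by linarith)
        refine mul_le_mul_of_nonneg_right (pow_le_pow_right₀ (by linarith) ha) (by linarith)
    _ = _ := by ring

theorem lt_bits' {x c : ℤ} {a : ℕ} (ha : a ≤ 39) (hc0 : 0 ≤ c) (hc : c ≤ 1000)
    (h : x ≤ c * (size n m : ℤ) ^ a) : x < 2 ^ bits n m := by
  refine lt_bits ha hc (h.trans (mul_le_mul_of_nonneg_left ?_ hc0))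
  exact le_mul_of_one_le_right (by positivity) (growth_pos n m)

theorem natCast_lt_bits {k a : ℕ} (ha : a ≤ 39) (h : (k : ℤ) ≤ (size n m : ℤ) ^ a) :
    (k : ℤ) < 2 ^ bits n m := lt_bits' (c := 1) ha (by norm_num) (by norm_num) (by linarith)

end Bounds

theorem small_input {n m : ℕ} (φ : Instance n m) : Small (bits n m) φ.input := by
  have hr := size_ge n m
  have hm := le_size n m
  have hn : (n : ℤ) ≤ size n m := by rw [size]; push_cast; omega
  suffices h : ∀ a i, |φ.input a i| ≤ size n m from
    fun a i => lt_bits' (c := 1) (a := 1) (by norm_num) (by norm_num) (by norm_num)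
      (by simpa using h a i)
  intro a i
  rcases a with _ | _ | _ | _ | a
  · refine abs_array_le (f := ![(n : ℤ), (m : ℤ)]) (by positivity) (fun k => ?_) i
    fin_cases k
    · simpa using hn
    · simpa using hm
  · refine abs_array_le (f := fun j => (((φ.edge j).1.1 : ℕ) : ℤ)) (by positivity) (fun k => ?_) i
    have := (φ.edge k).1.1.2
    rw [abs_of_nonneg (by positivity)]
    omega
  · refine abs_array_le (f := fun j => (((φ.edge j).1.2 : ℕ) : ℤ)) (by positivity) (fun k => ?_) i
    have := (φ.edge k).1.2.2
    rw [abs_of_nonneg (by positivity)]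
    omega
  · refine abs_array_le (f := fun j => ((φ.sign j : ℤˣ) : ℤ)) (by positivity) (fun k => ?_) i
    rcases Int.units_eq_one_or (φ.sign k) with h | h <;> rw [h] <;> simp <;> linarith
  · change |(0 : ℤ)| ≤ _
    simp

section Phases

variable {n m : ℕ} (φ : Instance n m)

/-- The program `p` leads from the contents `st` of the working banks to the contents `st'`, in time
at most `p.weight * X`, and the new contents are small. -/
def Steps (X : ℕ) (p : Prog) (st st' : Banks) : Prop :=
  Runs X p (st.mem φ) (st'.mem φ) ∧ Small (bits n m) (st'.mem φ)

variable {φ}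

theorem Steps.mono {X X' : ℕ} {p : Prog} {st st' : Banks} (h : Steps φ X p st st') (hX : X ≤ X') :
    Steps φ X' p st st' := ⟨h.1.mono hX, h.2⟩

theorem Steps.seq {X : ℕ} {p q : Prog} {st st' st'' : Banks} (h : Steps φ X p st st')
    (h' : Steps φ X q st' st'') : Steps φ X (.seq p q) st st'' := ⟨h.1.seq h'.1, h'.2⟩

variable {X : ℕ} {st : Banks}

theorem steps_load (hX : bits n m + 1 ≤ X) (hs : Small (bits n m) (st.mem φ))
    (hW : st.W = flat (0 : Matrix (Fin (2 * n)) (Fin (2 * n)) ℤ)) :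
    Steps φ ((m + 1) * X) loadProg st { st with W := flat φ.sym, c₁ := m } := by
  have hr := size_ge n m
  have hm := le_size n m
  have hmb : (m : ℤ) < 2 ^ bits n m := natCast_lt_bits (a := 1) (by norm_num) (by simpa using hm)
  have hsign : ∀ s : ℤˣ, |(s : ℤ)| ≤ 1 := fun s => by
    rcases Int.units_eq_one_or s with h | h <;> rw [h] <;> simp
  set w : ℕ → ℤ := fun k => if h : k < m then ((φ.sign ⟨k, h⟩ : ℤˣ) : ℤ) else 0 with hw
  have hwa : ∀ k < m, |w k| ≤ 1 := fun k hk => by simp only [hw, dif_pos hk]; exact hsign _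
  -- the first loop
  obtain ⟨h1, h2⟩ := runs_scatter (b := 5) (c := 13) (by norm_num) (s := st.mem φ) (K := eM)
    (α := .add (.mul (.get 1 eK) eD) (.add eN (.get 2 eK))) (v := .get 3 eK) (k₀ := m)
    (a := fun k => if h : k < m then
      ((leftIdx (φ.edge ⟨k, h⟩).1.1 : ℕ) : ℤ) * (2 * n : ℕ) +
        (rightIdx (φ.edge ⟨k, h⟩).1.2 : ℕ) else 0)
    (w := w) (Y := 0) (Y' := 1) hX hs
    (fun f k => by rw [setBank_5, set_13, eval_eM])
    (fun f k hk => by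
      rw [setBank_5, set_13]
      simp only [Expr.eval, eval_eD, eval_eN, eval_eK, mem_1 _ _ hk, mem_2 _ _ hk, dif_pos hk]
      simp only [leftIdx, rightIdx]
      push_cast
      rfl)
    (fun f k hk => by
      rw [setBank_5, set_13]
      simp only [Expr.eval, eval_eK, mem_3 _ _ hk, hw, dif_pos hk])
    hmb (fun i => by rw [mem_5, hW, flat_zero]; simp) hwa (by linarith)
  rw [mem_5, hW, flat_add_sum 0 (fun k => leftIdx (φ.edge k).1.1) (fun k => rightIdx (φ.edge k).1.2)
    (fun k => ((φ.sign k : ℤˣ) : ℤ)) (fun k => by simp) (fun k => by simp [hw]), setBank_5, set_13]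
    at h1 h2
  set M : Matrix (Fin (2 * n)) (Fin (2 * n)) ℤ := 0 + Matrix.of fun i j =>
    ∑ k, if i = leftIdx (φ.edge k).1.1 ∧ j = rightIdx (φ.edge k).1.2 then ((φ.sign k : ℤˣ) : ℤ)
      else 0 with hM
  have hMa : ∀ i j, |M i j| ≤ m := by
    intro i j
    rw [hM, zero_add, Matrix.of_apply]
    refine (Finset.abs_sum_le_sum_abs _ _).trans ?_
    calc _ ≤ ∑ _k : Fin m, (1 : ℤ) := by
          refine Finset.sum_le_sum fun k _ => ?_
          split_ifs
          · exact hsign _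
          · simp
      _ = m := by simp
  -- the second loop
  obtain ⟨h3, h4⟩ := runs_scatter (b := 5) (c := 13) (by norm_num)
    (s := Banks.mem φ { st with W := flat M, c₁ := m }) (K := eM)
    (α := .add (.mul (.add eN (.get 2 eK)) eD) (.get 1 eK)) (v := .get 3 eK) (k₀ := m)
    (a := fun k => if h : k < m then
      ((rightIdx (φ.edge ⟨k, h⟩).1.2 : ℕ) : ℤ) * (2 * n : ℕ) +
        (leftIdx (φ.edge ⟨k, h⟩).1.1 : ℕ) else 0)
    (w := w) (Y := m) (Y' := 1) hX h2
    (fun f k => by rw [setBank_5, set_13, eval_eM])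
    (fun f k hk => by
      rw [setBank_5, set_13]
      simp only [Expr.eval, eval_eD, eval_eN, eval_eK, mem_1 _ _ hk, mem_2 _ _ hk, dif_pos hk]
      simp only [leftIdx, rightIdx]
      push_cast
      rfl)
    (fun f k hk => by
      rw [setBank_5, set_13]
      simp only [Expr.eval, eval_eK, mem_3 _ _ hk, hw, dif_pos hk])
    hmb (fun i => abs_flat_le (by positivity) hMa i) hwa
    (lt_bits' (c := 2) (a := 1) (by norm_num) (by norm_num) (by norm_num) (by linarith))
  rw [mem_5, flat_add_sum M (fun k => rightIdx (φ.edge k).1.2) (fun k => leftIdx (φ.edge k).1.1)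
    (fun k => ((φ.sign k : ℤˣ) : ℤ)) (fun k => by simp) (fun k => by simp [hw]), setBank_5, set_13]
    at h3 h4
  have hsym : (M + Matrix.of fun i j => ∑ k, if i = rightIdx (φ.edge k).1.2 ∧
      j = leftIdx (φ.edge k).1.1 then ((φ.sign k : ℤˣ) : ℤ) else 0) = φ.sym := by
    ext i j
    rw [hM, zero_add, Matrix.add_apply, Matrix.of_apply, Matrix.of_apply, Instance.sym,
      ← Finset.sum_add_distrib]
    refine Finset.sum_congr rfl fun k _ => ?_
    rw [mul_add, mul_ite, mul_ite, mul_one, mul_zero]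
  rw [hsym] at h3 h4
  exact ⟨h1.seq h3, h4⟩

end Phases

end TwoXORRefutation

namespace TwoXORRefutation

open Matrix

section Phases

variable {n m : ℕ} {φ : Instance n m} {X : ℕ} {st : Banks}

theorem two_mul_sq_le (n m : ℕ) : ((2 * n * (2 * n) : ℕ) : ℤ) ≤ (size n m : ℤ) ^ 4 := by
  have h := two_mul_le_size_sq n m
  have h0 : (0 : ℤ) ≤ ((2 * n : ℕ) : ℤ) := by positivity
  rw [Nat.cast_mul]
  nlinarith

theorem two_mul_cube_le (n m : ℕ) : ((2 * n * (2 * n) * (2 * n) : ℕ) : ℤ) ≤ (size n m : ℤ) ^ 6 := by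
  have h := two_mul_le_size_sq n m
  have h' := two_mul_sq_le n m
  have h0 : (0 : ℤ) ≤ ((2 * n : ℕ) : ℤ) := by positivity
  rw [Nat.cast_mul]
  calc _ ≤ (size n m : ℤ) ^ 4 * (size n m : ℤ) ^ 2 := by gcongr
    _ = _ := by ring

theorem abs_sym_le_sq (φ : Instance n m) (i j : Fin (2 * n)) :
    |φ.sym i j| ≤ (size n m : ℤ) ^ 2 := by
  refine (abs_sym_le φ i j).trans ?_
  have h := le_size n m
  have h' := size_ge n m
  nlinarith

theorem abs_shifted_le {z : Fin (2 * n) → ℤ} (hz : ∀ i, |z i| ≤ (size n m : ℤ) ^ 19)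
    (i j : Fin (2 * n)) : |φ.shifted z i j| ≤ (size n m : ℤ) ^ 20 := by
  have hr := size_ge n m
  have h1 := abs_sym_le_sq φ i j
  have h2 : |diagonal (fun i => (size n m : ℤ) ^ 19 - 2 * z i) i j| ≤ 3 * (size n m : ℤ) ^ 19 := by
    by_cases h : i = j
    · subst h
      rw [diagonal_apply_eq, abs_le]
      have := abs_le.mp (hz i)
      have : (0 : ℤ) ≤ (size n m : ℤ) ^ 19 := by positivity
      constructor <;> linarith
    · rw [diagonal_apply_ne _ h]
      simp
  rw [Instance.shifted, Matrix.add_apply, Matrix.smul_apply, smul_eq_mul]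
  refine (abs_add_le _ _).trans ?_
  rw [abs_mul, abs_of_nonneg (by positivity : (0 : ℤ) ≤ (size n m : ℤ) ^ 12)]
  have h3 : (size n m : ℤ) ^ 12 * |φ.sym i j| ≤ (size n m : ℤ) ^ 12 * (size n m : ℤ) ^ 2 := by
    gcongr
  have h4 : (size n m : ℤ) ^ 14 ≤ (size n m : ℤ) ^ 19 :=
    pow_le_pow_right₀ (by linarith) (by norm_num)
  have h5 : 1000 * (size n m : ℤ) ^ 19 ≤ size n m * (size n m : ℤ) ^ 19 := by gcongr
  have h6 : (0 : ℤ) ≤ (size n m : ℤ) ^ 19 := by positivity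
  linarith [pow_add (size n m : ℤ) 12 2, pow_succ' (size n m : ℤ) 19]

theorem abs_shifted_pow_le {z : Fin (2 * n) → ℤ} (hz : ∀ i, |z i| ≤ (size n m : ℤ) ^ 19) (k : ℕ)
    (i j : Fin (2 * n)) : |(φ.shifted z ^ (k + 1)) i j| ≤ (size n m : ℤ) ^ (22 * (k + 1)) := by
  have hr := size_ge n m
  induction k generalizing i j with
  | zero =>
    rw [zero_add, pow_one]
    exact (abs_shifted_le hz i j).trans (pow_le_pow_right₀ (by linarith) (by norm_num))
  | succ k ih =>
    rw [pow_succ']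
    refine (abs_mul_apply_le (abs_shifted_le hz) ih i j).trans ?_
    have h := two_mul_le_size_sq n m
    calc _ ≤ (size n m : ℤ) ^ 2 * ((size n m : ℤ) ^ 20 * (size n m : ℤ) ^ (22 * (k + 1))) := by
          gcongr
      _ = _ := by ring

/-- The values that a loop over the diagonal adds form a diagonal matrix. -/
theorem sum_diagonal {N : ℕ} (u : Fin N → ℤ) :
    (Matrix.of fun i j => ∑ k, if i = k ∧ j = k then u k else 0) = diagonal u := by
  ext i j
  rw [Matrix.of_apply, Finset.sum_eq_single i]
  · by_cases h : i = j
    · subst h; simp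
    · rw [diagonal_apply_ne _ h, if_neg fun h' => h h'.2.symm]
  · intro k _ hk
    rw [if_neg fun h' => hk h'.1.symm]
  · simp

theorem steps_shift {z : Fin (2 * n) → ℤ} {A₀ B₀ : Matrix (Fin (2 * n)) (Fin (2 * n)) ℤ}
    (hX : bits n m + 1 ≤ X)
    (hs : Small (bits n m) (st.mem φ)) (hz : ∀ i, |z i| ≤ (size n m : ℤ) ^ 19)
    (h_W : st.W = flat φ.sym) (h_A : st.A = flat A₀) (h_B : st.B = flat B₀) (h_z : st.z = array z) :
    Steps φ ((2 * n * (2 * n) + 1) * X) shiftProg st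
      { st with
        A := flat (φ.shifted z), B := flat (φ.shifted z), c₁ := (2 * n * (2 * n) : ℕ) } := by
  obtain ⟨W, A, B, C, z', tr, num, acc, c₁, c₂, c₃⟩ := st
  dsimp only at h_W h_A h_B h_z
  subst h_W h_A h_B h_z
  have hr := size_ge n m
  have hD := two_mul_le_size_sq n m
  have hD2 := two_mul_sq_le n m
  have hk2 : ((2 * n * (2 * n) : ℕ) : ℤ) < 2 ^ bits n m :=
    natCast_lt_bits (a := 4) (by norm_num) hD2
  have hk1 : ((2 * n : ℕ) : ℤ) < 2 ^ bits n m := natCast_lt_bits (a := 2) (by norm_num) hD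
  have hsymb : ∀ i j, |(((size n m : ℤ) ^ 12) • φ.sym) i j| ≤ (size n m : ℤ) ^ 14 := fun i j => by
    rw [Matrix.smul_apply, smul_eq_mul, abs_mul, abs_of_nonneg (by positivity)]
    calc _ ≤ (size n m : ℤ) ^ 12 * (size n m : ℤ) ^ 2 :=
          mul_le_mul_of_nonneg_left (abs_sym_le_sq φ i j) (by positivity)
      _ = _ := by ring
  -- the multiple of the constraint matrix
  obtain ⟨h1, h2⟩ := runs_fill (b := 6) (c := 13) (by norm_num)
    (s := Banks.mem φ ⟨flat φ.sym, flat A₀, flat B₀, C, array z, tr, num, acc, c₁, c₂, c₃⟩)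
    (K := .mul eD eD) (v := .mul (eR.pow 12) (.get 5 eK)) (k₀ := 2 * n * (2 * n))
    (w := flat (((size n m : ℤ) ^ 12) • φ.sym)) hX hs
    (fun f k => by
      rw [setBank_6, set_13]
      simp only [Expr.eval, eval_eD]
      push_cast
      rfl)
    (fun f k hk => by
      rw [setBank_6, set_13, flat_smul]
      simp only [Expr.eval, Expr.eval_pow, eval_eR, eval_eK, mem_5])
    hk2 (fun k hk => lt_bits' (c := 1) (a := 14) (by norm_num) (by norm_num) (by norm_num)
      (by rw [one_mul]; exact abs_flat_le (by positivity) hsymb k))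
  rw [mem_6] at h1 h2
  dsimp only at h1 h2
  rw [fill_flat, setBank_6, set_13] at h1 h2
  dsimp only at h1 h2
  -- the diagonal
  obtain ⟨h3, h4⟩ := runs_scatter (b := 6) (c := 13) (by norm_num)
    (s := Banks.mem φ ⟨flat φ.sym, flat (((size n m : ℤ) ^ 12) • φ.sym), flat B₀, C, array z, tr,
      num, acc, (2 * n * (2 * n) : ℕ), c₂, c₃⟩) (K := eD)
    (α := .add (.mul eK eD) eK) (v := .sub (eR.pow 19) (.mul (.const 2) (.get 9 eK)))
    (k₀ := 2 * n) (a := fun k => (k : ℤ) * (2 * n : ℕ) + k)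
    (w := fun k => (size n m : ℤ) ^ 19 - 2 * array z k)
    (Y := (size n m : ℤ) ^ 14) (Y' := 3 * (size n m : ℤ) ^ 19) hX h2
    (fun f k => by rw [setBank_6, set_13, eval_eD])
    (fun f k hk => by
      rw [setBank_6, set_13]
      simp only [Expr.eval, eval_eD, eval_eK])
    (fun f k hk => by
      rw [setBank_6, set_13]
      simp only [Expr.eval, Expr.eval_pow, eval_eR, eval_eK, mem_9])
    hk1 (fun i => abs_flat_le (by positivity) hsymb i)
    (fun k hk => by
      have := abs_le.mp (abs_array_le (f := z) (by positivity) hz k)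
      have : (0 : ℤ) ≤ (size n m : ℤ) ^ 19 := by positivity
      rw [abs_le]
      constructor <;> linarith)
    (lt_bits' (c := 4) (a := 21) (by norm_num) (by norm_num) (by norm_num) (by
      have e1 : (size n m : ℤ) ^ 14 ≤ (size n m : ℤ) ^ 21 :=
        pow_le_pow_right₀ (by linarith) (by norm_num)
      have e2 : ((2 * n : ℕ) : ℤ) * (3 * (size n m : ℤ) ^ 19) ≤
          (size n m : ℤ) ^ 2 * (3 * (size n m : ℤ) ^ 19) := by gcongr
      linarith [pow_add (size n m : ℤ) 2 19]))
  rw [mem_6] at h3 h4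
  dsimp only at h3 h4
  rw [flat_add_sum (((size n m : ℤ) ^ 12) • φ.sym) id id
    (fun k => (size n m : ℤ) ^ 19 - 2 * z k) (fun k => rfl)
    (fun k => by simp only [array_apply z k.2])] at h3 h4
  simp only [id] at h3 h4
  rw [sum_diagonal, setBank_6, set_13] at h3 h4
  change Runs _ _ _ (Banks.mem φ
    ⟨flat φ.sym, flat (φ.shifted z), flat B₀, C, array z, tr, num, acc, (2 * n : ℕ), c₂, c₃⟩) at h3
  change Small _ (Banks.mem φ
    ⟨flat φ.sym, flat (φ.shifted z), flat B₀, C, array z, tr, num, acc, (2 * n : ℕ), c₂, c₃⟩) at h4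
  -- the copy
  obtain ⟨h5, h6⟩ := runs_fill (b := 7) (c := 13) (by norm_num)
    (s := Banks.mem φ
      ⟨flat φ.sym, flat (φ.shifted z), flat B₀, C, array z, tr, num, acc, (2 * n : ℕ), c₂, c₃⟩)
    (K := .mul eD eD) (v := .get 6 eK) (k₀ := 2 * n * (2 * n)) (w := flat (φ.shifted z)) hX h4
    (fun f k => by
      rw [setBank_7, set_13]
      simp only [Expr.eval, eval_eD]
      push_cast
      rfl)
    (fun f k hk => by
      rw [setBank_7, set_13]
      simp only [Expr.eval, eval_eK, mem_6])
    hk2 (fun k hk => lt_bits' (c := 1) (a := 20) (by norm_num) (by norm_num) (by norm_num)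
      (by rw [one_mul]; exact abs_flat_le (by positivity) (abs_shifted_le hz) k))
  rw [mem_7] at h5 h6
  dsimp only at h5 h6
  rw [fill_flat, setBank_7, set_13] at h5 h6
  dsimp only at h5 h6
  refine ⟨h1.seq (Runs.seq (h3.mono ?_) h5), h6⟩
  exact Nat.mul_le_mul_right _ (by nlinarith)

theorem steps_mul {A B : Matrix (Fin (2 * n)) (Fin (2 * n)) ℤ} (hX : bits n m + 1 ≤ X)
    (hs : Small (bits n m) (st.mem φ)) (hA : ∀ i j, |A i j| ≤ (size n m : ℤ) ^ 20)
    (hB : ∀ i j, |B i j| ≤ growth n m) (hAB : ∀ i j, |(A * B) i j| ≤ growth n m)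
    (h_A : st.A = flat A) (h_B : st.B = flat B)
    (h_C : st.C = flat (0 : Matrix (Fin (2 * n)) (Fin (2 * n)) ℤ)) :
    Steps φ ((2 * n * (2 * n) * (2 * n) + 1) * X) mulProg st
      { st with B := flat (A * B), c₁ := (2 * n * (2 * n) : ℕ) } := by
  obtain ⟨W, A', B', C, z, tr, num, acc, c₁, c₂, c₃⟩ := st
  dsimp only at h_A h_B h_C
  subst h_A h_B h_C
  have hr := size_ge n m
  have hg := growth_pos n m
  have hD2 := two_mul_sq_le n m
  have hD3 := two_mul_cube_le n m
  have hk2 : ((2 * n * (2 * n) : ℕ) : ℤ) < 2 ^ bits n m :=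
    natCast_lt_bits (a := 4) (by norm_num) hD2
  have hk3 : ((2 * n * (2 * n) * (2 * n) : ℕ) : ℤ) < 2 ^ bits n m :=
    natCast_lt_bits (a := 6) (by norm_num) hD3
  have hABb : ∀ k : ℤ, |flat (A * B) k| < 2 ^ bits n m := fun k =>
    lt_bits (c := 1) (a := 0) (by norm_num) (by norm_num)
      (by rw [one_mul, pow_zero, one_mul]; exact abs_flat_le (by linarith) hAB k)
  -- the product
  obtain ⟨h1, h2⟩ := runs_scatter (b := 8) (c := 13) (by norm_num)
    (s := Banks.mem φ ⟨W, flat A, flat B, flat 0, z, tr, num, acc, c₁, c₂, c₃⟩)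
    (K := .mul (.mul eD eD) eD) (α := .div eK eD)
    (v := .mul (.get 6 (.add (.mul (.div (.div eK eD) eD) eD) (eK.mod eD)))
        (.get 7 (.add (.mul (eK.mod eD) eD) ((Expr.div eK eD).mod eD))))
    (k₀ := 2 * n * (2 * n) * (2 * n)) (a := fun k => ((k / (2 * n) : ℕ) : ℤ))
    (w := fun k => flat A (((k / (2 * n) / (2 * n) : ℕ) : ℤ) * (2 * n : ℕ) + (k % (2 * n) : ℕ)) *
        flat B (((k % (2 * n) : ℕ) : ℤ) * (2 * n : ℕ) + (k / (2 * n) % (2 * n) : ℕ)))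
    (Y := 0) (Y' := (size n m : ℤ) ^ 20 * growth n m) hX hs
    (fun f k => by
      rw [setBank_8, set_13]
      simp only [Expr.eval, eval_eD]
      push_cast
      rfl)
    (fun f k hk => by
      rw [setBank_8, set_13]
      simp only [Expr.eval, eval_eD, eval_eK]
      norm_cast)
    (fun f k hk => by
      rw [setBank_8, set_13]
      simp only [Expr.eval, Expr.eval_mod, eval_eD, eval_eK, mem_6, mem_7]
      norm_cast)
    hk3 (fun i => by rw [mem_8]; simp [flat_zero])
    (fun k hk => by
      rw [abs_mul]
      exact mul_le_mul (abs_flat_le (by positivity) hA _) (abs_flat_le (by linarith) hB _)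
        (abs_nonneg _) (by positivity))
    (lt_bits (c := 1) (a := 26) (by norm_num) (by norm_num) (by
      calc _ ≤ 0 + (size n m : ℤ) ^ 6 * ((size n m : ℤ) ^ 20 * growth n m) := by gcongr
        _ = _ := by ring))
  rw [mem_8] at h1 h2
  simp only [flat_zero] at h1 h2
  rw [flat_mul, setBank_8, set_13] at h1 h2
  dsimp only at h1 h2
  rw [← flat_zero (N := 2 * n)] at h1
  -- the copy
  obtain ⟨h3, h4⟩ := runs_fill (b := 7) (c := 13) (by norm_num)
    (s := Banks.mem φ ⟨W, flat A, flat B, flat (A * B), z, tr, num, acc,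
      (2 * n * (2 * n) * (2 * n) : ℕ), c₂, c₃⟩) (K := .mul eD eD)
    (v := .get 8 eK) (k₀ := 2 * n * (2 * n)) (w := flat (A * B)) hX h2
    (fun f k => by
      rw [setBank_7, set_13]
      simp only [Expr.eval, eval_eD]
      push_cast
      rfl)
    (fun f k hk => by
      rw [setBank_7, set_13]
      simp only [Expr.eval, eval_eK, mem_8])
    hk2 (fun k hk => hABb k)
  rw [mem_7] at h3 h4
  dsimp only at h3 h4
  rw [fill_flat, setBank_7, set_13] at h3 h4
  dsimp only at h3 h4
  -- the accumulator is cleared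
  obtain ⟨h5, h6⟩ := runs_fill (b := 8) (c := 13) (by norm_num)
    (s := Banks.mem φ ⟨W, flat A, flat (A * B), flat (A * B), z, tr, num, acc,
      (2 * n * (2 * n) : ℕ), c₂, c₃⟩) (K := .mul eD eD)
    (v := .const 0) (k₀ := 2 * n * (2 * n))
    (w := flat (0 : Matrix (Fin (2 * n)) (Fin (2 * n)) ℤ)) hX h4
    (fun f k => by
      rw [setBank_8, set_13]
      simp only [Expr.eval, eval_eD]
      push_cast
      rfl)
    (fun f k hk => by rw [flat_zero]; rfl)
    hk2 (fun k hk => by rw [flat_zero]; simp)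
  rw [mem_8] at h5 h6
  dsimp only at h5 h6
  rw [fill_flat, setBank_8, set_13] at h5 h6
  dsimp only at h5 h6
  have hle : (2 * n * (2 * n) + 1) * X ≤ (2 * n * (2 * n) * (2 * n) + 1) * X := by
    refine Nat.mul_le_mul_right _ (Nat.add_le_add_right ?_ 1)
    rcases Nat.eq_zero_or_pos n with rfl | hn
    · simp
    · exact Nat.le_mul_of_pos_right _ (by omega)
  exact ⟨h1.seq (Runs.seq (h3.mono hle) (h5.mono hle)), h6⟩

end Phases

end TwoXORRefutation

namespace TwoXORRefutation

open Matrix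

section Phases

variable {n m : ℕ} {φ : Instance n m} {X : ℕ} {st : Banks}

theorem steps_power {z : Fin (2 * n) → ℤ} (hX : bits n m + 1 ≤ X)
    (hs : Small (bits n m) (st.mem φ)) (hz : ∀ i, |z i| ≤ (size n m : ℤ) ^ 19)
    (h_A : st.A = flat (φ.shifted z)) (h_B : st.B = flat (φ.shifted z))
    (h_C : st.C = flat (0 : Matrix (Fin (2 * n)) (Fin (2 * n)) ℤ)) :
    ∃ c₁ c₂, Steps φ ((size n m ^ 10 + 1) * ((2 * n * (2 * n) * (2 * n) + 1) * X)) powerProg st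
      { st with B := flat (φ.power z), c₁ := c₁, c₂ := c₂ } := by
  have hX' : bits n m + 1 ≤ (2 * n * (2 * n) * (2 * n) + 1) * X :=
    hX.trans (Nat.le_mul_of_pos_left _ (by omega))
  have hpow : ∀ k ≤ size n m ^ 10, ∀ i j, |(φ.shifted z ^ (k + 1)) i j| ≤ growth n m :=
    fun k hk i j => (abs_shifted_pow_le hz k i j).trans (size_pow_le_growth n m (by omega))
  have h := runs_forLoop (c := 14) (K := eR.pow 10) (p := mulProg)
    (k₀ := size n m ^ 10) (s := st.mem φ)
    (I := fun k s => ∃ c : ℤ, s = Banks.mem φ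
      { st with B := flat (φ.shifted z ^ (k + 1)), c₁ := c, c₂ := k } ∧ Small (bits n m) s) hX'
    ?_ ?_ hs ?_
  · obtain ⟨s', hr, c, rfl, hs'⟩ := h
    exact ⟨c, (size n m ^ 10 : ℕ), hr, hs'⟩
  · rintro k - s ⟨c, rfl, hs⟩
    refine ⟨?_, rfl, hs⟩
    rw [Expr.eval_pow, eval_eR]
    push_cast
    rfl
  · rintro k hk s ⟨c, rfl, hs⟩
    have h := steps_mul (st := { st with B := flat (φ.shifted z ^ (k + 1)), c₁ := c, c₂ := k }) hX
      hs (abs_shifted_le hz) (hpow k hk.le) (fun i j => by rw [← pow_succ']; exact hpow _ hk i j)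
      h_A rfl h_C
    rw [← pow_succ'] at h
    have hkb : |((k : ℤ) + 1)| < 2 ^ bits n m := by
      rw [abs_of_nonneg (by positivity)]
      exact lt_bits' (c := 1) (a := 10) (by norm_num) (by norm_num) (by norm_num)
        (by rw [one_mul]; exact_mod_cast hk)
    refine ⟨_, h.1, rfl, h.2, (2 * n * (2 * n) : ℕ), ?_, h.2.set 14 0 hkb⟩
    rw [set_14]
    push_cast
    rfl
  · refine ⟨st.c₁, ?_, hs.set 14 0 (by simp)⟩
    rw [set_14, zero_add, pow_one, ← h_B]
    rfl

theorem cell_add_sum (x : ℤ) (K : ℕ) (w : ℕ → ℤ) :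
    (fun i => cell x i + ∑ k ∈ Finset.range K, if (0 : ℤ) = i then w k else 0) =
      cell (x + ∑ k ∈ Finset.range K, w k) := by
  funext i
  by_cases h : i = 0
  · subst h; simp
  · simp [cell, h, Ne.symm h]

theorem steps_trace {P : Matrix (Fin (2 * n)) (Fin (2 * n)) ℤ}
    (hX : bits n m + 1 ≤ X) (hs : Small (bits n m) (st.mem φ))
    (hP : ∀ i j, |P i j| ≤ growth n m)
    (h_W : st.W = flat φ.sym) (h_B : st.B = flat P) :
    Steps φ ((2 * n * (2 * n) + 1) * X) traceProg st
      { st with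
        tr := P.trace, num := ∑ i, ∑ j, φ.sym i j * P i j, c₁ := (2 * n * (2 * n) : ℕ) } := by
  obtain ⟨W, A, B, C, z, tr, num, acc, c₁, c₂, c₃⟩ := st
  dsimp only at h_W h_B
  subst h_W h_B
  have hr := size_ge n m
  have hg := growth_pos n m
  have hD := two_mul_le_size_sq n m
  have hD2 := two_mul_sq_le n m
  have hk2 : ((2 * n * (2 * n) : ℕ) : ℤ) < 2 ^ bits n m :=
    natCast_lt_bits (a := 4) (by norm_num) hD2
  have hk1 : ((2 * n : ℕ) : ℤ) < 2 ^ bits n m := natCast_lt_bits (a := 2) (by norm_num) hD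
  have hle : X ≤ (2 * n * (2 * n) + 1) * X := Nat.le_mul_of_pos_left _ (by omega)
  have hcell : ∀ i, |cell 0 i| ≤ (0 : ℤ) := fun i => by simp [cell]
  have h1 := (Runs.assign hs hX 10 (.const 0) (.const 0)).mono hle
  have h2 := hs.set 10 0 (x := 0) (by simp)
  change Runs _ _ _ (Memory.set _ 10 0 0) at h1
  rw [set_10] at h1 h2
  dsimp only at h1 h2
  obtain ⟨h3, h4⟩ := runs_scatter (b := 10) (c := 13) (by norm_num)
    (s := Banks.mem φ ⟨flat φ.sym, A, flat P, C, z, 0, num, acc, c₁, c₂, c₃⟩) (K := eD)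
    (α := .const 0) (v := .get 7 (.add (.mul eK eD) eK)) (k₀ := 2 * n) (a := fun _ => 0)
    (w := fun k => flat P ((k : ℤ) * (2 * n : ℕ) + k)) (Y := 0) (Y' := growth n m) hX h2
    -- bank `10` holds an arbitrary array here, but the expressions read other banks only
    (fun f k => eval_eD φ ⟨flat φ.sym, A, flat P, C, z, 0, num, acc, c₁, c₂, c₃⟩)
    (fun f k hk => rfl)
    (fun f k hk => by
      rw [← eval_eD φ ⟨flat φ.sym, A, flat P, C, z, 0, num, acc, c₁, c₂, c₃⟩]
      rfl)
    hk1 (fun i => by rw [mem_10]; exact hcell i)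
    (fun k hk => abs_flat_le (by linarith) hP _)
    (lt_bits (c := 1) (a := 2) (by norm_num) (by norm_num) (by
      rw [one_mul, zero_add]; gcongr))
  rw [mem_10] at h3 h4
  dsimp only at h3 h4
  rw [cell_add_sum, zero_add, sum_flat_diag, setBank_10, set_13] at h3 h4
  dsimp only at h3 h4
  have h5 := (Runs.assign h4 hX 11 (.const 0) (.const 0)).mono hle
  have h6 := h4.set 11 0 (x := 0) (by simp)
  change Runs _ _ _ (Memory.set _ 11 0 0) at h5
  rw [set_11] at h5 h6
  dsimp only at h5 h6
  obtain ⟨h7, h8⟩ := runs_scatter (b := 11) (c := 13) (by norm_num)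
    (s := Banks.mem φ ⟨flat φ.sym, A, flat P, C, z, P.trace, 0, acc, (2 * n : ℕ), c₂, c₃⟩)
    (K := .mul eD eD) (α := .const 0) (v := .mul (.get 5 eK) (.get 7 eK)) (k₀ := 2 * n * (2 * n))
    (a := fun _ => 0) (w := fun k => flat φ.sym k * flat P k) (Y := 0)
    (Y' := (size n m : ℤ) ^ 2 * growth n m) hX h6
    (fun f k => by
      have h := eval_eD φ ⟨flat φ.sym, A, flat P, C, z, P.trace, 0, acc, (2 * n : ℕ), c₂, c₃⟩
      rw [Nat.cast_mul (2 * n) (2 * n), ← h]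
      rfl)
    (fun f k hk => rfl)
    (fun f k hk => rfl)
    hk2 (fun i => by rw [mem_11]; exact hcell i)
    (fun k hk => by
      rw [abs_mul]
      exact mul_le_mul (abs_flat_le (by positivity) (abs_sym_le_sq φ) _)
        (abs_flat_le (by linarith) hP _) (abs_nonneg _) (by positivity))
    (lt_bits (c := 1) (a := 6) (by norm_num) (by norm_num) (by
      calc _ ≤ 0 + (size n m : ℤ) ^ 4 * ((size n m : ℤ) ^ 2 * growth n m) := by gcongr
        _ = _ := by ring))
  rw [mem_11] at h7 h8
  dsimp only at h7 h8
  rw [cell_add_sum, zero_add, sum_flat_mul, setBank_11, set_13] at h7 h8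
  dsimp only at h7 h8
  refine ⟨h1.seq (Runs.seq (h3.mono ?_) (h5.seq h7)), h8⟩
  exact Nat.mul_le_mul_right _ (by nlinarith)

theorem steps_dual {P : Matrix (Fin (2 * n)) (Fin (2 * n)) ℤ} {z : Fin (2 * n) → ℤ}
    (hX : bits n m + 1 ≤ X) (hs : Small (bits n m) (st.mem φ))
    (hP : ∀ i j, |P i j| ≤ growth n m) (hz : ∀ i, |z i| ≤ (size n m : ℤ) ^ 19)
    (hnum : |st.num| ≤ (size n m : ℤ) ^ 6 * growth n m)
    (hacc : |st.acc| ≤ (size n m : ℤ) ^ 25 * growth n m)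
    (h_B : st.B = flat P) (h_z : st.z = array z) :
    Steps φ ((2 * n + 1) * X) dualProg st
      { st with
        z := array fun i => z i +
          ((size n m : ℤ) ^ 8 * (2 * n) * P i i / st.tr - (size n m : ℤ) ^ 8)
        acc := st.acc + (size n m : ℤ) ^ 8 * (2 * n) * st.num / st.tr
        c₁ := (2 * n : ℕ) } := by
  obtain ⟨W, A, B, C, z', tr, num, acc, c₁, c₂, c₃⟩ := st
  dsimp only at h_B h_z hnum hacc ⊢
  subst h_B h_z
  have hr := size_ge n m
  have hg := growth_pos n m
  have hD := two_mul_le_size_sq n m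
  have hD0 : (0 : ℤ) ≤ ((2 * n : ℕ) : ℤ) := by positivity
  have hk1 : ((2 * n : ℕ) : ℤ) < 2 ^ bits n m := natCast_lt_bits (a := 2) (by norm_num) hD
  have hle : X ≤ (2 * n + 1) * X := Nat.le_mul_of_pos_left _ (by omega)
  have hquot : ∀ x y c : ℤ, |x| ≤ c →
      |(size n m : ℤ) ^ 8 * (2 * n : ℕ) * x / y| ≤ (size n m : ℤ) ^ 10 * c := by
    intro x y c hx
    refine (abs_ediv_le _ _).trans ?_
    rw [abs_mul, abs_of_nonneg (by positivity)]
    calc _ ≤ (size n m : ℤ) ^ 8 * (size n m : ℤ) ^ 2 * c := by gcongr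
      _ = _ := by ring
  obtain ⟨h1, h2⟩ := runs_scatter (b := 9) (c := 13) (by norm_num)
    (s := Banks.mem φ ⟨W, A, flat P, C, array z, tr, num, acc, c₁, c₂, c₃⟩)
    (K := eD) (α := eK)
    (v := .sub (.div (.mul (.mul (eR.pow 8) eD) (.get 7 (.add (.mul eK eD) eK)))
        (.get 10 (.const 0))) (eR.pow 8)) (k₀ := 2 * n)
    (a := fun k => (k : ℤ))
    (w := fun k => (size n m : ℤ) ^ 8 * (2 * n : ℕ) * flat P ((k : ℤ) * (2 * n : ℕ) + k) / tr -
      (size n m : ℤ) ^ 8)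
    (Y := (size n m : ℤ) ^ 19) (Y' := 2 * ((size n m : ℤ) ^ 10 * growth n m)) hX hs
    (fun f k => by rw [setBank_9, set_13, eval_eD])
    (fun f k hk => by rw [setBank_9, set_13, eval_eK])
    (fun f k hk => by
      rw [setBank_9, set_13]
      simp only [Expr.eval, Expr.eval_pow, eval_eD, eval_eR, eval_eK, mem_7, mem_10, cell_zero])
    hk1 (fun i => abs_array_le (by positivity) hz i)
    (fun k hk => by
      refine (abs_sub _ _).trans ?_
      have e1 := hquot _ tr _ (abs_flat_le (by linarith) hP ((k : ℤ) * (2 * n : ℕ) + k))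
      have e2 : |(size n m : ℤ) ^ 8| ≤ (size n m : ℤ) ^ 10 * growth n m := by
        rw [abs_of_nonneg (by positivity)]
        exact (pow_le_pow_right₀ (by linarith) (by norm_num)).trans
          (le_mul_of_one_le_right (by positivity) hg)
      linarith)
    (lt_bits (c := 3) (a := 19) (by norm_num) (by norm_num) (by
      have e1 : (size n m : ℤ) ^ 19 ≤ (size n m : ℤ) ^ 19 * growth n m :=
        le_mul_of_one_le_right (by positivity) hg
      have e2 : ((2 * n : ℕ) : ℤ) * (2 * ((size n m : ℤ) ^ 10 * growth n m)) ≤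
          (size n m : ℤ) ^ 2 * (2 * ((size n m : ℤ) ^ 10 * growth n m)) := by gcongr
      have e3 : (size n m : ℤ) ^ 12 * growth n m ≤ (size n m : ℤ) ^ 19 * growth n m :=
        mul_le_mul_of_nonneg_right (pow_le_pow_right₀ (by linarith) (by norm_num)) (by linarith)
      have e4 : (size n m : ℤ) ^ 2 * (2 * ((size n m : ℤ) ^ 10 * growth n m)) =
        2 * ((size n m : ℤ) ^ 12 * growth n m) := by ring
      linarith))
  rw [mem_9] at h1 h2
  dsimp only at h1 h2
  rw [array_add_sum z (fun i => (size n m : ℤ) ^ 8 * (2 * n : ℕ) * P i i / tr -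
    (size n m : ℤ) ^ 8) (fun k => by rw [flat_address]), setBank_9, set_13] at h1 h2
  dsimp only at h1 h2
  have h3 := (Runs.assign h2 hX 12 (.const 0) (.add (.get 12 (.const 0))
      (.div (.mul (.mul (eR.pow 8) eD) (.get 11 (.const 0))) (.get 10 (.const 0))))).mono hle
  simp only [Expr.eval, Expr.eval_pow, eval_eD, eval_eR, mem_10, mem_11, mem_12, cell_zero] at h3
  have h4 := h2.set 12 0 (x := acc + (size n m : ℤ) ^ 8 * (2 * n : ℕ) * num / tr)
    (lt_bits (c := 2) (a := 25) (by norm_num) (by norm_num) (by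
      have e1 := hquot num tr _ hnum
      have e2 : (size n m : ℤ) ^ 16 * growth n m ≤ (size n m : ℤ) ^ 25 * growth n m :=
        mul_le_mul_of_nonneg_right (pow_le_pow_right₀ (by linarith) (by norm_num)) (by linarith)
      have e3 : (size n m : ℤ) ^ 10 * ((size n m : ℤ) ^ 6 * growth n m) =
        (size n m : ℤ) ^ 16 * growth n m := by ring
      have e4 := abs_add_le acc ((size n m : ℤ) ^ 8 * (2 * n : ℕ) * num / tr)
      linarith))
  rw [set_12] at h3 h4
  dsimp only at h3 h4
  simp only [Nat.cast_mul 2 n, Nat.cast_ofNat] at h1 h3 h4 ⊢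
  exact ⟨h1.seq h3, h4⟩

end Phases

end TwoXORRefutation

namespace TwoXORRefutation

open Matrix

section Phases

variable {n m : ℕ} {φ : Instance n m} {X : ℕ} {st : Banks}

theorem abs_sum_sym_mul_le (φ : Instance n m) {P : Matrix (Fin (2 * n)) (Fin (2 * n)) ℤ} {c : ℤ}
    (hc : 0 ≤ c) (hP : ∀ i j, |P i j| ≤ c) :
    |∑ i, ∑ j, φ.sym i j * P i j| ≤ (size n m : ℤ) ^ 6 * c := by
  rw [← sum_flat_mul]
  refine (Finset.abs_sum_le_sum_abs _ _).trans ?_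
  calc _ ≤ ∑ _k ∈ Finset.range (2 * n * (2 * n)), (size n m : ℤ) ^ 2 * c := by
        refine Finset.sum_le_sum fun k _ => ?_
        rw [abs_mul]
        exact mul_le_mul (abs_flat_le (by positivity) (abs_sym_le_sq φ) _)
          (abs_flat_le hc hP _) (abs_nonneg _) (by positivity)
    _ = ((2 * n * (2 * n) : ℕ) : ℤ) * ((size n m : ℤ) ^ 2 * c) := by
        rw [Finset.sum_const, Finset.card_range, nsmul_eq_mul]
    _ ≤ (size n m : ℤ) ^ 4 * ((size n m : ℤ) ^ 2 * c) := by
        gcongr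
        exact two_mul_sq_le n m
    _ = _ := by ring

theorem abs_power_le {z : Fin (2 * n) → ℤ} (hz : ∀ i, |z i| ≤ (size n m : ℤ) ^ 19)
    (i j : Fin (2 * n)) : |φ.power z i j| ≤ growth n m :=
  (abs_shifted_pow_le hz _ i j).trans (size_pow_le_growth n m le_rfl)

theorem abs_dual_le_pow (φ : Instance n m) {t : ℕ} (ht : t ≤ size n m ^ 9) (i : Fin (2 * n)) :
    |φ.dual t i| ≤ (size n m : ℤ) ^ 19 := by
  refine (abs_dual_le φ ht i).trans ?_
  have h := two_mul_le_size_sq n m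
  push_cast at h
  have ht' : (t : ℤ) ≤ (size n m : ℤ) ^ 9 := by exact_mod_cast ht
  calc _ ≤ (size n m : ℤ) ^ 9 * ((size n m : ℤ) ^ 2 * (size n m : ℤ) ^ 8) := by gcongr
    _ = _ := by ring

theorem abs_total_le (φ : Instance n m) {t : ℕ} (ht : t ≤ size n m ^ 9) :
    |φ.total t| ≤ (size n m : ℤ) ^ 25 * growth n m := by
  have hg := growth_pos n m
  have hD := two_mul_le_size_sq n m
  push_cast at hD
  have ht' : (t : ℤ) ≤ (size n m : ℤ) ^ 9 := by exact_mod_cast ht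
  refine (Finset.abs_sum_le_sum_abs _ _).trans ?_
  calc _ ≤ ∑ _k ∈ Finset.range t, (size n m : ℤ) ^ 16 * growth n m := by
        refine Finset.sum_le_sum fun k hk => ?_
        have hk' := Finset.mem_range.mp hk
        refine (abs_ediv_le _ _).trans ?_
        rw [abs_mul, abs_of_nonneg (by positivity)]
        have h := abs_sum_sym_mul_le φ (by linarith)
          (abs_power_le (φ := φ) (abs_dual_le_pow φ (hk'.le.trans ht)))
        calc _ ≤ (size n m : ℤ) ^ 8 * (size n m : ℤ) ^ 2 *
              ((size n m : ℤ) ^ 6 * growth n m) := by gcongr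
          _ = _ := by ring
    _ = t * ((size n m : ℤ) ^ 16 * growth n m) := by
        rw [Finset.sum_const, Finset.card_range, nsmul_eq_mul]
    _ ≤ (size n m : ℤ) ^ 9 * ((size n m : ℤ) ^ 16 * growth n m) := by gcongr
    _ = _ := by ring

theorem steps_iterate {A₀ B₀ : Matrix (Fin (2 * n)) (Fin (2 * n)) ℤ} (hX : bits n m + 1 ≤ X)
    (hs : Small (bits n m) (st.mem φ)) (h_W : st.W = flat φ.sym) (h_A : st.A = flat A₀)
    (h_B : st.B = flat B₀) (h_C : st.C = flat (0 : Matrix (Fin (2 * n)) (Fin (2 * n)) ℤ))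
    (h_z : st.z = array (φ.dual 0)) (h_acc : st.acc = 0) :
    ∃ st', st'.acc = φ.total (size n m ^ 9) ∧
      Steps φ ((size n m ^ 9 + 1) *
        ((size n m ^ 10 + 1) * ((2 * n * (2 * n) * (2 * n) + 1) * X))) stepsProg st st' := by
  obtain ⟨W, A, B, C, z, tr, num, acc, c₁, c₂, c₃⟩ := st
  dsimp only at h_W h_A h_B h_C h_z h_acc
  subst h_W h_A h_B h_C h_z h_acc
  set Y := (2 * n * (2 * n) * (2 * n) + 1) * X with hY
  have hYX : ∀ k ≤ 2 * n * (2 * n) * (2 * n), (k + 1) * X ≤ (size n m ^ 10 + 1) * Y := by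
    intro k hk
    refine (Nat.mul_le_mul_right X (Nat.add_le_add_right hk 1)).trans ?_
    exact Nat.le_mul_of_pos_left _ (by omega)
  have hN2 : 2 * n * (2 * n) ≤ 2 * n * (2 * n) * (2 * n) := by
    rcases Nat.eq_zero_or_pos n with rfl | hn
    · simp
    · exact Nat.le_mul_of_pos_right _ (by omega)
  have hN1 : 2 * n ≤ 2 * n * (2 * n) := by nlinarith
  have hX' : bits n m + 1 ≤ (size n m ^ 10 + 1) * Y := by
    refine hX.trans (le_trans ?_ (hYX 0 (by omega)))
    omega
  have h := runs_forLoop (c := 15) (K := eR.pow 9)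
    (p := .seq shiftProg (.seq powerProg (.seq traceProg dualProg))) (k₀ := size n m ^ 9)
    (s := Banks.mem φ ⟨flat φ.sym, flat A₀, flat B₀, flat 0, array (φ.dual 0), tr, num, 0,
      c₁, c₂, c₃⟩)
    (I := fun t s => ∃ (A B : Matrix (Fin (2 * n)) (Fin (2 * n)) ℤ) (tr num c₁ c₂ : ℤ),
      s = Banks.mem φ ⟨flat φ.sym, flat A, flat B, flat (0 : Matrix (Fin (2 * n)) (Fin (2 * n)) ℤ),
        array (φ.dual t), tr, num, φ.total t, c₁, c₂, t⟩ ∧ Small (bits n m) s) hX' ?_ ?_ hs ?_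
  · obtain ⟨s', hr, A, B, tr', num', c₁', c₂', rfl, hs'⟩ := h
    exact ⟨_, rfl, hr, hs'⟩
  · rintro t - s ⟨A, B, tr, num, c₁, c₂, rfl, hs⟩
    refine ⟨?_, rfl, hs⟩
    rw [Expr.eval_pow, eval_eR]
    push_cast
    rfl
  · rintro t ht s ⟨A, B, tr, num, c₁, c₂, rfl, hs⟩
    have hg := growth_pos n m
    have hz := abs_dual_le_pow φ ht.le
    have hP := abs_power_le (φ := φ) hz
    have h1 := steps_shift hX hs hz rfl rfl rfl rfl
    dsimp only at h1
    obtain ⟨c₁', c₂', h2⟩ := steps_power hX h1.2 hz rfl rfl rfl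
    dsimp only at h2
    have h3 := steps_trace hX h2.2 hP rfl rfl
    dsimp only at h3
    have h4 := steps_dual hX h3.2 hP hz (abs_sum_sym_mul_le φ (by linarith) hP)
      (abs_total_le φ ht.le) rfl rfl
    dsimp only at h4
    have h5 := (h1.mono (hYX _ hN2)).seq (h2.seq ((h3.mono (hYX _ hN2)).seq
      (h4.mono (hYX _ (hN1.trans hN2)))))
    have htb : |((t : ℤ) + 1)| < 2 ^ bits n m := by
      rw [abs_of_nonneg (by positivity)]
      exact lt_bits' (c := 1) (a := 9) (by norm_num) (by norm_num) (by norm_num)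
        (by rw [one_mul]; exact_mod_cast ht)
    refine ⟨_, h5.1, rfl, h5.2, φ.shifted (φ.dual t), φ.power (φ.dual t),
      (φ.power (φ.dual t)).trace, ∑ i, ∑ j, φ.sym i j * φ.power (φ.dual t) i j, (2 * n : ℕ), c₂', ?_,
      h5.2.set 15 0 htb⟩
    have e : φ.total (t + 1) = φ.total t + φ.roundPair (φ.dual t) := Finset.sum_range_succ _ _
    rw [set_15, e, Nat.cast_add_one]
    rfl
  · exact ⟨A₀, B₀, tr, num, c₁, c₂, by rw [set_15]; rfl, hs.set 15 0 (by simp)⟩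

/-- The number `max m 1`, by which the program divides. -/
def denom (m : ℕ) : ℤ := m + 1 / (m + 1)

theorem eval_eM' : eM'.eval (st.mem φ) = denom m := by
  have h := eval_eM φ st
  simp only [eM', Expr.eval, h]
  rfl

theorem denom_eq (hm : 0 < m) : denom m = m := by
  rw [denom, Int.ediv_eq_zero_of_lt (by norm_num) (by omega), add_zero]

theorem denom_zero : denom 0 = 1 := rfl

theorem denom_pos (m : ℕ) : 0 < denom m := by
  rcases Nat.eq_zero_or_pos m with rfl | hm
  · simp [denom_zero]
  · rw [denom_eq hm]; exact_mod_cast hm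

theorem denom_le_size : denom m ≤ size n m := by
  have h := size_ge n m
  rcases Nat.eq_zero_or_pos m with rfl | hm
  · rw [denom_zero]; linarith
  · rw [denom_eq hm]; exact le_size n m

theorem runs_output (hX : bits n m + 1 ≤ X) (hs : Small (bits n m) (st.mem φ))
    (hacc : |st.acc| ≤ (size n m : ℤ) ^ 25 * growth n m) :
    ∃ s, Runs X outputProg (st.mem φ) s ∧
      s 4 0 = 2 * (size n m : ℤ) ^ 17 * (denom m * denom m) +
        m * (st.acc + (size n m : ℤ) ^ 17) ∧
      s 4 1 = 4 * (size n m : ℤ) ^ 17 * (denom m * denom m) := by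
  have hr := size_ge n m
  have hg := growth_pos n m
  have hm := le_size n m
  have hd := denom_pos m
  have hd' := denom_le_size (n := n) (m := m)
  set x : ℤ := 2 * (size n m : ℤ) ^ 17 * (denom m * denom m) +
    m * (st.acc + (size n m : ℤ) ^ 17) with hx
  have hxb : |x| < 2 ^ bits n m := by
    refine lt_bits (c := 4) (a := 26) (by norm_num) (by norm_num) ?_
    have e1 : (size n m : ℤ) ^ 17 ≤ (size n m : ℤ) ^ 25 * growth n m :=
      (pow_le_pow_right₀ (by linarith) (by norm_num)).trans
        (le_mul_of_one_le_right (by positivity) hg)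
    have e2 : |st.acc + (size n m : ℤ) ^ 17| ≤ 2 * ((size n m : ℤ) ^ 25 * growth n m) := by
      refine (abs_add_le _ _).trans ?_
      rw [abs_of_nonneg (by positivity : (0 : ℤ) ≤ (size n m : ℤ) ^ 17)]
      linarith
    have e3 : (size n m : ℤ) ^ 19 ≤ (size n m : ℤ) ^ 26 * growth n m :=
      (pow_le_pow_right₀ (by linarith) (by norm_num)).trans
        (le_mul_of_one_le_right (by positivity) hg)
    calc |x| ≤ 2 * (size n m : ℤ) ^ 17 * (denom m * denom m) +
          m * |st.acc + (size n m : ℤ) ^ 17| := by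
          refine (abs_add_le _ _).trans (le_of_eq ?_)
          rw [abs_mul (m : ℤ), abs_of_nonneg (by positivity : (0 : ℤ) ≤ m), abs_of_nonneg]
          positivity
      _ ≤ 2 * (size n m : ℤ) ^ 17 * (size n m * size n m) +
          size n m * (2 * ((size n m : ℤ) ^ 25 * growth n m)) := by gcongr
      _ = 2 * (size n m : ℤ) ^ 19 + 2 * ((size n m : ℤ) ^ 26 * growth n m) := by ring
      _ ≤ _ := by linarith
  have h1 := Runs.assign hs hX 4 (.const 0)
      (.add (.mul (.mul (.const 2) (eR.pow 17)) (.mul eM' eM'))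
        (.mul eM (.add (.get 12 (.const 0)) (eR.pow 17))))
  simp only [Expr.eval, Expr.eval_pow, eval_eM', eval_eM, eval_eR, mem_12, cell_zero] at h1
  rw [← hx] at h1
  have h2 := hs.set 4 0 hxb
  have h3 := Runs.assign h2 hX 4 (.const 1) (.mul (.mul (.const 4) (eR.pow 17)) (.mul eM' eM'))
  -- the second assignment reads only cells of the input, which the first one leaves alone
  have eR' : eR.eval ((st.mem φ).set 4 0 x) = size n m := eval_eR φ st
  have eM'' : eM'.eval ((st.mem φ).set 4 0 x) = denom m := eval_eM' (φ := φ) (st := st)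
  simp only [Expr.eval, Expr.eval_pow, eR', eM''] at h3
  refine ⟨_, h1.seq h3, ?_, ?_⟩
  · simp [Memory.set]
  · simp [Memory.set]

/-- The program, run on the input `φ`, with a time bound that is polynomial in `n + m`. -/
theorem runs_refute (φ : Instance n m) :
    ∃ s, Runs ((size n m ^ 9 + 1) *
        ((size n m ^ 10 + 1) * ((size n m ^ 6 + 1) * (bits n m + 1)))) refuteProg φ.input s ∧
      s 4 0 = 2 * (size n m : ℤ) ^ 17 * (denom m * denom m) +
        m * (φ.total (size n m ^ 9) + (size n m : ℤ) ^ 17) ∧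
      s 4 1 = 4 * (size n m : ℤ) ^ 17 * (denom m * denom m) := by
  have hs := small_input φ
  rw [← mem_zero φ] at hs ⊢
  have h1 := steps_load le_rfl hs flat_zero.symm
  dsimp only at h1
  obtain ⟨st, hacc, h2⟩ := steps_iterate (A₀ := 0) (B₀ := 0) le_rfl h1.2 rfl flat_zero.symm
    flat_zero.symm flat_zero.symm (by funext i; simp [array, Instance.dual]) rfl
  obtain ⟨s, h3, h4, h5⟩ := runs_output le_rfl h2.2 (by rw [hacc]; exact abs_total_le φ le_rfl)
  rw [hacc] at h4
  have e1 : 1 ≤ size n m ^ 6 + 1 := by omega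
  have e2 : 1 ≤ size n m ^ 10 + 1 := by omega
  have e3 : m + 1 ≤ size n m ^ 9 + 1 := by
    have hr : 1000 ≤ size n m := by exact_mod_cast size_ge n m
    have hm : m ≤ size n m := by exact_mod_cast le_size n m
    exact Nat.add_le_add_right (hm.trans (Nat.le_self_pow (by norm_num) _)) 1
  have e4 : 2 * n * (2 * n) * (2 * n) ≤ size n m ^ 6 := by exact_mod_cast two_mul_cube_le n m
  have e5 : bits n m + 1 ≤ (size n m ^ 10 + 1) * ((size n m ^ 6 + 1) * (bits n m + 1)) :=
    (Nat.le_mul_of_pos_left _ e1).trans (Nat.le_mul_of_pos_left _ e2)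
  refine ⟨s, (h1.1.mono (Nat.mul_le_mul e3 e5)).seq ((h2.1.mono ?_).seq (h3.mono ?_)), h4, h5⟩
  · gcongr
  · exact e5.trans (Nat.le_mul_of_pos_left _ (by omega))

end Phases

end TwoXORRefutation

/-! ### The certified bound -/

namespace TwoXORRefutation

open Matrix

/-- The output of the algorithm. For `m > 0`, it is `1 / 2 + (S + 1 / 2) / (2 * m)`, where
`S = φ.total (R ^ 9) / (2 * R ^ 17)` approximates the value of the semidefinite relaxation, with
`R = size n m`. -/
def refute (n m : ℕ) (φ : Instance n m) : ℚ :=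
  ((2 * (size n m : ℤ) ^ 17 * (denom m * denom m) +
      m * (φ.total (size n m ^ 9) + (size n m : ℤ) ^ 17) : ℤ) : ℚ) /
    ((4 * (size n m : ℤ) ^ 17 * (denom m * denom m) : ℤ) : ℚ)

theorem polyTimeComputable_refute : PolyTimeComputable refute := by
  let S : Polynomial ℕ := Polynomial.X + Polynomial.C 1000
  refine ⟨refuteProg, Polynomial.C refuteProg.weight * ((S ^ 9 + 1) * ((S ^ 10 + 1) *
    ((S ^ 6 + 1) * (S * (40 + 22 * (S ^ 10 + 1)) + 1)))), fun n m φ => ?_⟩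
  obtain ⟨s, ⟨t, ht, h⟩, h0, h1⟩ := runs_refute φ
  refine ⟨s, t, h, ht.trans (le_of_eq ?_), ?_, ?_⟩
  · have hS : S.eval (n + m) = size n m := by simp [S, size]
    simp [hS, bits]
  · have hr := size_ge n m
    have hd := denom_pos m
    rw [h1]
    positivity
  · rw [h0, h1, refute]

theorem two_mul_refute_sub_one (n m : ℕ) (φ : Instance n m) :
    (2 * (refute n m φ : ℝ) - 1) * m =
      if m = 0 then 0 else φ.total (size n m ^ 9) / (2 * (size n m : ℝ) ^ 17) + 1 / 2 := by
  have hr : (0 : ℝ) < size n m := by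
    have := size_ge n m
    exact_mod_cast (by linarith : (0 : ℤ) < size n m)
  split_ifs with hm
  · simp [hm]
  · have hm' : 0 < m := Nat.pos_of_ne_zero hm
    have hmr : (m : ℝ) ≠ 0 := by exact_mod_cast hm
    rw [refute, denom_eq hm']
    push_cast
    field_simp
    ring

theorem sdpValue_matrix_bounds (n m : ℕ) (φ : Instance n m) :
    sdpValue φ.matrix ≤ (2 * (refute n m φ : ℝ) - 1) * m ∧
      (2 * (refute n m φ : ℝ) - 1) * m ≤ sdpValue φ.matrix + 1 := by
  rw [two_mul_refute_sub_one]
  split_ifs with hm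
  · subst hm
    have h1 := sdpValue_nonneg φ.matrix
    have h2 := sdpValue_matrix_le φ
    simp at h2
    constructor <;> linarith
  · have hn : 0 < n := (φ.edge ⟨0, Nat.pos_of_ne_zero hm⟩).1.1.pos
    exact total_bounds φ hn

theorem norm_sgn_sq (s : ℤˣ) : ‖sgn s‖ ^ 2 = 1 := by
  rcases Int.units_eq_one_or s with h | h <;> simp [h, sgn]

theorem valAt_le (n m : ℕ) (φ : Instance n m) (hm : 0 < m) (x : Fin n → ℤˣ) :
    (2 * φ.valAt x - 1) * m ≤ sdpValue φ.matrix := by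
  have h1 : (2 * φ.valAt x - 1) * m =
      ∑ e, sgn (φ.sign e) * (sgn (x (φ.edge e).1.1) * sgn (x (φ.edge e).1.2)) := by
    have hmr : (m : ℝ) ≠ 0 := by exact_mod_cast hm.ne'
    have : ∀ e, sgn (φ.sign e) * (sgn (x (φ.edge e).1.1) * sgn (x (φ.edge e).1.2)) =
        2 * (if x (φ.edge e).1.1 * x (φ.edge e).1.2 * φ.sign e = 1 then 1 else 0) - 1 := by
      intro e
      rw [mul_comm, ← sgn_mul, ← sgn_mul]
      rcases Int.units_eq_one_or (x (φ.edge e).1.1 * x (φ.edge e).1.2 * φ.sign e) with h | h <;>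
        rw [h] <;> norm_num [sgn]
    rw [Finset.sum_congr rfl fun e _ => this e, Finset.sum_sub_distrib, ← Finset.mul_sum,
      Finset.sum_boole, Instance.valAt]
    simp
    field_simp
  have h2 := sum_inner_le_sdpValue φ.matrix (fun i => sgn (x i)) (fun i => sgn (x i)) one_pos
    (fun i => (norm_sgn_sq _).le) fun i => (norm_sgn_sq _).le
  rw [one_mul, sum_matrix_mul φ fun a b => inner ℝ (sgn (x a)) (sgn (x b))] at h2
  rw [h1]
  refine le_trans (le_of_eq (Finset.sum_congr rfl fun e _ => ?_)) h2
  rw [real_inner_eq_re_inner, RCLike.inner_apply]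
  simp [mul_comm]

theorem val_le_refute (n m : ℕ) (φ : Instance n m) : φ.val ≤ refute n m φ := by
  refine ciSup_le fun x => ?_
  rcases Nat.eq_zero_or_pos m with rfl | hm
  · have h : (0 : ℚ) ≤ refute n 0 φ := by
      rw [refute, denom_zero, Nat.cast_zero, zero_mul, add_zero]
      positivity
    have h' : φ.valAt x = 0 := by simp [Instance.valAt]
    rw [h']
    exact_mod_cast h
  · have h := (valAt_le n m φ hm x).trans (sdpValue_matrix_bounds n m φ).1
    have hm' : (0 : ℝ) < m := by exact_mod_cast hm
    have := le_of_mul_le_mul_right h hm'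
    linarith

/-- For random signs, the value of the relaxation is at most `ε * m`. The constant `96 ^ 2` makes up
for the Grothendieck constant, and the error `1` of the algorithm is at most a second `ε * m`. -/
theorem signProb_refute_le (c : ℕ) {n m : ℕ} (E : Fin m → Edge n) {ε : ℝ} (hn : 0 < n)
    (hε : 0 < ε) (hε' : ε < 1 / 2) (h : 96 ^ 2 * (2 * c + 4) * (n : ℝ) / ε ^ 2 ≤ m) :
    1 - 1 / (n : ℝ) ^ c ≤ signProb fun r => (refute n m ⟨E, r⟩ : ℝ) ≤ 1 / 2 + ε := by
  have hn' : (1 : ℝ) ≤ n := by exact_mod_cast hn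
  rw [div_le_iff₀ (by positivity)] at h
  have hc : (0 : ℝ) ≤ c := by positivity
  have h1 : (2 * c + 4) * (n : ℝ) ≤ (ε / 96) ^ 2 * m := by
    rw [div_pow, div_mul_eq_mul_div, le_div_iff₀ (by norm_num)]
    linarith
  have h2 : 1 ≤ ε * m := by
    have h3 : 1 ≤ m * ε ^ 2 := by
      refine le_trans ?_ h
      nlinarith [mul_nonneg hc (by linarith : (0 : ℝ) ≤ n)]
    have h4 : (m : ℝ) * ε ^ 2 ≤ ε * m := by
      rw [sq, ← mul_assoc, mul_comm ε]
      exact mul_le_of_le_one_right (by positivity) (by linarith)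
    linarith
  have hm : (0 : ℝ) < m := by
    by_contra hm
    nlinarith
  refine (signProb_sdpValue_le_pow c hn E (by positivity) h1).trans (signProb_mono fun r hr => ?_)
  have h5 := (sdpValue_matrix_bounds n m ⟨E, r⟩).2
  have h6 : (2 * (refute n m ⟨E, r⟩ : ℝ) - 1) * m ≤ (2 * ε) * m := by linarith
  have := le_of_mul_le_mul_right h6 hm
  linarith

end TwoXORRefutation

theorem mainTheorem5 :
    ∃ A : (n m : ℕ) → TwoXORRefutation.Instance n m → ℚ,
      -- the algorithm is efficient
      TwoXORRefutation.PolyTimeComputable A ∧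
      -- its output is always a valid upper bound on the value of the instance
      (∀ (n m : ℕ) (φ : TwoXORRefutation.Instance n m), φ.val ≤ (A n m φ : ℝ)) ∧
      -- the certificate is the value of the semidefinite relaxation, computed up to an error of 1
      (∀ (n m : ℕ) (φ : TwoXORRefutation.Instance n m),
        TwoXORRefutation.sdpValue φ.matrix ≤ (2 * (A n m φ : ℝ) - 1) * (m : ℝ) ∧
        (2 * (A n m φ : ℝ) - 1) * (m : ℝ) ≤ TwoXORRefutation.sdpValue φ.matrix + 1) ∧
      -- for arbitrary constraints and random signs, the bound is good with high probability
      (∀ c : ℕ, ∃ K : ℝ, 0 < K ∧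
        ∀ (n m : ℕ) (E : Fin m → TwoXORRefutation.Edge n) (ε : ℝ),
          0 < n → 0 < ε → ε < 1 / 2 → K * (n : ℝ) / ε ^ 2 ≤ (m : ℝ) →
          1 - 1 / (n : ℝ) ^ c ≤
            TwoXORRefutation.signProb (fun r : Fin m → ℤˣ =>
              (A n m ⟨E, r⟩ : ℝ) ≤ 1 / 2 + ε)) := by
  refine ⟨TwoXORRefutation.refute, TwoXORRefutation.polyTimeComputable_refute,
    TwoXORRefutation.val_le_refute, TwoXORRefutation.sdpValue_matrix_bounds,
    fun c => ⟨96 ^ 2 * (2 * c + 4), by positivity, fun n m E ε hn hε hε' h => ?_⟩⟩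
  exact TwoXORRefutation.signProb_refute_le c E hn hε hε' h
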